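/- **Setting.** Let $I\subset\mathbb R$ be open, and let $g$ be a smooth metric of signature $(+,-,-,-)$ on $I\times(0,\infty)\times S^2$ (coordinates $u,r,x^A$; indices $0,1,A$) in the affine Bondi gauge $$g=du\,(g_{00}\,du+2\,dr+2\omega_A\,dx^A)+g_{AB}\,dx^A dx^B ,$$ with $g_{AB}$ negative definite with inverse $g^{AB}$, and $\omega^A=g^{AB}\omega_B$. Let $s_{AB}$ be the standard metric of $S^2$, $\sigma=\sqrt{\det g_{AB}}$, $\sigma_s=\sqrt{\det s_{AB}}$, and $\hat g_{AB}=r^{-2}g_{AB}$ with inverse $\hat g^{AB}$. Let $T_{\mu\nu}$ be a symmetric tensor, $T=T^\mu{}_\mu$, and $R_{\mu\nu}$ the Ricci tensor of $g$ (with the sign convention in which round spheres with their positive definite metric have positive Ricci curvature). Fix $u\in I$ and assume on the cone $u=\mathrm{const}$: 1. (Asymptotics.) As $r\to\infty$, uniformly on $S^2$, $$\omega_A=\psi_A+\kappa_A r^{-1}+O(r^{-2}),\qquad g_{AB}=-s_{AB}r^2+n_{AB}r+m_{AB}+O(r^{-1}),$$ $$g_{00}=1+\tfrac12\,\partial_u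 n^A{}_A-\tfrac{2M}{r}+O(r^{-2}),$$ where the coefficients, and $\partial_u n_{AB},\partial_u m_{AB}$, are continuous on $S^2$, $n^A{}_A=-s^{AB}n_{AB}$, and the expansion of $g_{AB}$ may be differentiated once in $r$ (remainder $O(r^{-2})$) or once in $u$ (remainder $O(r^{-1})$). 2. (Regular vertex at $r=0$.) As $r\to0$, uniformly on $S^2$: $r^{-2}\sigma/\sigma_s$ converges to a nowhere vanishing continuous function, $\sigma_{,u}/\sigma_s\to0$, $\sigma_{,r}/\sigma_s\to0$, and $|g_{00}-\omega_A\omega^A|$ stays bounded. 3. (Einstein equations.) $R_{11}=T_{11}$ and $g^{AB}R_{AB}=g^{AB}T_{AB}-T$ for all $0<r<\infty$. The Bondi mass aspect $M'$ of the cone is the continuous function on $S^2$ with $g'_{00}=1-2M'/r'+O(r'^{-2})$ uniformly on $S^2$, where $g'_{00}$ is the $00$-component of $g$ in the coordinates $(u,r',x^A)$ with the luminosity distance $r'=(\sigma/\sigma_s)^{1/2}$, which is an admissible coordinate for large $r$. The Trautman–Bondi energy is $E=\frac1{4\pi}\int_{S^2}M'\sigma_s\,d^2x$. **Proposition 3.1.**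 The energy $E$ of the cone is well defined, and $$16\pi E=-\int_0^\infty dr\int_{S^2}\Big(\tfrac14 r^2\sigma_s\,\hat g_{AB,r}\hat g^{AB}{}_{,r}+\tfrac12\sigma g_{AB}\,\omega^A{}_{,r}\omega^B{}_{,r}\Big)d^2x+\int_0^\infty dr\int_{S^2}\Big(r^2\sigma_sT_{11}+\sigma\,(T-g^{AB}T_{AB})\Big)d^2x .$$ Here the first term, including its minus sign, has a non-negative integrand. In general the right-hand side is understood as the limit, for $r_1\to0$ and $r_2\to\infty$, of the sum of the two terms with $\int_0^\infty dr$ replaced by $\int_{r_1}^{r_2}dr$. If the matter integral over the sphere is integrable in $r$ on $(0,\infty)$, then so is the geometric one, and the formula holds with two separate Lebesgue integrals over $(0,\infty)$. If $T_{\mu\nu}$ satisfies the dominant energy condition on the cone (for every timelike $v$: $T_{\alpha\beta}v^\alpha v^\beta\ge0$ and $T^\alpha{}_\beta v^\beta$ is not spacelike), then the matter integrand is non-negative as well, both integrals converge, and $E\ge0$. -/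

import Mathlib

open MeasureTheory Filter Topology Matrix
open scoped ContDiff

noncomputable section

namespace NullCone

/-! ## The manifold

The spacetime carries Bondi coordinates `(u, r, x)` with `u` in an open set `I` of reals,
`0 < r < ∞` and `x` in the unit sphere `S²`.  The manifold `I × (0, ∞) × S²` is identified with
`I × (ℝ³ ∖ {0})` by `(u, r, x) ↦ (u, r x)`, so that one global chart of `ℝ⁴` covers it (the vertex
`r = 0` is not part of it).  Tensor fields are given by their components in this chart;
the index `0` belongs to `u`, the indices `1, 2, 3` to `ℝ³`. -/

/-- The unit sphere `S²`. -/
abbrev S2 : Type := Metric.sphere (0 : EuclideanSpace ℝ (Fin 3)) 1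

/-- Points and vectors of the chart. -/
abbrev V4 : Type := Fin 4 → ℝ

/-- Components of a tensor with two indices at a point. -/
abbrev M4 : Type := Matrix (Fin 4) (Fin 4) ℝ

/-- Tensors with two indices on a tangent plane `x^⊥` of the sphere are written as
`3 × 3` matrices that are annihilated by `x` on both sides. -/
abbrev M3 : Type := Matrix (Fin 3) (Fin 3) ℝ

/-- The area measure of the standard metric `s_AB` on the sphere, `σ_s d²x`; its total mass
is `4π`. -/
def sphereArea : Measure S2 := (volume : Measure (EuclideanSpace ℝ (Fin 3))).toSphere

/-- The position vector of a point of the sphere. -/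
def pos (x : S2) : Fin 3 → ℝ := fun i => x.1 i

/-- The matrix `x xᵀ`, the orthogonal projection on the normal direction of the sphere. -/
def normalProj (x : S2) : M3 := vecMulVec (pos x) (pos x)

/-- The orthogonal projection on the tangent plane of the sphere; as a covariant tensor it is
the standard metric `s_AB`. -/
def tangentProj (x : S2) : M3 := 1 - normalProj x

/-- The point of the chart with Bondi coordinates `(u, r, x)`. -/
def pt (u r : ℝ) (x : S2) : V4 := Fin.cons u (fun i => r * pos x i)

/-- The domain `I × (ℝ³ ∖ {0})`. -/
def region (I : Set ℝ) : Set V4 := {p | p 0 ∈ I ∧ Fin.tail p ≠ 0}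

/-- The coordinate vector `∂_u` (at fixed `r` and `x`). -/
def dU : V4 := Fin.cons 1 0

/-- The coordinate vector `∂_r` (at fixed `u` and `x`). -/
def dR (x : S2) : V4 := Fin.cons 0 (pos x)

/-- A spatial vector. -/
def spatial (e : Fin 3 → ℝ) : V4 := Fin.cons 0 e

/-- The value `B(v, w)` of a covariant tensor on two vectors. -/
def val (B : M4) (v w : V4) : ℝ := v ⬝ᵥ (B *ᵥ w)

/-! ## The Ricci tensor -/

/-- The partial derivative with respect to the `i`-th coordinate of the chart. -/
def pd (i : Fin 4) (f : V4 → ℝ) (p : V4) : ℝ := fderiv ℝ f p (Pi.single i 1)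

/-- The Christoffel symbols `Γ^l_{ij}`. -/
def christoffel (g : V4 → M4) (l i j : Fin 4) (p : V4) : ℝ :=
  (1 / 2) * ∑ m, (g p)⁻¹ l m *
    (pd i (fun q => g q j m) p + pd j (fun q => g q i m) p - pd m (fun q => g q i j) p)

/-- The Ricci tensor
`R_ij = ∂_k Γ^k_ij - ∂_j Γ^k_ik + Γ^k_kl Γ^l_ij - Γ^k_jl Γ^l_ik`. -/
def ricci (g : V4 → M4) (p : V4) : M4 :=
  Matrix.of fun i j => ∑ k,
    (pd k (christoffel g k i j) p - pd j (christoffel g k i k) p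
      + ∑ l, (christoffel g k k l p * christoffel g l i j p
        - christoffel g k j l p * christoffel g l i k p))

/-! ## Angular components

A tangent vector `e ∈ x^⊥` of the sphere, moved to the sphere of radius `r`, is the spatial
vector `r e`; this is how the coordinate vectors `∂_A` look in the chart. -/

/-- The angular part `B_AB` of a covariant tensor `B` at the point `(u, r, x)`. -/
def angular (r : ℝ) (x : S2) (B : M4) : M3 :=
  r ^ 2 • (tangentProj x * B.submatrix Fin.succ Fin.succ * tangentProj x)

/-- The inverse of a nondegenerate tensor `A_AB` on the tangent plane `x^⊥`
(invert `A` on `x^⊥` and extend by zero). -/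
def tangentInv (x : S2) (A : M3) : M3 := (A + normalProj x)⁻¹ - normalProj x

/-- The quotient `det A_AB / det s_AB`, that is the determinant of `A` with respect to
an orthonormal basis of the tangent plane `x^⊥`. -/
def tangentDet (x : S2) (A : M3) : ℝ := (A + normalProj x).det

/-- The component `g_00`. -/
def g00 (g : V4 → M4) (u r : ℝ) (x : S2) : ℝ := val (g (pt u r x)) dU dU

/-- The components `g_AB`. -/
def gAB (g : V4 → M4) (u r : ℝ) (x : S2) : M3 := angular r x (g (pt u r x))

/-- The inverse `g^AB` of `g_AB`. -/
def gABinv (g : V4 → M4) (u r : ℝ) (x : S2) : M3 := tangentInv x (gAB g u r x)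

/-- The rescaled metric `ĝ_AB = r⁻² g_AB`. -/
def gHat (g : V4 → M4) (u r : ℝ) (x : S2) : M3 := (r ^ 2)⁻¹ • gAB g u r x

/-- The inverse `ĝ^AB` of `ĝ_AB`. -/
def gHatInv (g : V4 → M4) (u r : ℝ) (x : S2) : M3 := tangentInv x (gHat g u r x)

/-- The quotient `σ / σ_s`, where `σ² = det g_AB` and `σ_s² = det s_AB`. -/
def sigma (g : V4 → M4) (u r : ℝ) (x : S2) : ℝ := √(tangentDet x (gAB g u r x))

/-- The components `ω_A = g_0A`. -/
def omegaLow (g : V4 → M4) (u r : ℝ) (x : S2) : Fin 3 → ℝ :=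
  r • (tangentProj x *ᵥ fun i => g (pt u r x) 0 i.succ)

/-- The components `ω^A = g^AB ω_B`. -/
def omegaUp (g : V4 → M4) (u r : ℝ) (x : S2) : Fin 3 → ℝ :=
  gABinv g u r x *ᵥ omegaLow g u r x

/-! ## Metrics in the affine Bondi gauge -/

/-- `g = du (g_00 du + 2 dr + 2 ω_A dx^A) + g_AB dx^A dx^B` on `I × (0, ∞) × S²`, with smooth
components and negative definite `g_AB` (signature `+ - - -`). -/
structure IsAffineBondi (g : V4 → M4) (I : Set ℝ) : Prop where
  smooth : ∀ i j, ContDiffOn ℝ ∞ (fun p => g p i j) (region I)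
  symm : ∀ p ∈ region I, (g p).IsSymm
  g_rr : ∀ u ∈ I, ∀ r > 0, ∀ x, val (g (pt u r x)) (dR x) (dR x) = 0
  g_ur : ∀ u ∈ I, ∀ r > 0, ∀ x, val (g (pt u r x)) dU (dR x) = 1
  g_rA : ∀ u ∈ I, ∀ r > 0, ∀ x, ∀ e : Fin 3 → ℝ, e ⬝ᵥ pos x = 0 →
    val (g (pt u r x)) (dR x) (spatial e) = 0
  negDef : ∀ u ∈ I, ∀ r > 0, ∀ x, ∀ e : Fin 3 → ℝ, e ⬝ᵥ pos x = 0 → e ≠ 0 →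
    val (g (pt u r x)) (spatial e) (spatial e) < 0

/-! ## Asymptotic conditions -/

/-- `F = O(r^{-k})` for `r → ∞`, uniformly on the sphere. -/
def BigO (k : ℕ) (F : ℝ → S2 → ℝ) : Prop :=
  ∃ C R : ℝ, 0 < R ∧ ∀ r ≥ R, ∀ x, |F r x| ≤ C / r ^ k

/-- The trace `n^A_A` of a tensor `n_AB` whose indices are raised with the inverse of the leading
part `-s_AB` of the metric `r⁻² g_AB`. -/
def sTrace (x : S2) (n : M3) : ℝ := -(tangentProj x * n).trace

/-- The entrywise derivative of a matrix function of one real variable. -/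
def matDeriv (F : ℝ → M3) (t : ℝ) : M3 := Matrix.of fun i j => deriv (fun s => F s i j) t

/-- The expansions for `r → ∞` on the cone with label `u`:
`ω_A = ψ_A + κ_A r⁻¹ + O(r⁻²)`,
`g_AB = -s_AB r² + n_AB r + m_AB + O(r⁻¹)`, which may be differentiated once with respect to
`r` or `u`, and `g_00 = 1 + (1/2) ∂_u n^A_A - 2 M r⁻¹ + O(r⁻²)`. -/
structure IsAsymptotic (g : V4 → M4) (u : ℝ) (ψ κ : S2 → Fin 3 → ℝ) (n m : ℝ → S2 → M3)
    (M : S2 → ℝ) : Prop where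
  cont_ψ : Continuous ψ
  cont_κ : Continuous κ
  cont_n : Continuous (n u)
  cont_m : Continuous (m u)
  cont_M : Continuous M
  diff_n : ∀ x i j, DifferentiableAt ℝ (fun v => n v x i j) u
  diff_m : ∀ x i j, DifferentiableAt ℝ (fun v => m v x i j) u
  cont_ndot : Continuous fun x => matDeriv (fun v => n v x) u
  cont_mdot : Continuous fun x => matDeriv (fun v => m v x) u
  expand_omega : ∀ i, BigO 2 fun r x => omegaLow g u r x i - (ψ x i + κ x i / r)
  expand_gAB : ∀ i j, BigO 1 fun r x =>
    gAB g u r x i j - (-(tangentProj x i j) * r ^ 2 + n u x i j * r + m u x i j)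
  expand_gAB_r : ∀ i j, BigO 2 fun r x =>
    matDeriv (fun s => gAB g u s x) r i j - (-(tangentProj x i j) * (2 * r) + n u x i j)
  expand_gAB_u : ∀ i j, BigO 1 fun r x =>
    matDeriv (fun v => gAB g v r x) u i j
      - (matDeriv (fun v => n v x) u i j * r + matDeriv (fun v => m v x) u i j)
  expand_g00 : BigO 2 fun r x =>
    g00 g u r x - (1 + (1 / 2) * sTrace x (matDeriv (fun v => n v x) u) - 2 * M x / r)

/-! ## Regularity at the vertex -/

/-- The conditions at the vertex `r = 0` of the cone with label `u`: `lim r⁻² σ ≠ 0`,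
`σ_{,u} = σ_{,r} = 0` and `|g_00 - ω_A ω^A| < ∞` at `r = 0`.  Values at `r = 0` are limits for
`r → 0`, uniform on the sphere. -/
structure IsVertexRegular (g : V4 → M4) (u : ℝ) : Prop where
  sigma_lim : ∃ L : S2 → ℝ, Continuous L ∧ (∀ x, L x ≠ 0) ∧
    TendstoUniformly (fun r x => sigma g u r x / r ^ 2) L (𝓝[>] 0)
  sigma_u : TendstoUniformly (fun r x => deriv (fun v => sigma g v r x) u) (fun _ => 0) (𝓝[>] 0)
  sigma_r : TendstoUniformly (fun r x => deriv (fun s => sigma g u s x) r) (fun _ => 0) (𝓝[>] 0)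
  bounded : ∃ C : ℝ, ∀ᶠ r in 𝓝[>] (0 : ℝ), ∀ x,
    |g00 g u r x - omegaLow g u r x ⬝ᵥ omegaUp g u r x| ≤ C

/-! ## The energy -/

/-- The luminosity distance `r' = (σ / σ_s)^{1/2}`. -/
def lumDist (g : V4 → M4) (u r : ℝ) (x : S2) : ℝ := √(sigma g u r x)

/-- The coordinate vector `∂_u` of the coordinates `(u, r', x)`, in which `r'` and `x` are
kept fixed: `∂_u - (r'_{,u} / r'_{,r}) ∂_r`. -/
def dULum (g : V4 → M4) (u r : ℝ) (x : S2) : V4 :=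
  dU - (deriv (fun v => lumDist g v r x) u / deriv (fun s => lumDist g u s x) r) • dR x

/-- The component `g'_00` in the Bondi coordinates `(u, r', x)`. -/
def g00Lum (g : V4 → M4) (u r : ℝ) (x : S2) : ℝ :=
  val (g (pt u r x)) (dULum g u r x) (dULum g u r x)

/-- `M'` is the Bondi mass aspect of the cone with label `u`: for large `r` the luminosity
distance `r'` is an admissible coordinate and `g'_00 = 1 - 2 M' / r' + O(r'⁻²)`, uniformly on
the sphere. -/
def IsBondiMassAspect (g : V4 → M4) (u : ℝ) (M' : S2 → ℝ) : Prop :=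
  Continuous M' ∧ ∃ C R : ℝ, 0 < R ∧ ∀ r ≥ R, ∀ x,
    0 < lumDist g u r x ∧ 0 < deriv (fun s => lumDist g u s x) r ∧
    |g00Lum g u r x - (1 - 2 * M' x / lumDist g u r x)| ≤ C / lumDist g u r x ^ 2

/-- `E` is the Trautman-Bondi energy `(4π)⁻¹ ∫ M' σ_s d²x` of the cone with label `u`. -/
def IsTrautmanBondiEnergy (g : V4 → M4) (u E : ℝ) : Prop :=
  ∃ M' : S2 → ℝ, IsBondiMassAspect g u M' ∧
    E = (1 / (4 * Real.pi)) * ∫ x, M' x ∂sphereArea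

/-! ## Matter -/

/-- The component `T_11`. -/
def comp11 (x : S2) (B : M4) : ℝ := val B (dR x) (dR x)

/-- The contraction `g^AB B_AB`. -/
def angTrace (g : V4 → M4) (u r : ℝ) (x : S2) (B : M4) : ℝ :=
  (gABinv g u r x * angular r x B).trace

/-- The trace `T = T^μ_μ` at a point. -/
def fullTrace (g T : V4 → M4) (p : V4) : ℝ := ((g p)⁻¹ * T p).trace

/-- The Einstein equations `R_11 = T_11` and `g^AB R_AB = g^AB T_AB - T` on the cone with
label `u`. -/
structure EinsteinEqs (g T : V4 → M4) (u : ℝ) : Prop where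
  eq11 : ∀ r > 0, ∀ x, comp11 x (ricci g (pt u r x)) = comp11 x (T (pt u r x))
  eqAB : ∀ r > 0, ∀ x, angTrace g u r x (ricci g (pt u r x)) =
    angTrace g u r x (T (pt u r x)) - fullTrace g T (pt u r x)

/-- The dominant energy condition on the cone with label `u`: for every timelike vector `v`,
`T_αβ v^α v^β ≥ 0` and the vector `T^α_β v^β` is not spacelike. -/
def DominantEnergy (g T : V4 → M4) (u : ℝ) : Prop :=
  ∀ r > 0, ∀ x, ∀ v : V4, 0 < val (g (pt u r x)) v v →
    0 ≤ val (T (pt u r x)) v v ∧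
    0 ≤ val (g (pt u r x)) (((g (pt u r x))⁻¹ * T (pt u r x)) *ᵥ v)
      (((g (pt u r x))⁻¹ * T (pt u r x)) *ᵥ v)

/-! ## The two integrands, relative to `σ_s d²x` -/

/-- `-((1/4) r² ĝ_{AB,r} ĝ^{AB}_{,r} + (1/2) (σ / σ_s) g_AB ω^A_{,r} ω^B_{,r})`. -/
def geomDensity (g : V4 → M4) (u r : ℝ) (x : S2) : ℝ :=
  -((1 / 4) * r ^ 2 *
      (∑ i, ∑ j, matDeriv (fun s => gHat g u s x) r i j * matDeriv (fun s => gHatInv g u s x) r i j)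
    + (1 / 2) * sigma g u r x *
      (∑ i, ∑ j, gAB g u r x i j * deriv (fun s => omegaUp g u s x i) r
        * deriv (fun s => omegaUp g u s x j) r))

/-- `r² T_11 + (σ / σ_s) (T - g^AB T_AB)`. -/
def matterDensity (g T : V4 → M4) (u r : ℝ) (x : S2) : ℝ :=
  r ^ 2 * comp11 x (T (pt u r x))
    + sigma g u r x * (fullTrace g T (pt u r x) - angTrace g u r x (T (pt u r x)))

/-- The integral of the geometric terms over the sphere of affine radius `r`. -/
def geomFlux (g : V4 → M4) (u r : ℝ) : ℝ := ∫ x, geomDensity g u r x ∂sphereArea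

/-- The integral of the matter terms over the sphere of affine radius `r`. -/
def matterFlux (g T : V4 → M4) (u r : ℝ) : ℝ := ∫ x, matterDensity g T u r x ∂sphereArea

end NullCone

end

noncomputable section

namespace NullCone

/-! ## Calculus in the chart -/

/-! The two field equations combine into a balance law along the generators of the cone. For every
vector field X, Ric(X, X) = div(∇_X X − (div X) X) + (div X)² − tr(∇X ∘ ∇X) (`ricci_self'`). This
identity is used for two kinds of fields.

For the generator k = ∂_r, which is geodesic and the gradient of u, it is the Raychaudhuri equation.
With expansion θ = σ_{,r}/σ it says that r² R_11 plus the quadratic term in ĝ_{AB,r} equals ∂_r(2r −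
r²θ) (`focusing`).

For the angular contraction the identity is summed over a frame of the tangent planes of the
spheres. A global smooth orthonormal frame does not exist on S², so three fields E_a are used, the
columns of the square root of −ĝ^AB. They form a tight frame with Σ x_a E_a = 0, where x is the unit
position vector. After a constant rotation adapted to one point they become there an orthonormal
pair and a field that vanishes at the point. The pair produces the ω^A_{,r} term, through the
commutator of the two null fields (`twist`). The third field vanishes at the point but has a
non-zero derivative, and it produces 2/(r²ρ), where r²ρ = σ/σ_s (`sum_quadratic`). Multiplied by
σ/σ_s this is the constant 2, which plays the role of the Gauss–Bonnet theorem; the curvature of the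
spheres is never computed. The remaining divergence splits into a radial derivative and a divergence
over the spheres.

Adding both parts (`balance`), geometric plus matter density is the radial derivative of `potential`
up to a spherical divergence. Spherical divergences integrate to zero (`integral_div3_eq_zero`), so
the flux through r_1 ≤ r ≤ r_2 is the difference of the sphere integrals of W = 4r − r²σ_{,r}/σ +
2σ_{,u} − (g_00 − ω_Aω^A)σ_{,r} (`conePotential`). Since g'_00 = g_00 − 2σ_{,u}/σ_{,r}, also W = 4r
− σ_{,r}(r²/σ + g'_00 − ω_Aω^A). The expansions at infinity then give W → 4M' uniformly, while W → 0
at the vertex. This is the formula, because 4∫M' = 16πE.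

For the signs, the geometric density is the trace of the square of a symmetric matrix minus a
negative semidefinite form. The matter density is r²T(k,k) + 2(σ/σ_s)T(k,l), and both components are
limits of the dominant energy condition on the timelike vectors k + εl. Convergence of the separate
integrals follows from non-negativity and convergence of the truncated sum. -/

theorem isOpen_region {I : Set ℝ} (hI : IsOpen I) : IsOpen (region I) := by
  have h1 : Continuous fun p : V4 => p 0 := continuous_apply 0
  have h2 : Continuous fun p : V4 => Fin.tail p :=
    continuous_pi fun i => continuous_apply i.succ
  exact (hI.preimage h1).inter (isOpen_ne.preimage h2)

theorem fderiv_eq_sum_pd (f : V4 → ℝ) (p v : V4) : fderiv ℝ f p v = ∑ i, v i * pd i f p := by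
  conv_lhs => rw [pi_eq_sum_univ' v]
  simp [pd, map_sum]

theorem _root_.ContDiffOn.pd {f : V4 → ℝ} {U : Set V4} (hU : IsOpen U) (hf : ContDiffOn ℝ ∞ f U)
    (i : Fin 4) : ContDiffOn ℝ ∞ (pd i f) U :=
  (hf.fderiv_of_isOpen hU (m := ∞) (by simp)).clm_apply contDiffOn_const

theorem pd_comm {f : V4 → ℝ} {p : V4} (hf : ContDiffAt ℝ ∞ f p) (i j : Fin 4) :
    pd i (pd j f) p = pd j (pd i f) p := by
  have hs : IsSymmSndFDerivAt ℝ f p := hf.isSymmSndFDerivAt (by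
    rw [minSmoothness_of_isRCLikeNormedField]; exact WithTop.coe_le_coe.2 (le_top : (2 : ℕ∞) ≤ ⊤))
  have hd : DifferentiableAt ℝ (fderiv ℝ f) p :=
    (hf.fderiv_right (m := 1) (by norm_cast)).differentiableAt (by simp)
  have key : ∀ a b : Fin 4, pd a (pd b f) p
      = fderiv ℝ (fderiv ℝ f) p (Pi.single a 1) (Pi.single b 1) := by
    intro a b
    change fderiv ℝ (fun q => fderiv ℝ f q (Pi.single b 1)) p (Pi.single a 1) = _
    rw [fderiv_clm_apply hd (differentiableAt_const _)]
    simp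
  rw [key, key, hs.eq]

section pdrules

variable {f h : V4 → ℝ} {p : V4}

theorem pd_add (hf : DifferentiableAt ℝ f p) (hh : DifferentiableAt ℝ h p) (i : Fin 4) :
    pd i (fun q => f q + h q) p = pd i f p + pd i h p := by
  simp [pd, fderiv_fun_add hf hh]

theorem pd_sub (hf : DifferentiableAt ℝ f p) (hh : DifferentiableAt ℝ h p) (i : Fin 4) :
    pd i (fun q => f q - h q) p = pd i f p - pd i h p := by
  simp [pd, fderiv_fun_sub hf hh]

theorem pd_mul (hf : DifferentiableAt ℝ f p) (hh : DifferentiableAt ℝ h p) (i : Fin 4) :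
    pd i (fun q => f q * h q) p = f p * pd i h p + pd i f p * h p := by
  simp [pd, fderiv_fun_mul hf hh]; ring

theorem pd_const_mul (c : ℝ) (hh : DifferentiableAt ℝ h p) (i : Fin 4) :
    pd i (fun q => c * h q) p = c * pd i h p := by
  simp [pd, fderiv_const_mul hh]

theorem pd_const (c : ℝ) (i : Fin 4) : pd i (fun _ => c) p = 0 := by
  simp [pd]

theorem pd_sum {ι : Type*} {s : Finset ι} {F : ι → V4 → ℝ}
    (hF : ∀ a ∈ s, DifferentiableAt ℝ (F a) p) (i : Fin 4) :
    pd i (fun q => ∑ a ∈ s, F a q) p = ∑ a ∈ s, pd i (F a) p := by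
  simp [pd, fderiv_fun_sum hF]

theorem pd_congr (hfh : f =ᶠ[𝓝 p] h) (i : Fin 4) : pd i f p = pd i h p := by
  simp [pd, hfh.fderiv_eq]

end pdrules

/-! ## The covariant derivative -/

/-- The components `∇_j X^i` of the covariant derivative of a vector field. -/
def cov (g : V4 → M4) (X : V4 → V4) (p : V4) : M4 :=
  Matrix.of fun i j => pd j (fun q => X q i) p + ∑ l, christoffel g i l j p * X p l

/-- The divergence of a vector field. -/
def divg (g : V4 → M4) (X : V4 → V4) (p : V4) : ℝ := (cov g X p).trace

set_option maxHeartbeats 4000000 in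
-- Once Γ is symmetric in its lower indices and second derivatives of X commute, the contracted
-- Ricci identity is a polynomial identity. Here Γ, X and their derivatives are independent
-- variables: `dΓ m k i j` stands for ∂_m Γ^k_ij, `dX i j` for ∂_j X^i and `ddX a i j` for ∂_i ∂_j
-- X^a.
theorem contracted_ricci_algebra (Γ : Fin 4 → Fin 4 → Fin 4 → ℝ)
    (dΓ : Fin 4 → Fin 4 → Fin 4 → Fin 4 → ℝ) (X : Fin 4 → ℝ) (dX : Fin 4 → Fin 4 → ℝ)
    (ddX : Fin 4 → Fin 4 → Fin 4 → ℝ)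
    (hΓ : ∀ k i j, Γ k i j = Γ k j i) (hX : ∀ a i j, ddX a i j = ddX a j i) :
    ∑ i, ∑ j, X i * X j * (∑ k, (dΓ k k i j - dΓ j k i k
      + ∑ l, (Γ k k l * Γ l i j - Γ k j l * Γ l i k))) =
    (∑ i, (∑ j, ((ddX i i j + ∑ l, (dΓ i i l j * X l + Γ i l j * dX l i)) * X j
        + (dX i j + ∑ l, Γ i l j * X l) * dX j i)
      + ∑ l, Γ i l i * ∑ j, (dX l j + ∑ m, Γ l m j * X m) * X j))
    - (∑ j, X j * ∑ i, (ddX i j i + ∑ l, (dΓ j i l i * X l + Γ i l i * dX l j)))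
    - ∑ i, ∑ j, (dX i j + ∑ l, Γ i l j * X l) * (dX j i + ∑ l, Γ j l i * X l) := by
  simp only [Fin.sum_univ_four]
  simp only [fun k => hΓ k 1 0, fun k => hΓ k 2 0, fun k => hΓ k 2 1, fun k => hΓ k 3 0,
    fun k => hΓ k 3 1, fun k => hΓ k 3 2, fun k => hX k 1 0, fun k => hX k 2 0,
    fun k => hX k 2 1, fun k => hX k 3 0, fun k => hX k 3 1, fun k => hX k 3 2]
  ring

theorem contDiffOn_det {n : ℕ} {A : V4 → Matrix (Fin n) (Fin n) ℝ} {U : Set V4}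
    (hA : ∀ i j, ContDiffOn ℝ ∞ (fun p => A p i j) U) : ContDiffOn ℝ ∞ (fun p => (A p).det) U := by
  simp only [Matrix.det_apply]
  exact ContDiffOn.sum fun σ _ => (contDiffOn_prod fun i _ => hA _ _).const_smul _

theorem contDiffOn_inv {n : ℕ} {A : V4 → Matrix (Fin n) (Fin n) ℝ} {U : Set V4}
    (hA : ∀ i j, ContDiffOn ℝ ∞ (fun p => A p i j) U) (hdet : ∀ p ∈ U, (A p).det ≠ 0)
    (i j : Fin n) : ContDiffOn ℝ ∞ (fun p => (A p)⁻¹ i j) U := by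
  have h : ∀ p, (A p)⁻¹ i j = (A p).det⁻¹ * ((A p).updateRow j (Pi.single i 1)).det := by
    intro p
    rw [Matrix.inv_def, Matrix.smul_apply, Matrix.adjugate_apply, Ring.inverse_eq_inv', smul_eq_mul]
  simp only [h]
  refine ((contDiffOn_det hA).inv hdet).mul (contDiffOn_det fun a b => ?_)
  by_cases hab : a = j
  · subst hab; simpa using contDiffOn_const
  · simpa [Matrix.updateRow_apply, hab] using hA a b

/-- A smooth nondegenerate metric on a subset of the chart. -/
structure SmoothMetric (g : V4 → M4) (U : Set V4) : Prop where
  isOpen : IsOpen U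
  smooth : ∀ i j, ContDiffOn ℝ ∞ (fun p => g p i j) U
  symm : ∀ p ∈ U, (g p).IsSymm
  det_ne : ∀ p ∈ U, (g p).det ≠ 0

/-- A vector field with smooth components. -/
def SmoothVF (X : V4 → V4) (U : Set V4) : Prop := ∀ i, ContDiffOn ℝ ∞ (fun q => X q i) U

theorem differentiableAt_of_smooth {f : V4 → ℝ} {U : Set V4} (hU : IsOpen U)
    (hf : ContDiffOn ℝ ∞ f U) {p : V4} (hp : p ∈ U) : DifferentiableAt ℝ f p :=
  (hf.contDiffAt (hU.mem_nhds hp)).differentiableAt (by simp)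

namespace SmoothMetric

variable {g : V4 → M4} {U : Set V4} (hg : SmoothMetric g U)
include hg

theorem christoffel_smooth (l i j : Fin 4) : ContDiffOn ℝ ∞ (christoffel g l i j) U := by
  unfold christoffel
  refine contDiffOn_const.mul (ContDiffOn.sum fun m _ => ?_)
  exact (contDiffOn_inv hg.smooth hg.det_ne _ _).mul
    ((((hg.smooth _ _).pd hg.isOpen _).add ((hg.smooth _ _).pd hg.isOpen _)).sub
      ((hg.smooth _ _).pd hg.isOpen _))

theorem pd_symm {p : V4} (hp : p ∈ U) (m i j : Fin 4) :
    pd m (fun q => g q i j) p = pd m (fun q => g q j i) p := by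
  apply pd_congr
  filter_upwards [hg.isOpen.mem_nhds hp] with q hq
  exact (hg.symm q hq).apply j i

theorem christoffel_symm {p : V4} (hp : p ∈ U) (l i j : Fin 4) :
    christoffel g l i j p = christoffel g l j i p := by
  unfold christoffel
  congr 1
  refine Finset.sum_congr rfl fun m _ => ?_
  rw [hg.pd_symm hp m i j]
  ring

theorem cov_smooth {X : V4 → V4} (hX : SmoothVF X U) (i j : Fin 4) :
    ContDiffOn ℝ ∞ (fun q => cov g X q i j) U :=
  ((hX i).pd hg.isOpen j).add
    (ContDiffOn.sum fun l _ => (hg.christoffel_smooth i l j).mul (hX l))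

theorem divg_smooth {X : V4 → V4} (hX : SmoothVF X U) : ContDiffOn ℝ ∞ (divg g X) U := by
  change ContDiffOn ℝ ∞ (fun q => ∑ i, cov g X q i i) U
  exact ContDiffOn.sum fun i _ => hg.cov_smooth hX i i

theorem smoothVF_cov_mulVec {X Y : V4 → V4} (hX : SmoothVF X U) (hY : SmoothVF Y U) :
    SmoothVF (fun q => cov g X q *ᵥ Y q) U := by
  intro i
  change ContDiffOn ℝ ∞ (fun q => ∑ j, cov g X q i j * Y q j) U
  exact ContDiffOn.sum fun j _ => (hg.cov_smooth hX i j).mul (hY j)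

theorem pd_cov {X : V4 → V4} (hX : SmoothVF X U) {p : V4} (hp : p ∈ U) (m i j : Fin 4) :
    pd m (fun q => cov g X q i j) p = pd m (pd j (fun q => X q i)) p
      + ∑ l, (pd m (christoffel g i l j) p * X p l
        + christoffel g i l j p * pd m (fun q => X q l) p) := by
  have d1 : ∀ i, DifferentiableAt ℝ (fun q => X q i) p := fun i =>
    differentiableAt_of_smooth hg.isOpen (hX i) hp
  have d2 : ∀ k i j, DifferentiableAt ℝ (christoffel g k i j) p := fun k i j =>
    differentiableAt_of_smooth hg.isOpen (hg.christoffel_smooth k i j) hp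
  have d3 : DifferentiableAt ℝ (pd j (fun q => X q i)) p :=
    differentiableAt_of_smooth hg.isOpen ((hX i).pd hg.isOpen j) hp
  simp only [cov, Matrix.of_apply]
  rw [pd_add d3 (DifferentiableAt.fun_sum fun l _ => (d2 _ _ _).fun_mul (d1 _)),
    pd_sum fun l _ => (d2 _ _ _).fun_mul (d1 _)]
  congr 1
  refine Finset.sum_congr rfl fun l _ => ?_
  rw [pd_mul (d2 _ _ _) (d1 _)]
  ring

/-- The contracted Ricci identity. -/
theorem ricci_self {X : V4 → V4} (hX : SmoothVF X U) {p : V4} (hp : p ∈ U) :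
    val (ricci g p) (X p) (X p) = divg g (fun q => cov g X q *ᵥ X q) p
      - fderiv ℝ (divg g X) p (X p) - (cov g X p * cov g X p).trace := by
  have dX : ∀ i, DifferentiableAt ℝ (fun q => X q i) p := fun i =>
    differentiableAt_of_smooth hg.isOpen (hX i) hp
  have dM : ∀ i j, DifferentiableAt ℝ (fun q => cov g X q i j) p := fun i j =>
    differentiableAt_of_smooth hg.isOpen (hg.cov_smooth hX i j) hp
  have h := contracted_ricci_algebra (fun k i j => christoffel g k i j p)
    (fun m k i j => pd m (christoffel g k i j) p) (X p) (fun i j => pd j (fun q => X q i) p)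
    (fun a i j => pd i (pd j (fun q => X q a)) p) (fun k i j => hg.christoffel_symm hp k i j)
    (fun a i j => pd_comm ((hX a).contDiffAt (hg.isOpen.mem_nhds hp)) i j)
  have e1 : val (ricci g p) (X p) (X p) = ∑ i, ∑ j, X p i * X p j *
      (∑ k, (pd k (christoffel g k i j) p - pd j (christoffel g k i k) p
      + ∑ l, (christoffel g k k l p * christoffel g l i j p
        - christoffel g k j l p * christoffel g l i k p))) := by
    simp only [val, dotProduct, mulVec, ricci, Matrix.of_apply]
    refine Finset.sum_congr rfl fun i _ => ?_
    rw [Finset.mul_sum]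
    refine Finset.sum_congr rfl fun j _ => ?_
    ring
  rw [e1, h]
  congr 1
  · congr 1
    · simp only [divg, Matrix.trace, Matrix.diag]
      refine Finset.sum_congr rfl fun i _ => ?_
      change _ = pd i (fun q => ∑ j, cov g X q i j * X q j) p
        + ∑ l, christoffel g i l i p * ∑ j, cov g X p l j * X p j
      congr 1
      rw [pd_sum fun j _ => (dM i j).fun_mul (dX j)]
      refine Finset.sum_congr rfl fun j _ => ?_
      rw [pd_mul (dM i j) (dX j), hg.pd_cov hX hp]
      simp only [cov, Matrix.of_apply]
      ring
    · rw [fderiv_eq_sum_pd]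
      refine Finset.sum_congr rfl fun j _ => ?_
      congr 1
      change _ = pd j (fun q => ∑ i, cov g X q i i) p
      rw [pd_sum fun i _ => dM i i]
      refine Finset.sum_congr rfl fun i _ => ?_
      rw [hg.pd_cov hX hp]
theorem divg_smul {f : V4 → ℝ} {X : V4 → V4} (hf : ContDiffOn ℝ ∞ f U) (hX : SmoothVF X U)
    {p : V4} (hp : p ∈ U) :
    divg g (fun q => f q • X q) p = fderiv ℝ f p (X p) + f p * divg g X p := by
  have dX : ∀ i, DifferentiableAt ℝ (fun q => X q i) p := fun i =>
    differentiableAt_of_smooth hg.isOpen (hX i) hp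
  have df := differentiableAt_of_smooth hg.isOpen hf hp
  rw [fderiv_eq_sum_pd]
  simp only [divg, Matrix.trace, Matrix.diag, cov, Matrix.of_apply, Pi.smul_apply, smul_eq_mul,
    Finset.mul_sum, ← Finset.sum_add_distrib]
  refine Finset.sum_congr rfl fun i _ => ?_
  rw [pd_mul df (dX i), mul_add, Finset.mul_sum]
  have : ∀ l, christoffel g i l i p * (f p * X p l) = f p * (christoffel g i l i p * X p l) :=
    fun l => by ring
  simp only [this]
  ring

theorem divg_sub {X Y : V4 → V4} (hX : SmoothVF X U) (hY : SmoothVF Y U)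
    {p : V4} (hp : p ∈ U) :
    divg g (fun q => X q - Y q) p = divg g X p - divg g Y p := by
  have dX : ∀ i, DifferentiableAt ℝ (fun q => X q i) p := fun i =>
    differentiableAt_of_smooth hg.isOpen (hX i) hp
  have dY : ∀ i, DifferentiableAt ℝ (fun q => Y q i) p := fun i =>
    differentiableAt_of_smooth hg.isOpen (hY i) hp
  simp only [divg, Matrix.trace, Matrix.diag, cov, Matrix.of_apply, Pi.sub_apply,
    ← Finset.sum_sub_distrib]
  refine Finset.sum_congr rfl fun i _ => ?_
  rw [pd_sub (dX i) (dY i)]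
  simp only [mul_sub, Finset.sum_sub_distrib]
  ring

theorem divg_sum {ι : Type*} {s : Finset ι} {X : ι → V4 → V4} (hX : ∀ a, SmoothVF (X a) U)
    {p : V4} (hp : p ∈ U) :
    divg g (fun q => ∑ a ∈ s, X a q) p = ∑ a ∈ s, divg g (X a) p := by
  have dX : ∀ a i, DifferentiableAt ℝ (fun q => X a q i) p := fun a i =>
    differentiableAt_of_smooth hg.isOpen (hX a i) hp
  simp only [divg, Matrix.trace, Matrix.diag, cov, Matrix.of_apply, Finset.sum_apply]
  rw [Finset.sum_comm]
  refine Finset.sum_congr rfl fun i _ => ?_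
  rw [pd_sum fun a _ => dX a i, Finset.sum_add_distrib]
  congr 1
  rw [Finset.sum_comm]
  simp only [Finset.mul_sum]

/-- The contracted Ricci identity with the divergence terms collected. -/
theorem ricci_self' {X : V4 → V4} (hX : SmoothVF X U) {p : V4} (hp : p ∈ U) :
    val (ricci g p) (X p) (X p) = divg g (fun q => cov g X q *ᵥ X q - divg g X q • X q) p
      + (divg g X p ^ 2 - (cov g X p * cov g X p).trace) := by
  rw [hg.ricci_self hX hp, hg.divg_sub (hg.smoothVF_cov_mulVec hX hX)
    (Y := fun q => divg g X q • X q) (fun i => (hg.divg_smooth hX).mul (hX i)) hp, hg.divg_smul (hg.divg_smooth hX) hX hp]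
  ring

theorem lower_christoffel {p : V4} (hp : p ∈ U) (m i j : Fin 4) :
    ∑ l, g p m l * christoffel g l i j p = (1 / 2) *
      (pd i (fun q => g q j m) p + pd j (fun q => g q i m) p - pd m (fun q => g q i j) p) := by
  have h : ∀ a, ∑ l, g p m l * (g p)⁻¹ l a = if m = a then 1 else 0 := by
    intro a
    rw [← Matrix.mul_apply, Matrix.mul_nonsing_inv _ (hg.det_ne p hp).isUnit, Matrix.one_apply]
  simp only [christoffel]
  calc _ = (1 / 2) * ∑ a, (∑ l, g p m l * (g p)⁻¹ l a) *
      (pd i (fun q => g q j a) p + pd j (fun q => g q i a) p - pd a (fun q => g q i j) p) := by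
        simp only [Finset.mul_sum, Finset.sum_mul]
        rw [Finset.sum_comm]
        exact Finset.sum_congr rfl fun _ _ => Finset.sum_congr rfl fun _ _ => by ring
    _ = _ := by simp only [h, ite_mul, one_mul, zero_mul, Finset.sum_ite_eq, Finset.mem_univ,
                if_true]

theorem pd_metric {p : V4} (hp : p ∈ U) (m i j : Fin 4) :
    pd m (fun q => g q i j) p = ∑ l, (g p l j * christoffel g l i m p
      + g p i l * christoffel g l j m p) := by
  have h1 := hg.lower_christoffel hp j i m
  have h2 := hg.lower_christoffel hp i j m
  rw [Finset.sum_add_distrib]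
  have e : ∀ l, g p l j = g p j l := fun l => (hg.symm p hp).apply j l
  simp only [e, h1, h2]
  rw [hg.pd_symm hp i m j, hg.pd_symm hp j m i, hg.pd_symm hp m j i]
  ring

/-- Metric compatibility. -/
theorem pd_val {X Y : V4 → V4} {p : V4} (hp : p ∈ U)
    (hX : ∀ i, DifferentiableAt ℝ (fun q => X q i) p)
    (hY : ∀ i, DifferentiableAt ℝ (fun q => Y q i) p) (m : Fin 4) :
    pd m (fun q => val (g q) (X q) (Y q)) p =
      val (g p) (fun i => cov g X p i m) (Y p) + val (g p) (X p) (fun i => cov g Y p i m) := by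
  have dg : ∀ i j, DifferentiableAt ℝ (fun q => g q i j) p := fun i j =>
    differentiableAt_of_smooth hg.isOpen (hg.smooth i j) hp
  have e : ∀ i j, pd m (fun q => X q i * (g q i j * Y q j)) p = 
      X p i * (g p i j * pd m (fun q => Y q j) p + (∑ l, (g p l j * christoffel g l i m p
      + g p i l * christoffel g l j m p)) * Y p j) + pd m (fun q => X q i) p * (g p i j * Y p j) := by
    intro i j
    rw [pd_mul (hX i) ((dg i j).fun_mul (hY j)), pd_mul (dg i j) (hY j), hg.pd_metric hp]
  have e1 : pd m (fun q => val (g q) (X q) (Y q)) p =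
      ∑ i, ∑ j, pd m (fun q => X q i * (g q i j * Y q j)) p := by
    simp only [val, dotProduct, mulVec, Finset.mul_sum]
    rw [pd_sum fun i _ => DifferentiableAt.fun_sum fun j _ => (hX i).fun_mul ((dg i j).fun_mul (hY j))]
    exact Finset.sum_congr rfl fun i _ => pd_sum (fun j _ => (hX i).fun_mul ((dg i j).fun_mul (hY j))) m
  rw [e1]
  simp only [e, val, dotProduct, mulVec, cov, Matrix.of_apply, Fin.sum_univ_four]
  ring

theorem fderiv_val {X Y : V4 → V4} {p : V4} (hp : p ∈ U)
    (hX : ∀ i, DifferentiableAt ℝ (fun q => X q i) p)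
    (hY : ∀ i, DifferentiableAt ℝ (fun q => Y q i) p) (v : V4) :
    fderiv ℝ (fun q => val (g q) (X q) (Y q)) p v =
      val (g p) (cov g X p *ᵥ v) (Y p) + val (g p) (X p) (cov g Y p *ᵥ v) := by
  rw [fderiv_eq_sum_pd]
  simp only [hg.pd_val hp hX hY]
  simp only [val, dotProduct, mulVec, Fin.sum_univ_four]
  ring

omit hg in
theorem _root_.NullCone.fderiv_apply_comp {X : V4 → V4} {p : V4}
    (hX : ∀ i, DifferentiableAt ℝ (fun q => X q i) p) (v : V4) (i : Fin 4) :
    fderiv ℝ X p v i = ∑ j, v j * pd j (fun q => X q i) p := by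
  rw [← fderiv_eq_sum_pd]
  have h := (hasFDerivAt_pi'.1 (differentiableAt_pi.2 hX).hasFDerivAt i).fderiv
  rw [h]
  rfl

/-- The connection is torsion free. -/
theorem torsion_free {X Y : V4 → V4} {p : V4} (hp : p ∈ U)
    (hX : ∀ i, DifferentiableAt ℝ (fun q => X q i) p)
    (hY : ∀ i, DifferentiableAt ℝ (fun q => Y q i) p) :
    cov g X p *ᵥ Y p - cov g Y p *ᵥ X p = fderiv ℝ X p (Y p) - fderiv ℝ Y p (X p) := by
  funext i
  simp only [Pi.sub_apply, fderiv_apply_comp hX, fderiv_apply_comp hY, mulVec, dotProduct, cov,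
    Matrix.of_apply, Fin.sum_univ_four]
  rw [hg.christoffel_symm hp i 1 0, hg.christoffel_symm hp i 2 0, hg.christoffel_symm hp i 2 1,
    hg.christoffel_symm hp i 3 0, hg.christoffel_symm hp i 3 1, hg.christoffel_symm hp i 3 2]
  ring

end SmoothMetric

/-! ## Linear algebra of a null frame -/

section frame

theorem val_add_left (G : M4) (v v' w : V4) : val G (v + v') w = val G v w + val G v' w := by
  simp [val, add_dotProduct]

theorem val_sub_left (G : M4) (v v' w : V4) : val G (v - v') w = val G v w - val G v' w := by
  simp [val, sub_dotProduct]

theorem val_smul_left (G : M4) (c : ℝ) (v w : V4) : val G (c • v) w = c * val G v w := by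
  simp [val, smul_dotProduct]

theorem val_neg_left (G : M4) (v w : V4) : val G (-v) w = -val G v w := by
  simp [val, neg_dotProduct]

theorem val_zero_left (G : M4) (w : V4) : val G 0 w = 0 := by
  simp [val]

theorem val_sum_left {ι : Type*} (s : Finset ι) (G : M4) (v : ι → V4) (w : V4) :
    val G (∑ a ∈ s, v a) w = ∑ a ∈ s, val G (v a) w := by
  simp [val, sum_dotProduct]

theorem val_comm {G : M4} (hG : G.IsSymm) (v w : V4) : val G v w = val G w v := by
  unfold val
  rw [dotProduct_mulVec, ← mulVec_transpose, hG.eq, dotProduct_comm]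

/-- The completeness relation of a null frame `k, l` and a tight frame `E a` of the orthogonal
complement. -/
def Resolution (G : M4) (k l : V4) (E : Fin 3 → V4) : Prop :=
  vecMulVec k (G *ᵥ l) + vecMulVec l (G *ᵥ k) - ∑ a, vecMulVec (E a) (G *ᵥ E a) = 1

variable {G : M4} {k l : V4} {E : Fin 3 → V4}

theorem Resolution.expand (h : Resolution G k l E) (v : V4) :
    v = val G v l • k + val G v k • l - ∑ a, val G v (E a) • E a := by
  have h1 := congrArg (fun A : M4 => A *ᵥ v) h
  simp only [one_mulVec, add_mulVec, sub_mulVec, sum_mulVec, vecMulVec_mulVec] at h1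
  have h2 : ∀ w : V4, (G *ᵥ w) ⬝ᵥ v = val G v w := fun w => by rw [val, dotProduct_comm]
  simp only [h2] at h1
  conv_lhs => rw [← h1]
  ext i
  simp

theorem Resolution.trace_eq (h : Resolution G k l E) (M : M4) :
    M.trace = val G (M *ᵥ k) l + val G (M *ᵥ l) k - ∑ a, val G (M *ᵥ E a) (E a) := by
  have h1 := congrArg (fun A : M4 => (M * A).trace) h
  simp only [mul_sub, mul_add, Finset.mul_sum, mul_vecMulVec, trace_sub, trace_add, trace_sum,
    trace_vecMulVec, mul_one] at h1
  exact h1.symm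

theorem Resolution.val_mulVec_mulVec (h : Resolution G k l E) (M : M4) (v w : V4) :
    val G (M *ᵥ (M *ᵥ v)) w = val G (M *ᵥ v) l * val G (M *ᵥ k) w
      + val G (M *ᵥ v) k * val G (M *ᵥ l) w
      - ∑ a, val G (M *ᵥ v) (E a) * val G (M *ᵥ E a) w := by
  conv_lhs => rw [h.expand (M *ᵥ v)]
  simp only [mulVec_sub, mulVec_add, mulVec_smul, mulVec_sum, val_sub_left, val_add_left,
    val_smul_left, val_sum_left]

/-- The part of the quadratic terms in the contracted Ricci identity that stems from the
two frame vectors tangent to the spheres. -/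
theorem Resolution.quadratic_tangent (h : Resolution G k l E) (hE : E 2 = 0) {K L M₀ M₁ : M4}
    (hKk : ∀ v, val G (K *ᵥ k) v = 0)
    (hK : ∀ v w, val G (K *ᵥ v) w = val G (K *ᵥ w) v)
    (hL : val G (L *ᵥ E 0) (E 1) = val G (L *ᵥ E 1) (E 0))
    (hLk₀ : val G (L *ᵥ k) (E 0) = -val G (K *ᵥ l) (E 0))
    (hLk₁ : val G (L *ᵥ k) (E 1) = -val G (K *ᵥ l) (E 1))
    (h0k : ∀ v, val G (M₀ *ᵥ v) k = -val G (K *ᵥ v) (E 0))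
    (h1k : ∀ v, val G (M₁ *ᵥ v) k = -val G (K *ᵥ v) (E 1))
    (h0l : ∀ v, val G (M₀ *ᵥ v) l = -val G (L *ᵥ v) (E 0))
    (h1l : ∀ v, val G (M₁ *ᵥ v) l = -val G (L *ᵥ v) (E 1))
    (h00 : ∀ v, val G (M₀ *ᵥ v) (E 0) = 0) (h11 : ∀ v, val G (M₁ *ᵥ v) (E 1) = 0)
    (h01 : ∀ v, val G (M₁ *ᵥ v) (E 0) = -val G (M₀ *ᵥ v) (E 1)) :
    (M₀.trace ^ 2 - (M₀ * M₀).trace) + (M₁.trace ^ 2 - (M₁ * M₁).trace) =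
      -2 * (val G (K *ᵥ l) (E 0) ^ 2 + val G (K *ᵥ l) (E 1) ^ 2) := by
  rw [h.trace_eq M₀, h.trace_eq M₁, h.trace_eq (M₀ * M₀), h.trace_eq (M₁ * M₁)]
  simp only [← mulVec_mulVec, h.val_mulVec_mulVec, Fin.sum_univ_three, hE, mulVec_zero,
    val_zero_left, h0k, h1k, h0l, h1l, h00, h11, h01, hKk, hLk₀, hLk₁]
  -- The products of ⟨M₀ k, E 1⟩ and ⟨M₀ l, E 1⟩ with entries of L and K occur in both traces with
  -- opposite signs. They cancel because K and L are symmetric on the span of E 0 and E 1.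
  rw [hK (E 1) (E 0), hL]
  have hz : ∀ v, val G v (0 : V4) = 0 := fun v => by simp [val]
  simp only [hz]
  ring

/-- The part of the quadratic terms in the contracted Ricci identity that stems from the
normal direction of the spheres. -/
theorem Resolution.quadratic_normal (h : Resolution G k l E) (hE : E 2 = 0) {M : M4}
    (hk : ∀ v, val G (M *ᵥ v) k = 0) (hl : ∀ v, val G (M *ᵥ v) l = 0) :
    M.trace ^ 2 - (M * M).trace = 2 * (val G (M *ᵥ E 0) (E 0) * val G (M *ᵥ E 1) (E 1)
      - val G (M *ᵥ E 0) (E 1) * val G (M *ᵥ E 1) (E 0)) := by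
  have hz : ∀ v, val G v (0 : V4) = 0 := fun v => by simp [val]
  rw [h.trace_eq M, h.trace_eq (M * M)]
  simp only [← mulVec_mulVec, h.val_mulVec_mulVec, Fin.sum_univ_three, hE, mulVec_zero,
    val_zero_left, hk, hl, hz]
  ring

end frame

/-! ## Tangential tensors -/

section tangential

/-- The projection on the plane orthogonal to a unit vector. -/
def orthProj (x : Fin 3 → ℝ) : M3 := 1 - vecMulVec x x

theorem exists_orthogonal {x : Fin 3 → ℝ} (hx : x ⬝ᵥ x = 1) :
    ∃ O : M3, Oᵀ * O = 1 ∧ O * Oᵀ = 1 ∧ O *ᵥ Pi.single 2 1 = x := by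
  have hx' : x 0 ^ 2 + x 1 ^ 2 + x 2 ^ 2 = 1 := by
    simp only [dotProduct, Fin.sum_univ_three] at hx; linarith
  suffices ∃ O : M3, Oᵀ * O = 1 ∧ O *ᵥ Pi.single 2 1 = x by
    obtain ⟨O, h1, h2⟩ := this
    exact ⟨O, h1, mul_eq_one_comm.1 h1, h2⟩
  by_cases h : x 2 = 1
  · refine ⟨1, by simp, ?_⟩
    have h0 : x 0 = 0 := by nlinarith [sq_nonneg (x 0), sq_nonneg (x 1)]
    have h1 : x 1 = 0 := by nlinarith [sq_nonneg (x 0), sq_nonneg (x 1)]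
    ext i
    fin_cases i <;> simp [h0, h1, h]
  · have hd : 1 - x 2 ≠ 0 := fun h' => h (by linarith)
    set v : Fin 3 → ℝ := x - Pi.single 2 1 with hv
    have e0 : v 0 = x 0 := by simp [hv]
    have e1 : v 1 = x 1 := by simp [hv]
    have e2 : v 2 = x 2 - 1 := by simp [hv]
    have hvv : v ⬝ᵥ v = 2 * (1 - x 2) := by
      simp only [dotProduct, Fin.sum_univ_three, e0, e1, e2]; linear_combination hx'
    -- The Householder reflection that exchanges e₂ and x; its coefficient 2 / (v · v) is 1 / (1 −
    -- x₂).
    refine ⟨1 - (1 - x 2)⁻¹ • vecMulVec v v, ?_, ?_⟩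
    · have : (1 - (1 - x 2)⁻¹ • vecMulVec v v)ᵀ = 1 - (1 - x 2)⁻¹ • vecMulVec v v := by
        simp [transpose_vecMulVec]
      rw [this, sub_mul, mul_sub, mul_sub, one_mul, mul_one, one_mul, smul_mul_smul_comm,
        vecMulVec_mul_vecMulVec, hvv]
      ext i j
      simp [vecMulVec_apply]
      field_simp
      ring
    · have hve : v ⬝ᵥ Pi.single 2 1 = x 2 - 1 := by simp [e2]
      rw [sub_mulVec, one_mulVec, smul_mulVec, vecMulVec_mulVec, hve]
      ext i
      have : (1 - x 2)⁻¹ * (v i * (x 2 - 1)) = - v i := by field_simp; ring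
      have hvi : v i = x i - (Pi.single 2 1 : Fin 3 → ℝ) i := rfl
      rw [hvi] at this
      simp [hv]
      linarith

variable {x : Fin 3 → ℝ} {A : M3}

/-- A tensor on the tangent plane becomes a `2 × 2` block in an adapted orthonormal basis. -/
theorem exists_tangential_form (hx : x ⬝ᵥ x = 1) (hA : A *ᵥ x = 0) (hA' : x ᵥ* A = 0) :
    ∃ O : M3, Oᵀ * O = 1 ∧ O * Oᵀ = 1 ∧ O *ᵥ Pi.single 2 1 = x ∧ ∃ a b c d : ℝ,
      A = O * !![a, b, 0; c, d, 0; 0, 0, 0] * Oᵀ := by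
  obtain ⟨O, h1, h2, h3⟩ := exists_orthogonal hx
  refine ⟨O, h1, h2, h3, ?_⟩
  set C := Oᵀ * A * O with hC
  have hAC : A = O * C * Oᵀ := by
    rw [hC]
    calc A = (O * Oᵀ) * A * (O * Oᵀ) := by rw [h2]; simp
      _ = _ := by simp only [Matrix.mul_assoc]
  have hc : C *ᵥ Pi.single 2 1 = 0 := by
    rw [hC, ← mulVec_mulVec, h3, ← mulVec_mulVec, hA, mulVec_zero]
  have hr : Pi.single 2 1 ᵥ* C = 0 := by
    rw [hC, ← vecMul_vecMul, ← vecMul_vecMul, vecMul_transpose, h3, hA', zero_vecMul]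
  have c' : ∀ i, C i 2 = 0 := fun i => by simpa using congrFun hc i
  have r' : ∀ i, C 2 i = 0 := fun i => by simpa using congrFun hr i
  refine ⟨C 0 0, C 0 1, C 1 0, C 1 1, ?_⟩
  have : !![C 0 0, C 0 1, 0; C 1 0, C 1 1, 0; 0, 0, 0] = C := by
    ext i j
    fin_cases i <;> fin_cases j <;> simp [c', r']
  rw [this, hAC]

theorem vecMulVec_eq_conj {O : M3} (h3 : O *ᵥ Pi.single 2 1 = x) :
    vecMulVec x x = O * !![0, 0, 0; 0, 0, 0; 0, 0, 1] * Oᵀ := by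
  have : (!![0, 0, 0; 0, 0, 0; 0, 0, 1] : M3) = vecMulVec (Pi.single 2 1) (Pi.single 2 1) := by
    ext i j
    fin_cases i <;> fin_cases j <;> simp [vecMulVec_apply]
  rw [this, mul_vecMulVec, vecMulVec_mul, vecMul_transpose, h3]

theorem trace_conj {O : M3} (h1 : Oᵀ * O = 1) (C : M3) : (O * C * Oᵀ).trace = C.trace := by
  rw [trace_mul_comm, ← Matrix.mul_assoc, h1, one_mul]

theorem det_conj {O : M3} (h1 : Oᵀ * O = 1) (C : M3) : (O * C * Oᵀ).det = C.det := by
  rw [det_mul_comm, ← Matrix.mul_assoc, h1, one_mul]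

theorem conj_mul_conj {O : M3} (h1 : Oᵀ * O = 1) (C D : M3) :
    (O * C * Oᵀ) * (O * D * Oᵀ) = O * (C * D) * Oᵀ := by
  calc _ = O * C * (Oᵀ * O) * D * Oᵀ := by simp only [Matrix.mul_assoc]
    _ = _ := by rw [h1]; simp only [Matrix.mul_assoc, mul_one]

theorem conj_add (O C D : M3) : O * C * Oᵀ + O * D * Oᵀ = O * (C + D) * Oᵀ := by
  rw [mul_add, add_mul]

/-- The two-dimensional determinant in terms of traces. -/
theorem det_add_normal (hx : x ⬝ᵥ x = 1) (hA : A *ᵥ x = 0) (hA' : x ᵥ* A = 0) :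
    (A + vecMulVec x x).det = 1 / 2 * (A.trace ^ 2 - (A * A).trace) := by
  obtain ⟨O, h1, -, h3, a, b, c, d, rfl⟩ := exists_tangential_form hx hA hA'
  rw [vecMulVec_eq_conj h3, conj_mul_conj h1, conj_add, det_conj h1, trace_conj h1, trace_conj h1]
  simp [det_fin_three, trace, Fin.sum_univ_three]
  ring

theorem det_smul_add_normal (hx : x ⬝ᵥ x = 1) (hA : A *ᵥ x = 0) (hA' : x ᵥ* A = 0) (c : ℝ) :
    (c • A + vecMulVec x x).det = c ^ 2 * (A + vecMulVec x x).det := by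
  rw [det_add_normal hx hA hA', det_add_normal hx (by rw [smul_mulVec, hA, smul_zero])
    (by rw [vecMul_smul, hA', smul_zero])]
  simp only [trace_smul, smul_mul_smul_comm, smul_eq_mul]
  ring

/-- The Cayley-Hamilton theorem on the tangent plane. -/
theorem tangential_cayley_hamilton (hx : x ⬝ᵥ x = 1) (hA : A *ᵥ x = 0) (hA' : x ᵥ* A = 0) :
    A * A = A.trace • A - (A + vecMulVec x x).det • orthProj x := by
  obtain ⟨O, h1, h2, h3, a, b, c, d, rfl⟩ := exists_tangential_form hx hA hA'
  have h4 : orthProj x = O * !![1, 0, 0; 0, 1, 0; 0, 0, 0] * Oᵀ := by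
    have : !![1, 0, 0; 0, 1, 0; 0, 0, 0] = (1 : M3) - !![0, 0, 0; 0, 0, 0; 0, 0, 1] := by
      ext i j
      fin_cases i <;> fin_cases j <;> simp
    rw [this, mul_sub, sub_mul, mul_one, h2, ← vecMulVec_eq_conj h3, orthProj]
  have hs : ∀ (t : ℝ) (C : M3), t • (O * C * Oᵀ) = O * (t • C) * Oᵀ := fun t C => by simp
  rw [h4, vecMulVec_eq_conj h3, conj_mul_conj h1, conj_add, det_conj h1, trace_conj h1,
    hs, hs, ← sub_mul, ← mul_sub]
  congr 2
  ext i j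
  fin_cases i <;> fin_cases j <;>
    simp [det_fin_three, trace, Fin.sum_univ_three, Matrix.mul_apply] <;> ring

/-- The square root of a positive semidefinite tensor on the tangent plane, where `s` is the square
root of its determinant. -/
def tangentSqrt (x : Fin 3 → ℝ) (s : ℝ) (A : M3) : M3 :=
  (√(A.trace + 2 * s))⁻¹ • (A + s • orthProj x)

theorem orthProj_mulVec_self (hx : x ⬝ᵥ x = 1) : orthProj x *ᵥ x = 0 := by
  rw [orthProj, sub_mulVec, one_mulVec, vecMulVec_mulVec, hx]; simp

theorem vecMul_orthProj_self (hx : x ⬝ᵥ x = 1) : x ᵥ* orthProj x = 0 := by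
  rw [orthProj, vecMul_sub, vecMul_one, vecMul_vecMulVec, hx]; simp

theorem mul_orthProj (hA : A *ᵥ x = 0) : A * orthProj x = A := by
  rw [orthProj, mul_sub, mul_one, mul_vecMulVec, hA]; simp

theorem orthProj_mul (hA' : x ᵥ* A = 0) : orthProj x * A = A := by
  rw [orthProj, sub_mul, one_mul, vecMulVec_mul, hA']; simp

theorem orthProj_mul_self (hx : x ⬝ᵥ x = 1) : orthProj x * orthProj x = orthProj x :=
  mul_orthProj (orthProj_mulVec_self hx)

theorem tangentSqrt_mulVec (hx : x ⬝ᵥ x = 1) (hA : A *ᵥ x = 0) (s : ℝ) :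
    tangentSqrt x s A *ᵥ x = 0 := by
  rw [tangentSqrt, smul_mulVec, add_mulVec, smul_mulVec, hA, orthProj_mulVec_self hx]; simp

theorem vecMul_tangentSqrt (hx : x ⬝ᵥ x = 1) (hA' : x ᵥ* A = 0) (s : ℝ) :
    x ᵥ* tangentSqrt x s A = 0 := by
  rw [tangentSqrt, vecMul_smul, vecMul_add, vecMul_smul, hA', vecMul_orthProj_self hx]; simp

theorem tangentSqrt_mul_self (hx : x ⬝ᵥ x = 1) (hA : A *ᵥ x = 0) (hA' : x ᵥ* A = 0) {s : ℝ}
    (hs : s ^ 2 = (A + vecMulVec x x).det) (hpos : 0 < A.trace + 2 * s) :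
    tangentSqrt x s A * tangentSqrt x s A = A := by
  -- By Cayley–Hamilton A² + 2sA + s²P = (tr A + 2s) A, so the square root is a normalised linear
  -- expression in A and depends smoothly on it.
  have h : (A + s • orthProj x) * (A + s • orthProj x) = (A.trace + 2 * s) • A := by
    rw [mul_add, add_mul, add_mul, tangential_cayley_hamilton hx hA hA', mul_smul_comm,
      mul_orthProj hA, smul_mul_assoc, orthProj_mul hA', smul_mul_smul_comm, orthProj_mul_self hx,
      ← hs]
    ext i j
    simp
    ring
  rw [tangentSqrt, smul_mul_smul_comm, h, smul_smul, ← mul_inv, Real.mul_self_sqrt hpos.le,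
    inv_mul_cancel₀ hpos.ne', one_smul]

theorem det_tangentSqrt (hx : x ⬝ᵥ x = 1) (hA : A *ᵥ x = 0) (hA' : x ᵥ* A = 0) {s : ℝ}
    (hs : s ^ 2 = (A + vecMulVec x x).det) (hpos : 0 < A.trace + 2 * s) :
    (tangentSqrt x s A + vecMulVec x x).det = s := by
  have hP : (orthProj x).trace = 2 := by
    have : (vecMulVec x x).trace = 1 := by rw [trace_vecMulVec, hx]
    simp [orthProj, this]; norm_num
  rw [det_add_normal hx (tangentSqrt_mulVec hx hA s) (vecMul_tangentSqrt hx hA' s),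
    tangentSqrt_mul_self hx hA hA' hs hpos, tangentSqrt, trace_smul, trace_add, trace_smul, hP,
    smul_eq_mul, smul_eq_mul, mul_pow, inv_pow, Real.sq_sqrt hpos.le]
  field_simp
  ring

end tangential

/-! ## The null frame of a metric in the affine Bondi gauge -/

/-- The coordinate `r` as a function on the chart. -/
def rad (p : V4) : ℝ := √(Fin.tail p ⬝ᵥ Fin.tail p)

/-- The unit position vector as a function on the chart. -/
def dir (p : V4) : Fin 3 → ℝ := fun i => p i.succ / rad p

/-- The spatial block of a tensor. -/
def sp (A : M4) : M3 := A.submatrix Fin.succ Fin.succ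

/-- The components `g_{0i}`. -/
def mixed (g : V4 → M4) (p : V4) : Fin 3 → ℝ := fun i => g p 0 i.succ

/-- The negative spatial metric, made nondegenerate in the radial direction. -/
def posMetric (g : V4 → M4) (p : V4) : M3 := vecMulVec (dir p) (dir p) - sp (g p)

/-- The inverse of the negative metric on the tangent planes of the spheres. -/
def invMetric (g : V4 → M4) (p : V4) : M3 := (posMetric g p)⁻¹ - vecMulVec (dir p) (dir p)

/-- The volume density of the metric in the chart. -/
def rho (g : V4 → M4) (p : V4) : ℝ := √(posMetric g p).det

/-- The square root of `invMetric`. -/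
def rootMetric (g : V4 → M4) (p : V4) : M3 := tangentSqrt (dir p) (rho g p)⁻¹ (invMetric g p)

/-- The function `g_00 - ω_A ω^A`. -/
def lapse (g : V4 → M4) (p : V4) : ℝ := g p 0 0 + mixed g p ⬝ᵥ invMetric g p *ᵥ mixed g p

/-- The vector `-ω^A ∂_A`. -/
def shift (g : V4 → M4) (p : V4) : Fin 3 → ℝ := invMetric g p *ᵥ mixed g p

/-- The radial null vector field. -/
def kVec (p : V4) : V4 := Fin.cons 0 (dir p)

/-- The null vector field transversal to the cone. -/
def lVec (g : V4 → M4) (p : V4) : V4 := Fin.cons 1 (shift g p - (lapse g p / 2) • dir p)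

/-- The tight frame of the tangent planes of the spheres. -/
def eVec (g : V4 → M4) (a : Fin 3) (p : V4) : V4 := Fin.cons 0 fun i => rootMetric g p i a

/-- The conditions of the affine Bondi gauge in the chart. -/
structure BondiChart (g : V4 → M4) (U : Set V4) : Prop where
  isOpen : IsOpen U
  smooth : ∀ i j, ContDiffOn ℝ ∞ (fun p => g p i j) U
  symm : ∀ p ∈ U, (g p).IsSymm
  tail_ne : ∀ p ∈ U, Fin.tail p ≠ 0
  radial : ∀ p ∈ U, sp (g p) *ᵥ dir p = 0
  mixed_radial : ∀ p ∈ U, mixed g p ⬝ᵥ dir p = 1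
  negDef : ∀ p ∈ U, ∀ e : Fin 3 → ℝ, e ⬝ᵥ dir p = 0 → e ≠ 0 → e ⬝ᵥ sp (g p) *ᵥ e < 0

theorem val_cons (B : M4) (a b : ℝ) (v w : Fin 3 → ℝ) :
    val B (Fin.cons a v : Fin 4 → ℝ) (Fin.cons b w : Fin 4 → ℝ) = a * (B 0 0 * b) + a * ((fun i : Fin 3 => B 0 i.succ) ⬝ᵥ w)
      + ((fun i : Fin 3 => B i.succ 0) ⬝ᵥ v) * b + v ⬝ᵥ sp B *ᵥ w := by
  simp only [val, dotProduct, mulVec, Fin.sum_univ_succ (n := 3), Fin.cons_zero, Fin.cons_succ, sp,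
    Matrix.submatrix_apply, mul_add, Finset.sum_add_distrib, Finset.sum_mul, Finset.mul_sum]
  have : ∀ x : Fin 3, v x * (B x.succ 0 * b) = B x.succ 0 * v x * b := fun x => by ring
  simp only [this]
  ring

theorem cons_mulVec (B : M4) (a : ℝ) (v : Fin 3 → ℝ) (c : ℝ) (z : Fin 3 → ℝ)
    (h0 : B 0 0 * a + (fun i : Fin 3 => B 0 i.succ) ⬝ᵥ v = c)
    (hs : a • (fun i : Fin 3 => B i.succ 0) + sp B *ᵥ v = z) :
    B *ᵥ (Fin.cons a v : Fin 4 → ℝ) = (Fin.cons c z : Fin 4 → ℝ) := by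
  funext i
  refine Fin.cases ?_ (fun i => ?_) i
  · simp only [mulVec, dotProduct, Fin.sum_univ_succ (n := 3), Fin.cons_zero, Fin.cons_succ] at h0 ⊢
    exact h0
  · have := congrFun hs i
    simp only [Pi.add_apply, Pi.smul_apply, smul_eq_mul, mulVec, dotProduct, sp,
      Matrix.submatrix_apply] at this
    simp only [mulVec, dotProduct, Fin.sum_univ_succ (n := 3), Fin.cons_zero, Fin.cons_succ]
    linarith

theorem dir_dot_dir {p : V4} (hp : Fin.tail p ≠ 0) : dir p ⬝ᵥ dir p = 1 := by
  have h0 : 0 < Fin.tail p ⬝ᵥ Fin.tail p :=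
    lt_of_le_of_ne (Finset.sum_nonneg fun _ _ => mul_self_nonneg _) fun h => hp (dotProduct_self_eq_zero.1 h.symm)
  have h : dir p ⬝ᵥ dir p = (Fin.tail p ⬝ᵥ Fin.tail p) / rad p ^ 2 := by
    simp only [dotProduct, dir, Fin.sum_univ_three, Fin.tail]; ring
  rw [h, rad, Real.sq_sqrt h0.le, div_self h0.ne']

theorem rad_pos {p : V4} (hp : Fin.tail p ≠ 0) : 0 < rad p :=
  Real.sqrt_pos.2 <| lt_of_le_of_ne (Finset.sum_nonneg fun _ _ => mul_self_nonneg _) fun h =>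
    hp (dotProduct_self_eq_zero.1 h.symm)

namespace BondiChart

variable {g : V4 → M4} {U : Set V4} (hg : BondiChart g U) {p : V4} (hp : p ∈ U)
include hg hp

theorem dir_unit : dir p ⬝ᵥ dir p = 1 := dir_dot_dir (hg.tail_ne p hp)

theorem sp_symm : (sp (g p))ᵀ = sp (g p) := by
  rw [sp, transpose_submatrix, (hg.symm p hp).eq]

theorem mixed' : (fun i : Fin 3 => g p i.succ 0) = mixed g p := by
  funext i
  exact (hg.symm p hp).apply 0 i.succ

theorem radial' : dir p ᵥ* sp (g p) = 0 := by
  rw [← hg.sp_symm hp, vecMul_transpose, hg.radial p hp]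

theorem posMetric_symm : (posMetric g p)ᵀ = posMetric g p := by
  rw [posMetric, transpose_sub, hg.sp_symm hp, transpose_vecMulVec]

theorem posMetric_posDef : (posMetric g p).PosDef := by
  refine PosDef.of_dotProduct_mulVec_pos ?_ fun z hz => ?_
  · rw [IsHermitian, conjTranspose_eq_transpose_of_trivial, hg.posMetric_symm hp]
  · set x := dir p with hx
    have hxx := hg.dir_unit hp
    set e := z - (x ⬝ᵥ z) • x with he
    have hex : e ⬝ᵥ x = 0 := by
      rw [he, sub_dotProduct, smul_dotProduct, hxx, dotProduct_comm z x]; simp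
    have hGz : sp (g p) *ᵥ z = sp (g p) *ᵥ e := by
      rw [he, mulVec_sub, mulVec_smul, hg.radial p hp]; simp
    have hzG : z ⬝ᵥ sp (g p) *ᵥ e = e ⬝ᵥ sp (g p) *ᵥ e := by
      rw [dotProduct_mulVec, dotProduct_mulVec, he, sub_vecMul, smul_vecMul, hg.radial' hp]; simp
    have key : star z ⬝ᵥ posMetric g p *ᵥ z = (x ⬝ᵥ z) ^ 2 - e ⬝ᵥ sp (g p) *ᵥ e := by
      rw [posMetric, sub_mulVec, dotProduct_sub, star_trivial, hGz, hzG, vecMulVec_mulVec]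
      simp [← hx, dotProduct_comm z x]; ring
    rw [key]
    by_cases h0 : e = 0
    · have : x ⬝ᵥ z ≠ 0 := fun h => hz (by rw [h, zero_smul, sub_zero] at he; rw [← he, h0])
      rw [h0]; simp; positivity
    · have := hg.negDef p hp e hex h0
      nlinarith [sq_nonneg (x ⬝ᵥ z)]

theorem det_posMetric_pos : 0 < (posMetric g p).det := (hg.posMetric_posDef hp).det_pos

theorem rho_pos : 0 < rho g p := Real.sqrt_pos.2 (hg.det_posMetric_pos hp)

theorem rho_sq : rho g p ^ 2 = (posMetric g p).det := Real.sq_sqrt (hg.det_posMetric_pos hp).le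

theorem posMetric_mulVec_dir : posMetric g p *ᵥ dir p = dir p := by
  rw [posMetric, sub_mulVec, hg.radial p hp, vecMulVec_mulVec, hg.dir_unit hp]; simp

theorem isUnit_det_posMetric : IsUnit (posMetric g p).det := (hg.det_posMetric_pos hp).ne'.isUnit

theorem invMetric_symm : (invMetric g p)ᵀ = invMetric g p := by
  rw [invMetric, transpose_sub, transpose_nonsing_inv, hg.posMetric_symm hp, transpose_vecMulVec]

theorem invMetric_radial : invMetric g p *ᵥ dir p = 0 := by
  have h : (posMetric g p)⁻¹ *ᵥ dir p = dir p := by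
    conv_lhs => rw [← hg.posMetric_mulVec_dir hp]
    rw [mulVec_mulVec, nonsing_inv_mul _ (hg.isUnit_det_posMetric hp), one_mulVec]
  rw [invMetric, sub_mulVec, h, vecMulVec_mulVec, hg.dir_unit hp]; simp

theorem invMetric_radial' : dir p ᵥ* invMetric g p = 0 := by
  rw [← hg.invMetric_symm hp, vecMul_transpose, hg.invMetric_radial hp]

theorem invMetric_mul_sp : invMetric g p * sp (g p) = -orthProj (dir p) := by
  have h : sp (g p) = vecMulVec (dir p) (dir p) - posMetric g p := by rw [posMetric]; abel
  have h1 : invMetric g p * vecMulVec (dir p) (dir p) = 0 := by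
    rw [mul_vecMulVec, hg.invMetric_radial hp]; simp
  have h2 : vecMulVec (dir p) (dir p) * posMetric g p = vecMulVec (dir p) (dir p) := by
    rw [vecMulVec_mul, ← mulVec_transpose, hg.posMetric_symm hp, hg.posMetric_mulVec_dir hp]
  rw [h, mul_sub, h1, invMetric, sub_mul, nonsing_inv_mul _ (hg.isUnit_det_posMetric hp), h2,
    orthProj]
  abel

theorem sp_mul_invMetric : sp (g p) * invMetric g p = -orthProj (dir p) := by
  have h := congrArg transpose (hg.invMetric_mul_sp hp)
  rw [transpose_mul, hg.sp_symm hp, hg.invMetric_symm hp] at h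
  rw [h, orthProj, transpose_neg, transpose_sub, transpose_vecMulVec, transpose_one]

theorem invMetric_eq : invMetric g p = -(invMetric g p * sp (g p) * invMetric g p) := by
  rw [hg.invMetric_mul_sp hp, Matrix.neg_mul, neg_neg, orthProj_mul (hg.invMetric_radial' hp)]

theorem invMetric_nonneg (z : Fin 3 → ℝ) : 0 ≤ z ⬝ᵥ invMetric g p *ᵥ z := by
  have h : z ⬝ᵥ invMetric g p *ᵥ z =
      -((invMetric g p *ᵥ z) ⬝ᵥ sp (g p) *ᵥ (invMetric g p *ᵥ z)) := by
    conv_lhs => rw [hg.invMetric_eq hp]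
    rw [neg_mulVec, dotProduct_neg, ← mulVec_mulVec, ← mulVec_mulVec, dotProduct_mulVec z,
      ← mulVec_transpose, hg.invMetric_symm hp]
  have h0 : (invMetric g p *ᵥ z) ⬝ᵥ dir p = 0 := by
    rw [dotProduct_comm, dotProduct_mulVec, hg.invMetric_radial' hp, zero_dotProduct]
  rw [h]
  by_cases hz : invMetric g p *ᵥ z = 0
  · rw [hz]; simp
  · linarith [hg.negDef p hp _ h0 hz]

theorem trace_invMetric_nonneg : 0 ≤ (invMetric g p).trace := by
  refine Finset.sum_nonneg fun i _ => ?_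
  simpa using hg.invMetric_nonneg hp (Pi.single i 1)

theorem det_invMetric : ((rho g p)⁻¹) ^ 2 = (invMetric g p + vecMulVec (dir p) (dir p)).det := by
  rw [invMetric, sub_add_cancel, det_nonsing_inv, Ring.inverse_eq_inv', inv_pow, hg.rho_sq hp]

theorem trace_add_pos : 0 < (invMetric g p).trace + 2 * (rho g p)⁻¹ := by
  have := hg.trace_invMetric_nonneg hp
  have := inv_pos.2 (hg.rho_pos hp)
  linarith

theorem rootMetric_radial : rootMetric g p *ᵥ dir p = 0 :=
  tangentSqrt_mulVec (hg.dir_unit hp) (hg.invMetric_radial hp) _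

theorem rootMetric_radial' : dir p ᵥ* rootMetric g p = 0 :=
  vecMul_tangentSqrt (hg.dir_unit hp) (hg.invMetric_radial' hp) _

theorem rootMetric_symm : (rootMetric g p)ᵀ = rootMetric g p := by
  rw [rootMetric, tangentSqrt, transpose_smul, transpose_add, transpose_smul, orthProj,
    transpose_sub, transpose_vecMulVec, hg.invMetric_symm hp, transpose_one]

theorem rootMetric_mul_self : rootMetric g p * rootMetric g p = invMetric g p :=
  tangentSqrt_mul_self (hg.dir_unit hp) (hg.invMetric_radial hp) (hg.invMetric_radial' hp)
    (hg.det_invMetric hp) (hg.trace_add_pos hp)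

theorem det_rootMetric : (rootMetric g p + vecMulVec (dir p) (dir p)).det = (rho g p)⁻¹ :=
  det_tangentSqrt (hg.dir_unit hp) (hg.invMetric_radial hp) (hg.invMetric_radial' hp)
    (hg.det_invMetric hp) (hg.trace_add_pos hp)

/-- With B² = N and N G = −P the identity holds after multiplication by B. Adding x xᵀ makes the
left factor invertible, so it can be cancelled. -/
theorem rootMetric_sp_rootMetric :
    rootMetric g p * sp (g p) * rootMetric g p = -orthProj (dir p) := by
  set B := rootMetric g p with hB
  have hxB : dir p ᵥ* B = 0 := hg.rootMetric_radial' hp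
  have hBx : B *ᵥ dir p = 0 := hg.rootMetric_radial hp
  have hBB : B * B = invMetric g p := hg.rootMetric_mul_self hp
  have hu : IsUnit (B + vecMulVec (dir p) (dir p)).det := by
    rw [hB, hg.det_rootMetric hp]; exact (inv_pos.2 (hg.rho_pos hp)).ne'.isUnit
  have h1 : (B + vecMulVec (dir p) (dir p)) * (B * sp (g p) * B)
      = (B + vecMulVec (dir p) (dir p)) * (-orthProj (dir p)) := by
    have e1 : vecMulVec (dir p) (dir p) * B = 0 := by rw [vecMulVec_mul, hxB]; simp
    have e2 : vecMulVec (dir p) (dir p) * orthProj (dir p) = 0 := by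
      rw [vecMulVec_mul, vecMul_orthProj_self (hg.dir_unit hp)]; simp
    have e3 : B * (B * sp (g p) * B) = -B := by
      calc _ = (B * B) * sp (g p) * B := by simp only [Matrix.mul_assoc]
        _ = _ := by rw [hBB, hg.invMetric_mul_sp hp, Matrix.neg_mul, orthProj_mul hxB]
    rw [add_mul, add_mul, e3, Matrix.mul_neg, Matrix.mul_neg, e2, mul_orthProj hBx,
      Matrix.mul_assoc B, ← Matrix.mul_assoc _ B, e1]
    simp
  have h2 := congrArg (fun A => (B + vecMulVec (dir p) (dir p))⁻¹ * A) h1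
  simpa only [← Matrix.mul_assoc, nonsing_inv_mul _ hu, Matrix.one_mul] using h2

theorem shift_radial : dir p ⬝ᵥ shift g p = 0 := by
  rw [shift, dotProduct_mulVec, hg.invMetric_radial' hp, zero_dotProduct]

theorem sp_mulVec_shift : sp (g p) *ᵥ shift g p = dir p - mixed g p := by
  rw [shift, mulVec_mulVec, hg.sp_mul_invMetric hp, orthProj, neg_mulVec, sub_mulVec, one_mulVec,
    vecMulVec_mulVec, dotProduct_comm, hg.mixed_radial p hp]
  simp

/-- Lowering the index of k gives du. That k is a gradient is the source of its geodesic property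
and of the symmetry of ∇k. -/
theorem mulVec_kVec : g p *ᵥ kVec p = (Fin.cons 1 0 : Fin 4 → ℝ) :=
  cons_mulVec _ _ _ _ _ (by rw [mul_zero, zero_add]; exact hg.mixed_radial p hp)
    (by rw [zero_smul, zero_add, hg.radial p hp])

theorem mulVec_lVec : g p *ᵥ lVec g p = (Fin.cons (lapse g p / 2) (dir p) : Fin 4 → ℝ) := by
  refine cons_mulVec _ _ _ _ _ ?_ ?_
  · change g p 0 0 * 1 + mixed g p ⬝ᵥ (shift g p - (lapse g p / 2) • dir p) = _
    rw [dotProduct_sub, dotProduct_smul, hg.mixed_radial p hp, shift, lapse]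
    simp only [smul_eq_mul]
    ring
  · rw [hg.mixed' hp, one_smul, mulVec_sub, mulVec_smul, hg.radial p hp, hg.sp_mulVec_shift hp]
    simp

omit hg hp in
theorem mulVec_eVec (a : Fin 3) : g p *ᵥ eVec g a p =
    (Fin.cons ((mixed g p ᵥ* rootMetric g p) a) fun i => (sp (g p) * rootMetric g p) i a :
      Fin 4 → ℝ) := by
  refine cons_mulVec _ _ _ _ _ ?_ ?_
  · rw [mul_zero, zero_add]; rfl
  · rw [zero_smul, zero_add]; rfl

theorem val_kVec (v : V4) : val (g p) v (kVec p) = v 0 := by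
  rw [val, hg.mulVec_kVec hp]
  simp [dotProduct, Fin.sum_univ_succ]

theorem val_lVec (v : V4) :
    val (g p) v (lVec g p) = lapse g p / 2 * v 0 + dir p ⬝ᵥ Fin.tail v := by
  rw [val, hg.mulVec_lVec hp]
  simp [dotProduct, Fin.sum_univ_succ, Fin.tail]
  ring

theorem dir_dot_root (a : Fin 3) : (dir p ⬝ᵥ fun i => rootMetric g p i a) = 0 :=
  congrFun (hg.rootMetric_radial' hp) a

theorem val_eVec_kVec (a : Fin 3) : val (g p) (eVec g a p) (kVec p) = 0 := by
  rw [hg.val_kVec hp]; rfl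

theorem val_eVec_lVec (a : Fin 3) : val (g p) (eVec g a p) (lVec g p) = 0 := by
  rw [hg.val_lVec hp]
  have : Fin.tail (eVec g a p) = fun i => rootMetric g p i a := rfl
  rw [this, hg.dir_dot_root hp]
  simp [eVec]

/-- The Gram matrix is minus a projection of rank two. This replaces orthonormality, at the price of
a Gram matrix that varies with the point. -/
theorem val_eVec_eVec (a b : Fin 3) :
    val (g p) (eVec g a p) (eVec g b p) = -orthProj (dir p) a b := by
  rw [← Matrix.neg_apply, ← hg.rootMetric_sp_rootMetric hp, eVec, eVec, val_cons]
  simp only [zero_mul, mul_zero, zero_add]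
  rw [Matrix.mul_assoc, Matrix.mul_apply]
  refine Finset.sum_congr rfl fun j _ => ?_
  have h : rootMetric g p a j = rootMetric g p j a :=
    congrFun (congrFun (hg.rootMetric_symm hp) j) a
  rw [h]
  rfl

theorem val_lVec_lVec : val (g p) (lVec g p) (lVec g p) = 0 := by
  rw [hg.val_lVec hp]
  have : Fin.tail (lVec g p) = shift g p - (lapse g p / 2) • dir p := rfl
  rw [this, dotProduct_sub, hg.shift_radial hp, dotProduct_smul, hg.dir_unit hp]
  simp [lVec]

theorem val_lVec_kVec : val (g p) (lVec g p) (kVec p) = 1 := by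
  rw [hg.val_kVec hp]; rfl

theorem val_kVec_kVec : val (g p) (kVec p) (kVec p) = 0 := by
  rw [hg.val_kVec hp]; rfl

theorem resolution : Resolution (g p) (kVec p) (lVec g p) fun a => eVec g a p := by
  have hBB : rootMetric g p * (rootMetric g p)ᵀ = invMetric g p := by
    rw [hg.rootMetric_symm hp, hg.rootMetric_mul_self hp]
  have h1 : ∀ i : Fin 3, ∑ a, rootMetric g p i a * (mixed g p ᵥ* rootMetric g p) a
      = shift g p i := by
    intro i
    have : shift g p = rootMetric g p *ᵥ (mixed g p ᵥ* rootMetric g p) := by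
      rw [shift, ← hBB, ← mulVec_mulVec, mulVec_transpose]
    rw [this]; rfl
  have h2 : ∀ i j : Fin 3, ∑ a, rootMetric g p i a * (sp (g p) * rootMetric g p) j a
      = -orthProj (dir p) i j := by
    intro i j
    have : -orthProj (dir p) = rootMetric g p * (sp (g p) * rootMetric g p)ᵀ := by
      rw [transpose_mul, ← Matrix.mul_assoc, hBB, hg.sp_symm hp, hg.invMetric_mul_sp hp]
    rw [← Matrix.neg_apply, this, Matrix.mul_apply]; rfl
  unfold Resolution
  rw [hg.mulVec_kVec hp, hg.mulVec_lVec hp]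
  simp only [mulVec_eVec]
  ext i j
  simp only [Matrix.sub_apply, Matrix.add_apply, Matrix.sum_apply, vecMulVec_apply]
  refine Fin.cases ?_ (fun i => ?_) i <;> refine Fin.cases ?_ (fun j => ?_) j
  · simp [kVec, lVec, eVec]
  · simp [kVec, lVec, eVec, (Fin.succ_ne_zero j).symm]
  · simp only [kVec, lVec, eVec, Fin.cons_succ, Fin.cons_zero, h1]
    simp; ring
  · simp only [kVec, lVec, eVec, Fin.cons_succ, h2]
    simp [orthProj, vecMulVec_apply, Matrix.one_apply]

theorem inv_eq : (g p)⁻¹ = vecMulVec (kVec p) (lVec g p) + vecMulVec (lVec g p) (kVec p)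
    - ∑ a, vecMulVec (eVec g a p) (eVec g a p) := by
  refine inv_eq_left_inv ?_
  have h := hg.resolution hp
  rw [Resolution] at h
  rw [← h]
  have e : ∀ v w : V4, vecMulVec v w * g p = vecMulVec v (g p *ᵥ w) := fun v w => by
    rw [vecMulVec_mul, ← mulVec_transpose, (hg.symm p hp).eq]
  simp only [sub_mul, add_mul, Finset.sum_mul, e]

theorem det_ne : (g p).det ≠ 0 := by
  have h := hg.resolution hp
  have e : ∀ v w : V4, vecMulVec v w * g p = vecMulVec v (g p *ᵥ w) := fun v w => by
    rw [vecMulVec_mul, ← mulVec_transpose, (hg.symm p hp).eq]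
  rw [Resolution] at h
  simp only [← e, ← sub_mul, ← add_mul, ← Finset.sum_mul] at h
  intro h0
  have := congrArg det h
  rw [det_mul, h0] at this
  simp at this

theorem sum_dir_smul_eVec : ∑ a, dir p a • eVec g a p = 0 := by
  funext i
  refine Fin.cases ?_ (fun i => ?_) i
  · simp [eVec]
  · have := congrFun (hg.rootMetric_radial hp) i
    simp only [mulVec, dotProduct] at this
    simp only [Finset.sum_apply, Pi.smul_apply, eVec, Fin.cons_succ, smul_eq_mul]
    rw [Pi.zero_apply] at this ⊢
    rw [← this]
    exact Finset.sum_congr rfl fun _ _ => mul_comm _ _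

end BondiChart

/-! ## Smoothness of the frame -/

theorem contDiffOn_coord (i : Fin 4) (U : Set V4) : ContDiffOn ℝ ∞ (fun p : V4 => p i) U :=
  (contDiff_apply ℝ ℝ i).contDiffOn

theorem contDiffOn_rad {U : Set V4} (hU : ∀ p ∈ U, Fin.tail p ≠ 0) : ContDiffOn ℝ ∞ rad U := by
  have h : ∀ p ∈ U, Fin.tail p ⬝ᵥ Fin.tail p ≠ 0 := fun p hp h =>
    hU p hp (dotProduct_self_eq_zero.1 h)
  refine ContDiffOn.sqrt ?_ h
  change ContDiffOn ℝ ∞ (fun p : V4 => ∑ i : Fin 3, p i.succ * p i.succ) U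
  exact ContDiffOn.sum fun i _ => (contDiffOn_coord _ _).mul (contDiffOn_coord _ _)

theorem contDiffOn_dir {U : Set V4} (hU : ∀ p ∈ U, Fin.tail p ≠ 0) (i : Fin 3) :
    ContDiffOn ℝ ∞ (fun p => dir p i) U :=
  (contDiffOn_coord _ _).div (contDiffOn_rad hU) fun p hp => (rad_pos (hU p hp)).ne'

theorem smoothVF_cons {a : V4 → ℝ} {v : V4 → Fin 3 → ℝ} {U : Set V4} (ha : ContDiffOn ℝ ∞ a U)
    (hv : ∀ i, ContDiffOn ℝ ∞ (fun p => v p i) U) :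
    SmoothVF (fun p => (Fin.cons (a p) (v p) : Fin 4 → ℝ)) U := by
  intro i
  refine Fin.cases ?_ (fun i => ?_) i
  · simpa using ha
  · simpa using hv i

theorem smoothVF_kVec {U : Set V4} (hU : ∀ p ∈ U, Fin.tail p ≠ 0) : SmoothVF kVec U :=
  smoothVF_cons contDiffOn_const (contDiffOn_dir hU)

namespace BondiChart

variable {g : V4 → M4} {U : Set V4} (hg : BondiChart g U)
include hg

theorem smoothMetric : SmoothMetric g U :=
  ⟨hg.isOpen, hg.smooth, hg.symm, fun _ hp => hg.det_ne hp⟩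

theorem smooth_normal (i j : Fin 3) :
    ContDiffOn ℝ ∞ (fun p => vecMulVec (dir p) (dir p) i j) U := by
  simp only [vecMulVec_apply]
  exact (contDiffOn_dir hg.tail_ne i).mul (contDiffOn_dir hg.tail_ne j)

theorem smooth_posMetric (i j : Fin 3) : ContDiffOn ℝ ∞ (fun p => posMetric g p i j) U :=
  (hg.smooth_normal i j).sub (hg.smooth _ _)

theorem smooth_invMetric (i j : Fin 3) : ContDiffOn ℝ ∞ (fun p => invMetric g p i j) U :=
  (contDiffOn_inv hg.smooth_posMetric (fun _ hp => (hg.det_posMetric_pos hp).ne') i j).sub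
    (hg.smooth_normal i j)

theorem smooth_rho : ContDiffOn ℝ ∞ (rho g) U :=
  (contDiffOn_det hg.smooth_posMetric).sqrt fun _ hp => (hg.det_posMetric_pos hp).ne'

theorem smooth_rootMetric (i j : Fin 3) : ContDiffOn ℝ ∞ (fun p => rootMetric g p i j) U := by
  have h1 : ContDiffOn ℝ ∞ (fun p => (rho g p)⁻¹) U :=
    hg.smooth_rho.inv fun _ hp => (hg.rho_pos hp).ne'
  have h2 : ContDiffOn ℝ ∞ (fun p => (invMetric g p).trace) U := by
    change ContDiffOn ℝ ∞ (fun p => ∑ i, invMetric g p i i) U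
    exact ContDiffOn.sum fun i _ => hg.smooth_invMetric i i
  have h3 : ContDiffOn ℝ ∞ (fun p => √((invMetric g p).trace + 2 * (rho g p)⁻¹)) U :=
    (h2.add (contDiffOn_const.mul h1)).sqrt fun _ hp => (hg.trace_add_pos hp).ne'
  have h4 : ContDiffOn ℝ ∞ (fun p => (√((invMetric g p).trace + 2 * (rho g p)⁻¹))⁻¹) U :=
    h3.inv fun _ hp => (Real.sqrt_pos.2 (hg.trace_add_pos hp)).ne'
  exact h4.mul ((hg.smooth_invMetric i j).add (h1.mul (contDiffOn_const.sub
    (hg.smooth_normal i j))))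

theorem smooth_mixed (i : Fin 3) : ContDiffOn ℝ ∞ (fun p => mixed g p i) U := hg.smooth _ _

theorem smooth_shift (i : Fin 3) : ContDiffOn ℝ ∞ (fun p => shift g p i) U := by
  change ContDiffOn ℝ ∞ (fun p => ∑ j, invMetric g p i j * mixed g p j) U
  exact ContDiffOn.sum fun j _ => (hg.smooth_invMetric i j).mul (hg.smooth_mixed j)

theorem smooth_lapse : ContDiffOn ℝ ∞ (lapse g) U := by
  change ContDiffOn ℝ ∞ (fun p => g p 0 0 + ∑ i, mixed g p i * shift g p i) U
  exact (hg.smooth 0 0).add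
    (ContDiffOn.sum fun i _ => (hg.smooth_mixed i).mul (hg.smooth_shift i))

theorem smoothVF_lVec : SmoothVF (lVec g) U :=
  smoothVF_cons contDiffOn_const fun i => (hg.smooth_shift i).sub
    ((hg.smooth_lapse.div_const 2).mul (contDiffOn_dir hg.tail_ne i))

theorem smoothVF_eVec (a : Fin 3) : SmoothVF (eVec g a) U :=
  smoothVF_cons contDiffOn_const fun i => hg.smooth_rootMetric i a

end BondiChart

/-! ## Derivatives of the frame -/

theorem fderiv_rad {p : V4} (hp : Fin.tail p ≠ 0) (v : V4) :
    fderiv ℝ rad p v = dir p ⬝ᵥ Fin.tail v := by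
  have h0 : Fin.tail p ⬝ᵥ Fin.tail p ≠ 0 := fun h => hp (dotProduct_self_eq_zero.1 h)
  have hc : ∀ i : Fin 3, HasFDerivAt (fun p : V4 => p i.succ)
      (ContinuousLinearMap.proj (R := ℝ) (φ := fun _ : Fin 4 => ℝ) i.succ) p :=
    fun i => hasFDerivAt_apply i.succ p
  have hd := fun i : Fin 3 => (hc i).fun_mul (hc i)
  have h1 : HasFDerivAt (fun p : V4 => ∑ i : Fin 3, p i.succ * p i.succ) _ p :=
    HasFDerivAt.fun_sum fun i _ => hd i
  have h2 := (h1.sqrt h0).fderiv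
  change fderiv ℝ (fun p : V4 => √(∑ i : Fin 3, p i.succ * p i.succ)) p v = _
  rw [h2]
  have h3 : √(∑ i : Fin 3, p i.succ * p i.succ) = rad p := rfl
  rw [h3]
  simp only [Fin.sum_univ_three, dotProduct, dir, Fin.tail]
  simp
  have := (rad_pos hp).ne'
  field_simp
  ring

theorem differentiableAt_rad {p : V4} (hp : Fin.tail p ≠ 0) : DifferentiableAt ℝ rad p :=
  differentiableAt_of_smooth (U := {p | Fin.tail p ≠ 0})
    (isOpen_ne.preimage (continuous_pi fun i => continuous_apply i.succ))
    (contDiffOn_rad fun _ h => h) hp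

theorem differentiableAt_dir {p : V4} (hp : Fin.tail p ≠ 0) (i : Fin 3) :
    DifferentiableAt ℝ (fun p => dir p i) p :=
  differentiableAt_of_smooth (U := {p | Fin.tail p ≠ 0})
    (isOpen_ne.preimage (continuous_pi fun i => continuous_apply i.succ))
    (contDiffOn_dir (fun _ h => h) i) hp

theorem fderiv_dir {p : V4} (hp : Fin.tail p ≠ 0) (v : V4) (i : Fin 3) :
    fderiv ℝ (fun p => dir p i) p v = (v i.succ - (dir p ⬝ᵥ Fin.tail v) * dir p i) / rad p := by
  have hr := (rad_pos hp).ne'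
  have hc : HasFDerivAt (fun p : V4 => p i.succ)
      (ContinuousLinearMap.proj (R := ℝ) (φ := fun _ : Fin 4 => ℝ) i.succ) p :=
    hasFDerivAt_apply i.succ p
  have h : (fun q => dir q i * rad q) =ᶠ[𝓝 p] fun q => q i.succ := by
    have ho : IsOpen {p : V4 | Fin.tail p ≠ 0} :=
      isOpen_ne.preimage (continuous_pi fun i => continuous_apply i.succ)
    filter_upwards [ho.mem_nhds hp] with q hq
    rw [dir, div_mul_cancel₀ _ (rad_pos hq).ne']
  have h1 := congrArg (fun L : V4 →L[ℝ] ℝ => L v) (h.fderiv_eq (𝕜 := ℝ))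
  simp only [fderiv_fun_mul (differentiableAt_dir hp i) (differentiableAt_rad hp), hc.fderiv,
    _root_.add_apply, _root_.smul_apply, smul_eq_mul, fderiv_rad hp,
    ContinuousLinearMap.proj_apply] at h1
  rw [eq_div_iff hr]
  linarith

theorem tail_kVec (p : V4) : Fin.tail (kVec p) = dir p := rfl

theorem fderiv_dir_kVec {p : V4} (hp : Fin.tail p ≠ 0) (i : Fin 3) :
    fderiv ℝ (fun p => dir p i) p (kVec p) = 0 := by
  rw [fderiv_dir hp, tail_kVec, dir_dot_dir hp]
  simp [kVec]

theorem fderiv_kVec {U : Set V4} (hU : ∀ p ∈ U, Fin.tail p ≠ 0) (hUo : IsOpen U) {p : V4}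
    (hp : p ∈ U) (v : V4) : fderiv ℝ kVec p v =
      (Fin.cons 0 ((rad p)⁻¹ • (Fin.tail v - (dir p ⬝ᵥ Fin.tail v) • dir p)) : Fin 4 → ℝ) := by
  funext i
  rw [fderiv_apply_comp (fun i => differentiableAt_of_smooth hUo (smoothVF_kVec hU i) hp),
    ← fderiv_eq_sum_pd]
  refine Fin.cases ?_ (fun i => ?_) i
  · simp [kVec]
  · have := fderiv_dir (hU p hp) v i
    simp only [kVec, Fin.cons_succ, this]
    simp [Fin.tail]; ring

theorem fderiv_eq_of_const {f : V4 → ℝ} {c : ℝ} {U : Set V4} (hU : IsOpen U)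
    (h : ∀ q ∈ U, f q = c) {p : V4} (hp : p ∈ U) (v : V4) : fderiv ℝ f p v = 0 := by
  have : f =ᶠ[𝓝 p] fun _ => c := by
    filter_upwards [hU.mem_nhds hp] with q hq using h q hq
  rw [this.fderiv_eq]; simp

namespace BondiChart

variable {g : V4 → M4} {U : Set V4} (hg : BondiChart g U) {p : V4} (hp : p ∈ U)
include hg hp

theorem diff_kVec (i : Fin 4) : DifferentiableAt ℝ (fun q => kVec q i) p :=
  differentiableAt_of_smooth hg.isOpen (smoothVF_kVec hg.tail_ne i) hp

theorem diff_lVec (i : Fin 4) : DifferentiableAt ℝ (fun q => lVec g q i) p :=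
  differentiableAt_of_smooth hg.isOpen (hg.smoothVF_lVec i) hp

theorem diff_eVec (a : Fin 3) (i : Fin 4) : DifferentiableAt ℝ (fun q => eVec g a q i) p :=
  differentiableAt_of_smooth hg.isOpen (hg.smoothVF_eVec a i) hp

/-- Pairings of smooth fields that are constant yield relations between covariant derivatives. -/
theorem val_cov_add_eq_zero {X Y : V4 → V4} {c : ℝ} (hX : ∀ i, DifferentiableAt ℝ (fun q => X q i) p)
    (hY : ∀ i, DifferentiableAt ℝ (fun q => Y q i) p)
    (h : ∀ q ∈ U, val (g q) (X q) (Y q) = c) (v : V4) :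
    val (g p) (cov g X p *ᵥ v) (Y p) + val (g p) (cov g Y p *ᵥ v) (X p) = 0 := by
  rw [val_comm (hg.symm p hp) (cov g Y p *ᵥ v), ← hg.smoothMetric.fderiv_val hp hX hY]
  exact fderiv_eq_of_const hg.isOpen h hp v

theorem val_cov_kVec_kVec (v : V4) : val (g p) (cov g kVec p *ᵥ v) (kVec p) = 0 := by
  have := hg.val_cov_add_eq_zero hp (hg.diff_kVec hp) (hg.diff_kVec hp)
    (fun q hq => hg.val_kVec_kVec hq) v
  linarith

theorem val_cov_lVec_lVec (v : V4) : val (g p) (cov g (lVec g) p *ᵥ v) (lVec g p) = 0 := by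
  have := hg.val_cov_add_eq_zero hp (hg.diff_lVec hp) (hg.diff_lVec hp)
    (fun q hq => hg.val_lVec_lVec hq) v
  linarith

theorem val_cov_lVec_kVec (v : V4) : val (g p) (cov g (lVec g) p *ᵥ v) (kVec p)
    = -val (g p) (cov g kVec p *ᵥ v) (lVec g p) := by
  have := hg.val_cov_add_eq_zero hp (hg.diff_lVec hp) (hg.diff_kVec hp)
    (fun q hq => hg.val_lVec_kVec hq) v
  linarith

theorem val_cov_eVec_kVec (a : Fin 3) (v : V4) : val (g p) (cov g (eVec g a) p *ᵥ v) (kVec p)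
    = -val (g p) (cov g kVec p *ᵥ v) (eVec g a p) := by
  have := hg.val_cov_add_eq_zero hp (hg.diff_eVec hp a) (hg.diff_kVec hp)
    (fun q hq => hg.val_eVec_kVec hq a) v
  linarith

theorem val_cov_eVec_lVec (a : Fin 3) (v : V4) : val (g p) (cov g (eVec g a) p *ᵥ v) (lVec g p)
    = -val (g p) (cov g (lVec g) p *ᵥ v) (eVec g a p) := by
  have := hg.val_cov_add_eq_zero hp (hg.diff_eVec hp a) (hg.diff_lVec hp)
    (fun q hq => hg.val_eVec_lVec hq a) v
  linarith

/-- Differentiates the Gram matrix x xᵀ − 1. The covariant derivatives of the frame are skew only up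
to the derivative of x xᵀ. -/
theorem val_cov_eVec_eVec (a c : Fin 3) (v : V4) :
    val (g p) (cov g (eVec g a) p *ᵥ v) (eVec g c p)
      + val (g p) (cov g (eVec g c) p *ᵥ v) (eVec g a p)
      = fderiv ℝ (fun q => dir q a) p v * dir p c + dir p a * fderiv ℝ (fun q => dir q c) p v := by
  rw [val_comm (hg.symm p hp) (cov g (eVec g c) p *ᵥ v),
    ← hg.smoothMetric.fderiv_val hp (hg.diff_eVec hp a) (hg.diff_eVec hp c)]
  have h : (fun q => val (g q) (eVec g a q) (eVec g c q)) =ᶠ[𝓝 p]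
      fun q => dir q a * dir q c - (1 : M3) a c := by
    filter_upwards [hg.isOpen.mem_nhds hp] with q hq
    rw [hg.val_eVec_eVec hq, orthProj, Matrix.sub_apply, vecMulVec_apply]; ring
  have da := differentiableAt_dir (hg.tail_ne p hp) a
  have dc := differentiableAt_dir (hg.tail_ne p hp) c
  rw [h.fderiv_eq, fderiv_sub_const, fderiv_fun_mul da dc]
  simp
  ring

theorem cov_const_symm (v w : V4) :
    cov g (fun _ => v) p *ᵥ w = cov g (fun _ => w) p *ᵥ v := by
  have := hg.smoothMetric.torsion_free hp (X := fun _ => v) (Y := fun _ => w)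
    (fun i => differentiableAt_const _) (fun i => differentiableAt_const _)
  simpa [sub_eq_zero] using this

/-- ∇k is the Hessian of u. In the proof the derivative of the constant g(k, w) is moved onto
constant fields, which commute. -/
theorem val_cov_kVec_symm (v w : V4) :
    val (g p) (cov g kVec p *ᵥ v) w = val (g p) (cov g kVec p *ᵥ w) v := by
  have h1 := hg.val_cov_add_eq_zero hp (hg.diff_kVec hp) (Y := fun _ => w)
    (fun i => differentiableAt_const _) (c := w 0)
    (fun q hq => by rw [val_comm (hg.symm q hq), hg.val_kVec hq]) v
  have h2 := hg.val_cov_add_eq_zero hp (hg.diff_kVec hp) (Y := fun _ => v)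
    (fun i => differentiableAt_const _) (c := v 0)
    (fun q hq => by rw [val_comm (hg.symm q hq), hg.val_kVec hq]) w
  rw [hg.cov_const_symm hp w v] at h1
  linarith

/-- By symmetry of ∇k the pairing is half the derivative of g(k, k) = 0. -/
theorem val_cov_kVec_self (v : V4) : val (g p) (cov g kVec p *ᵥ kVec p) v = 0 := by
  rw [hg.val_cov_kVec_symm hp, hg.val_cov_kVec_kVec hp]

theorem cov_kVec_self : cov g kVec p *ᵥ kVec p = 0 := by
  rw [(hg.resolution hp).expand (cov g kVec p *ᵥ kVec p)]
  simp [hg.val_cov_kVec_self hp]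

/-- Half the Lie derivative of the metric along the radial null field. -/
theorem two_mul_val_cov_kVec (v w : V4) : 2 * val (g p) (cov g kVec p *ᵥ v) w =
    fderiv ℝ (fun q => val (g q) v w) p (kVec p) + val (g p) (fderiv ℝ kVec p v) w
      + val (g p) (fderiv ℝ kVec p w) v := by
  have hc : ∀ v : V4, cov g (fun _ => v) p *ᵥ kVec p = cov g kVec p *ᵥ v - fderiv ℝ kVec p v := by
    intro v
    have := hg.smoothMetric.torsion_free hp (X := fun _ => v) (Y := kVec)
      (fun i => differentiableAt_const _) (hg.diff_kVec hp)
    simp only [fderiv_fun_const, Pi.zero_apply, _root_.zero_apply, zero_sub] at this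
    rw [sub_eq_iff_eq_add] at this
    rw [this]; abel
  rw [hg.smoothMetric.fderiv_val hp (X := fun _ => v) (Y := fun _ => w)
    (fun i => differentiableAt_const _) (fun i => differentiableAt_const _), hc, hc,
    val_comm (hg.symm p hp) v, val_sub_left, val_sub_left, hg.val_cov_kVec_symm hp w v]
  ring

theorem fderiv_eVec_zero (a : Fin 3) (z : V4) : fderiv ℝ (eVec g a) p z 0 = 0 := by
  rw [fderiv_apply_comp (hg.diff_eVec hp a), ← fderiv_eq_sum_pd]
  simp [eVec]

theorem dir_dot_fderiv_eVec (a : Fin 3) (z : V4) :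
    dir p ⬝ᵥ Fin.tail (fderiv ℝ (eVec g a) p z)
      = -∑ i, fderiv ℝ (fun q => dir q i) p z * eVec g a p i.succ := by
  have h := fderiv_eq_of_const (f := fun q => ∑ i, dir q i * eVec g a q i.succ) (c := 0) hg.isOpen
    (fun q hq => hg.dir_dot_root hq a) hp z
  have dd := differentiableAt_dir (hg.tail_ne p hp)
  have de := fun i : Fin 3 => hg.diff_eVec hp a i.succ
  rw [fderiv_fun_sum (fun i _ => (dd i).fun_mul (de i))] at h
  simp only [fderiv_fun_mul (dd _) (de _), _root_.sum_apply,
    _root_.add_apply, _root_.smul_apply, smul_eq_mul,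
    Finset.sum_add_distrib] at h
  have e : dir p ⬝ᵥ Fin.tail (fderiv ℝ (eVec g a) p z)
      = ∑ i, dir p i * fderiv ℝ (fun q => eVec g a q i.succ) p z := by
    refine Finset.sum_congr rfl fun i _ => ?_
    rw [Fin.tail, fderiv_apply_comp (hg.diff_eVec hp a), ← fderiv_eq_sum_pd]
  rw [e, eq_neg_iff_add_eq_zero, ← h]
  congr 1
  exact Finset.sum_congr rfl fun i _ => mul_comm _ _

omit hg hp in
theorem tail_eVec (a : Fin 3) : Fin.tail (eVec g a p) = fun i => rootMetric g p i a := rfl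

theorem fderiv_dir_eVec (a i : Fin 3) :
    fderiv ℝ (fun q => dir q i) p (eVec g a p) = eVec g a p i.succ / rad p := by
  rw [fderiv_dir (hg.tail_ne p hp), tail_eVec, hg.dir_dot_root hp]
  simp

theorem fderiv_kVec_eVec (a : Fin 3) :
    fderiv ℝ kVec p (eVec g a p) = (rad p)⁻¹ • eVec g a p := by
  rw [fderiv_kVec hg.tail_ne hg.isOpen hp, tail_eVec, hg.dir_dot_root hp]
  funext i
  refine Fin.cases ?_ (fun i => ?_) i <;> simp [eVec]

/-- The commutator of two frame fields is tangent to the spheres, hence orthogonal to l. This makes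
the second fundamental form of the spheres along l symmetric. -/
theorem val_lie_eVec_eVec_lVec (a b : Fin 3) :
    val (g p) (cov g (eVec g a) p *ᵥ eVec g b p) (lVec g p)
      = val (g p) (cov g (eVec g b) p *ᵥ eVec g a p) (lVec g p) := by
  rw [← sub_eq_zero, ← val_sub_left,
    hg.smoothMetric.torsion_free hp (hg.diff_eVec hp a) (hg.diff_eVec hp b), val_sub_left,
    hg.val_lVec hp, hg.val_lVec hp, hg.fderiv_eVec_zero hp, hg.fderiv_eVec_zero hp,
    hg.dir_dot_fderiv_eVec hp, hg.dir_dot_fderiv_eVec hp]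
  simp only [hg.fderiv_dir_eVec hp, Fin.sum_univ_three]
  ring

theorem val_cov_lVec_eVec_symm (a b : Fin 3) :
    val (g p) (cov g (lVec g) p *ᵥ eVec g a p) (eVec g b p)
      = val (g p) (cov g (lVec g) p *ᵥ eVec g b p) (eVec g a p) := by
  have := hg.val_lie_eVec_eVec_lVec hp a b
  rw [hg.val_cov_eVec_lVec hp, hg.val_cov_eVec_lVec hp] at this
  linarith

/-- The commutator of E_a with k is tangent to the spheres and so orthogonal to l; combine this with
the symmetry of ∇k. -/
theorem val_cov_lVec_kVec_eVec (a : Fin 3) :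
    val (g p) (cov g (lVec g) p *ᵥ kVec p) (eVec g a p)
      = -val (g p) (cov g kVec p *ᵥ lVec g p) (eVec g a p) := by
  have h1 : val (g p) (cov g (eVec g a) p *ᵥ kVec p - cov g kVec p *ᵥ eVec g a p) (lVec g p)
      = 0 := by
    rw [hg.smoothMetric.torsion_free hp (hg.diff_eVec hp a) (hg.diff_kVec hp), val_sub_left,
      hg.fderiv_kVec_eVec hp, val_smul_left, hg.val_eVec_lVec hp, hg.val_lVec hp,
      hg.fderiv_eVec_zero hp, hg.dir_dot_fderiv_eVec hp]
    simp [fderiv_dir_kVec (hg.tail_ne p hp)]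
  rw [val_sub_left, hg.val_cov_eVec_lVec hp, hg.val_cov_kVec_symm hp (eVec g a p)] at h1
  linarith

/-- Differentiate Σ dir_a E_a = 0. The Christoffel terms drop out because the combination itself
vanishes, and only the derivative of the coefficients survives. -/
theorem sum_dir_smul_cov_eVec (v : V4) : ∑ a, dir p a • (cov g (eVec g a) p *ᵥ v)
    = -∑ a, fderiv ℝ (fun q => dir q a) p v • eVec g a p := by
  have hs : ∀ i : Fin 4, ∑ a, (dir p a * fderiv ℝ (fun q => eVec g a q i) p v
      + fderiv ℝ (fun q => dir q a) p v * eVec g a p i) = 0 := by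
    intro i
    have h := fderiv_eq_of_const (f := fun q => ∑ a, dir q a * eVec g a q i) (c := 0) hg.isOpen
      (fun q hq => by simpa using congrFun (hg.sum_dir_smul_eVec hq) i) hp v
    have dd := differentiableAt_dir (hg.tail_ne p hp)
    have de := fun a : Fin 3 => hg.diff_eVec hp a i
    rw [fderiv_fun_sum (fun a _ => (dd a).fun_mul (de a))] at h
    simp only [fderiv_fun_mul (dd _) (de _), _root_.sum_apply,
      _root_.add_apply, _root_.smul_apply, smul_eq_mul] at h
    rw [← h]
    exact Finset.sum_congr rfl fun a _ => by ring
  have hz := fun i => congrFun (hg.sum_dir_smul_eVec hp) i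
  simp only [Finset.sum_apply, Pi.smul_apply, smul_eq_mul, Pi.zero_apply] at hz
  funext i
  have h1 : ∀ a, (cov g (eVec g a) p *ᵥ v) i = fderiv ℝ (fun q => eVec g a q i) p v
      + ∑ l, (∑ j, christoffel g i l j p * v j) * eVec g a p l := by
    intro a
    rw [fderiv_eq_sum_pd]
    simp only [mulVec, dotProduct, cov, Matrix.of_apply, Fin.sum_univ_four]
    ring
  have h2 : ∑ a, dir p a * ∑ l, (∑ j, christoffel g i l j p * v j) * eVec g a p l = 0 := by
    simp only [Finset.mul_sum]
    rw [Finset.sum_comm]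
    refine Finset.sum_eq_zero fun l _ => ?_
    calc _ = (∑ j, christoffel g i l j p * v j) * ∑ a, dir p a * eVec g a p l := by
          rw [Finset.mul_sum]; exact Finset.sum_congr rfl fun a _ => by ring
      _ = 0 := by rw [hz, mul_zero]
  have h3 := hs i
  rw [Finset.sum_add_distrib] at h3
  simp only [Finset.sum_apply, Pi.smul_apply, smul_eq_mul, Pi.neg_apply, h1, mul_add,
    Finset.sum_add_distrib]
  linarith

end BondiChart

/-! ### Constant rotations of the tight frame -/

theorem sum_rotate {O : M3} (h : O * Oᵀ = 1) (β : Fin 3 → Fin 3 → ℝ) :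
    ∑ b, ∑ a, ∑ c, O a b * O c b * β a c = ∑ a, β a a := by
  have h1 : ∀ a c, ∑ b, O a b * O c b = if a = c then 1 else 0 := fun a c => by
    rw [← Matrix.one_apply, ← h, Matrix.mul_apply]; rfl
  rw [Finset.sum_comm]
  refine Finset.sum_congr rfl fun a _ => ?_
  rw [Finset.sum_comm]
  simp only [← Finset.sum_mul, h1, ite_mul, one_mul, zero_mul, Finset.sum_ite_eq, Finset.mem_univ,
    if_true]

theorem val_sum_right {ι : Type*} (s : Finset ι) (G : M4) (v : V4) (w : ι → V4) :
    val G v (∑ a ∈ s, w a) = ∑ a ∈ s, val G v (w a) := by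
  simp [val, mulVec_sum, dotProduct_sum]

theorem val_smul_right (G : M4) (c : ℝ) (v w : V4) : val G v (c • w) = c * val G v w := by
  simp [val, mulVec_smul]

/-- A frame rotated by a constant matrix. -/
def rotVec (O : M3) (E : Fin 3 → V4) (b : Fin 3) : V4 := ∑ a, O a b • E a

/-- Endomorphisms rotated by a constant matrix. -/
def rotMat (O : M3) (M : Fin 3 → M4) (b : Fin 3) : M4 := ∑ a, O a b • M a

theorem val_rotMat_left (O : M3) (M : Fin 3 → M4) (b : Fin 3) (G : M4) (v w : V4) :
    val G (rotMat O M b *ᵥ v) w = ∑ a, O a b * val G (M a *ᵥ v) w := by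
  simp only [rotMat, sum_mulVec, smul_mulVec, val_sum_left, val_smul_left]

theorem val_rotVec_right (O : M3) (E : Fin 3 → V4) (b : Fin 3) (G : M4) (w : V4) :
    val G w (rotVec O E b) = ∑ a, O a b * val G w (E a) := by
  simp only [rotVec, val_sum_right, val_smul_right]

/-- The expression is a bilinear form in the frame traced with the identity, hence unchanged under a
constant orthogonal matrix. This allows a rotation adapted to a single point. -/
theorem quadratic_rotate {O : M3} (h : O * Oᵀ = 1) (M : Fin 3 → M4) :
    ∑ b, ((rotMat O M b).trace ^ 2 - (rotMat O M b * rotMat O M b).trace)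
      = ∑ a, ((M a).trace ^ 2 - (M a * M a).trace) := by
  have := sum_rotate h fun a c => (M a).trace * (M c).trace - (M a * M c).trace
  simp only [sq, ← this]
  refine Finset.sum_congr rfl fun b _ => ?_
  simp only [rotMat, trace_sum, trace_smul, smul_eq_mul, Finset.sum_mul, Finset.mul_sum,
    smul_mul_smul_comm, ← Finset.sum_sub_distrib]
  rw [Finset.sum_comm]
  refine Finset.sum_congr rfl fun a _ => Finset.sum_congr rfl fun c _ => ?_
  rw [trace_mul_comm]
  ring

theorem Resolution.rotate {O : M3} (h : O * Oᵀ = 1) {G : M4} {k l : V4} {E : Fin 3 → V4}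
    (hr : Resolution G k l E) : Resolution G k l (rotVec O E) := by
  unfold Resolution at *
  rw [← hr]
  congr 1
  ext i j
  have := sum_rotate h fun a c => E a i * (G *ᵥ E c) j
  simp only [Matrix.sum_apply, vecMulVec_apply, ← this]
  refine Finset.sum_congr rfl fun b _ => ?_
  simp only [rotVec, mulVec_sum, mulVec_smul, Finset.sum_apply, Pi.smul_apply, smul_eq_mul,
    Finset.sum_mul, Finset.mul_sum]
  rw [Finset.sum_comm]
  exact Finset.sum_congr rfl fun a _ => Finset.sum_congr rfl fun c _ => by ring

/-- The tangential part `[k, l]` of the commutator of the null fields. -/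
def twist (g : V4 → M4) (p : V4) : Fin 3 → ℝ := fun i =>
  fderiv ℝ (fun q => shift g q i) p (kVec p) - shift g p i / rad p

/-! ### The commutator of the null fields and the quadratic terms -/

namespace BondiChart

variable {g : V4 → M4} {U : Set V4} (hg : BondiChart g U) {p : V4} (hp : p ∈ U)
include hg hp

theorem diff_shift (i : Fin 3) : DifferentiableAt ℝ (fun q => shift g q i) p :=
  differentiableAt_of_smooth hg.isOpen (hg.smooth_shift i) hp

theorem diff_lapse : DifferentiableAt ℝ (lapse g) p :=
  differentiableAt_of_smooth hg.isOpen hg.smooth_lapse hp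

theorem dir_dot_fderiv_shift :
    (dir p ⬝ᵥ fun i => fderiv ℝ (fun q => shift g q i) p (kVec p)) = 0 := by
  have h := fderiv_eq_of_const (f := fun q => ∑ i, dir q i * shift g q i) (c := 0) hg.isOpen
    (fun q hq => hg.shift_radial hq) hp (kVec p)
  have dd := differentiableAt_dir (hg.tail_ne p hp)
  have de := hg.diff_shift hp
  rw [fderiv_fun_sum (fun i _ => (dd i).fun_mul (de i))] at h
  simp only [fderiv_fun_mul (dd _) (de _), _root_.sum_apply,
    _root_.add_apply, _root_.smul_apply, smul_eq_mul, fderiv_dir_kVec (hg.tail_ne p hp), mul_zero,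
    add_zero] at h
  exact h

theorem dir_dot_twist : dir p ⬝ᵥ twist g p = 0 := by
  have h : twist g p = (fun i => fderiv ℝ (fun q => shift g q i) p (kVec p))
      - (rad p)⁻¹ • shift g p := by
    funext i; simp [twist]; ring
  rw [h, dotProduct_sub, hg.dir_dot_fderiv_shift hp, dotProduct_smul, hg.shift_radial hp]
  simp

omit hg hp in
theorem tail_lVec : Fin.tail (lVec g p) = shift g p - (lapse g p / 2) • dir p := rfl

/-- The commutator of the null fields. -/
theorem commutator : fderiv ℝ kVec p (lVec g p) - fderiv ℝ (lVec g) p (kVec p) =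
    (Fin.cons 0 (-twist g p + (fderiv ℝ (lapse g) p (kVec p) / 2) • dir p) : Fin 4 → ℝ) := by
  funext i
  rw [Pi.sub_apply, fderiv_kVec hg.tail_ne hg.isOpen hp, fderiv_apply_comp (hg.diff_lVec hp),
    ← fderiv_eq_sum_pd]
  have e1 : dir p ⬝ᵥ Fin.tail (lVec g p) = -(lapse g p / 2) := by
    rw [tail_lVec, dotProduct_sub, hg.shift_radial hp, dotProduct_smul, hg.dir_unit hp]
    simp
  refine Fin.cases ?_ (fun i => ?_) i
  · simp [lVec]
  · have dd := differentiableAt_dir (hg.tail_ne p hp) i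
    have e2 : fderiv ℝ (fun q => lVec g q i.succ) p (kVec p)
        = fderiv ℝ (fun q => shift g q i) p (kVec p)
          - fderiv ℝ (lapse g) p (kVec p) / 2 * dir p i := by
      have : (fun q => lVec g q i.succ) = fun q => shift g q i - 2⁻¹ * lapse g q * dir q i := by
        funext q
        simp only [lVec, Fin.cons_succ, Pi.sub_apply, Pi.smul_apply, smul_eq_mul]
        ring
      rw [this, fderiv_fun_sub (hg.diff_shift hp i)
        (((hg.diff_lapse hp).const_mul _).fun_mul dd),
        fderiv_fun_mul ((hg.diff_lapse hp).const_mul _) dd, fderiv_const_mul (hg.diff_lapse hp)]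
      simp [fderiv_dir_kVec (hg.tail_ne p hp)]
      ring
    rw [e2, e1]
    simp only [Fin.cons_succ, Pi.smul_apply, Pi.sub_apply, Pi.add_apply, Pi.neg_apply, smul_eq_mul,
      twist, tail_lVec]
    ring

/-- On tangential vectors ∇_k l = −∇_l k, so the commutator is twice ∇_l k there; this is the factor
1/2. -/
theorem val_cov_kVec_lVec_eVec (a : Fin 3) :
    val (g p) (cov g kVec p *ᵥ lVec g p) (eVec g a p)
      = -(1 / 2) * (rootMetric g p *ᵥ sp (g p) *ᵥ twist g p) a := by
  have h1 : val (g p) (cov g kVec p *ᵥ lVec g p - cov g (lVec g) p *ᵥ kVec p) (eVec g a p)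
      = -(rootMetric g p *ᵥ sp (g p) *ᵥ twist g p) a := by
    rw [hg.smoothMetric.torsion_free hp (hg.diff_kVec hp) (hg.diff_lVec hp), hg.commutator hp,
      eVec, val_cons]
    have e : (-twist g p + (fderiv ℝ (lapse g) p (kVec p) / 2) • dir p) ⬝ᵥ
        sp (g p) *ᵥ (fun i => rootMetric g p i a)
        = -((twist g p ᵥ* sp (g p)) ⬝ᵥ fun i => rootMetric g p i a) := by
      rw [dotProduct_mulVec, add_vecMul, smul_vecMul, hg.radial' hp, neg_vecMul]
      simp
    rw [e, ← mulVec_transpose, hg.sp_symm hp, mulVec_mulVec, ← mulVec_mulVec]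
    simp only [zero_mul, mul_zero, zero_add]
    congr 1
    simp only [dotProduct, mulVec]
    refine Finset.sum_congr rfl fun j _ => ?_
    have h : rootMetric g p a j = rootMetric g p j a :=
      congrFun (congrFun (hg.rootMetric_symm hp) j) a
    rw [h, mul_comm]
  rw [val_sub_left, hg.val_cov_lVec_kVec_eVec hp] at h1
  linarith

theorem sum_sq_val_cov_kVec_lVec_eVec :
    ∑ a, val (g p) (cov g kVec p *ᵥ lVec g p) (eVec g a p) ^ 2
      = -(1 / 4) * (twist g p ⬝ᵥ sp (g p) *ᵥ twist g p) := by
  set z := sp (g p) *ᵥ twist g p with hz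
  have e : ∑ a, (rootMetric g p *ᵥ z) a ^ 2 = -(twist g p ⬝ᵥ z) := by
    have e1 : ∑ a, (rootMetric g p *ᵥ z) a ^ 2 = (rootMetric g p *ᵥ z) ⬝ᵥ (rootMetric g p *ᵥ z) :=
      Finset.sum_congr rfl fun a _ => sq _
    have e2 : z ᵥ* (invMetric g p) = -twist g p := by
      rw [← mulVec_transpose, hg.invMetric_symm hp, hz, mulVec_mulVec, hg.invMetric_mul_sp hp,
        orthProj, neg_mulVec, sub_mulVec, one_mulVec, vecMulVec_mulVec, hg.dir_dot_twist hp]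
      simp
    have e3 : rootMetric g p *ᵥ z = z ᵥ* rootMetric g p := by
      rw [← vecMul_transpose, hg.rootMetric_symm hp]
    rw [e1, dotProduct_mulVec, e3, vecMul_vecMul, hg.rootMetric_mul_self hp, e2, neg_dotProduct]
  simp only [hg.val_cov_kVec_lVec_eVec hp, mul_pow, ← Finset.mul_sum]
  rw [← hz, e]
  ring

/-- The quadratic terms in the contracted Ricci identity for the tight frame. -/
theorem sum_quadratic :
    ∑ a, (divg g (eVec g a) p ^ 2 - (cov g (eVec g a) p * cov g (eVec g a) p).trace)
      = 1 / 2 * (twist g p ⬝ᵥ sp (g p) *ᵥ twist g p) + 2 / (rad p ^ 2 * rho g p) := by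
  -- O is a constant matrix whose third column is the value of `dir` at p. At p the rotated frame
  -- consists of an orthonormal pair and the zero vector.
  obtain ⟨O, hO1, hO2, hO3⟩ := exists_orthogonal (hg.dir_unit hp)
  set M : Fin 3 → M4 := fun a => cov g (eVec g a) p with hM
  set E : Fin 3 → V4 := fun a => eVec g a p with hE
  have hcol : ∀ a, O a 2 = dir p a := fun a => by simpa using congrFun hO3 a
  have hOx : ∀ d, ∑ c, O c d * dir p c = if d = 2 then 1 else 0 := by
    intro d
    have := congrFun (congrFun hO1 d) 2
    rw [Matrix.mul_apply, Matrix.one_apply] at this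
    simpa [hcol] using this
  have hr : Resolution (g p) (kVec p) (lVec g p) (rotVec O E) := (hg.resolution hp).rotate hO2
  have hE2 : rotVec O E 2 = 0 := by
    simp only [rotVec, hcol, hE]; exact hg.sum_dir_smul_eVec hp
  -- The first two columns of O are orthogonal to dir p, which kills the derivative of x xᵀ in
  -- `val_cov_eVec_eVec`. The rotated pair therefore satisfies the relations of an orthonormal frame
  -- to first order at p.
  have skew : ∀ b d : Fin 3, b ≠ 2 → d ≠ 2 → ∀ v,
      val (g p) (rotMat O M b *ᵥ v) (rotVec O E d)
        + val (g p) (rotMat O M d *ᵥ v) (rotVec O E b) = 0 := by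
    intro b d hb hd v
    have e : val (g p) (rotMat O M b *ᵥ v) (rotVec O E d)
        + val (g p) (rotMat O M d *ᵥ v) (rotVec O E b) = ∑ a, ∑ c, O a b * O c d *
          (val (g p) (M a *ᵥ v) (E c) + val (g p) (M c *ᵥ v) (E a)) := by
      simp only [val_rotMat_left, val_rotVec_right, Finset.mul_sum, mul_add,
        Finset.sum_add_distrib]
      congr 1
      · rw [Finset.sum_comm]
        exact Finset.sum_congr rfl fun a _ => Finset.sum_congr rfl fun c _ => by ring
      · exact Finset.sum_congr rfl fun a _ => Finset.sum_congr rfl fun c _ => by ring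
    have hb0 := hOx b
    have hd0 := hOx d
    rw [if_neg hb] at hb0
    rw [if_neg hd] at hd0
    rw [e]
    simp only [hM, hE, hg.val_cov_eVec_eVec hp]
    calc _ = (∑ a, O a b * fderiv ℝ (fun q => dir q a) p v) * (∑ c, O c d * dir p c)
          + (∑ a, O a b * dir p a) * (∑ c, O c d * fderiv ℝ (fun q => dir q c) p v) := by
          simp only [Fin.sum_univ_three]; ring
      _ = 0 := by rw [hb0, hd0]; ring
  have hK0 : ∀ b v, val (g p) (rotMat O M b *ᵥ v) (kVec p)
      = -val (g p) (cov g kVec p *ᵥ v) (rotVec O E b) := by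
    intro b v
    simp only [val_rotMat_left, val_rotVec_right, hM, hE, hg.val_cov_eVec_kVec hp, mul_neg,
      Finset.sum_neg_distrib]
  have hL0 : ∀ b v, val (g p) (rotMat O M b *ᵥ v) (lVec g p)
      = -val (g p) (cov g (lVec g) p *ᵥ v) (rotVec O E b) := by
    intro b v
    simp only [val_rotMat_left, val_rotVec_right, hM, hE, hg.val_cov_eVec_lVec hp, mul_neg,
      Finset.sum_neg_distrib]
  have hLk : ∀ b, val (g p) (cov g (lVec g) p *ᵥ kVec p) (rotVec O E b)
      = -val (g p) (cov g kVec p *ᵥ lVec g p) (rotVec O E b) := by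
    intro b
    simp only [val_rotVec_right, hE, hg.val_cov_lVec_kVec_eVec hp, mul_neg,
      Finset.sum_neg_distrib]
  have hLs : ∀ b d, val (g p) (cov g (lVec g) p *ᵥ rotVec O E b) (rotVec O E d)
      = val (g p) (cov g (lVec g) p *ᵥ rotVec O E d) (rotVec O E b) := by
    intro b d
    have e : ∀ b d, val (g p) (cov g (lVec g) p *ᵥ rotVec O E b) (rotVec O E d)
        = ∑ a, ∑ c, O a b * O c d * val (g p) (cov g (lVec g) p *ᵥ E a) (E c) := by
      intro b d
      simp only [val_rotVec_right]
      simp only [rotVec, mulVec_sum, mulVec_smul, val_sum_left, val_smul_left, Finset.mul_sum]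
      rw [Finset.sum_comm]
      exact Finset.sum_congr rfl fun a _ => Finset.sum_congr rfl fun c _ => by ring
    rw [e, e, Finset.sum_comm]
    refine Finset.sum_congr rfl fun a _ => Finset.sum_congr rfl fun c _ => ?_
    simp only [hE]
    rw [hg.val_cov_lVec_eVec_symm hp]
    ring
  have hself : ∀ b : Fin 3, b ≠ 2 → ∀ v, val (g p) (rotMat O M b *ᵥ v) (rotVec O E b) = 0 := by
    intro b hb v
    have := skew b b hb hb v
    linarith
  have htan := hr.quadratic_tangent hE2 (K := cov g kVec p) (L := cov g (lVec g) p)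
    (M₀ := rotMat O M 0) (M₁ := rotMat O M 1)
    (hg.val_cov_kVec_self hp) (hg.val_cov_kVec_symm hp) (hLs 0 1) (hLk 0) (hLk 1)
    (hK0 0) (hK0 1) (hL0 0) (hL0 1) (hself 0 (by decide)) (hself 1 (by decide))
    (fun v => by linarith [skew 0 1 (by decide) (by decide) v])
  -- The third rotated field has its coefficients frozen at p: it vanishes at p but not nearby, and
  -- its derivative is governed by the derivative of the position vector.
  have hM2 : ∀ v, rotMat O M 2 *ᵥ v = -∑ a, fderiv ℝ (fun q => dir q a) p v • E a := by
    intro v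
    simp only [rotMat, hcol, sum_mulVec, smul_mulVec, hM, hE]
    exact hg.sum_dir_smul_cov_eVec hp v
  have hnor := hr.quadratic_normal hE2 (M := rotMat O M 2)
    (fun v => by
      rw [hM2, val_neg_left, val_sum_left]
      simp [val_smul_left, hE, hg.val_eVec_kVec hp])
    (fun v => by
      rw [hM2, val_neg_left, val_sum_left]
      simp [val_smul_left, hE, hg.val_eVec_lVec hp])
  have hrad := (rad_pos (hg.tail_ne p hp)).ne'
  set C := Oᵀ * rootMetric g p * O with hC
  have hBE : ∀ b a : Fin 3, fderiv ℝ (fun q => dir q a) p (rotVec O E b)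
      = (rootMetric g p * O) a b / rad p := by
    intro b a
    simp only [rotVec, map_sum, map_smul, hE, hg.fderiv_dir_eVec hp, smul_eq_mul]
    simp only [eVec, Fin.cons_succ, Matrix.mul_apply, Finset.sum_div]
    exact Finset.sum_congr rfl fun c _ => by ring
  have hpair : ∀ b d : Fin 3, d ≠ 2 → val (g p) (rotMat O M 2 *ᵥ rotVec O E b) (rotVec O E d)
      = C d b / rad p := by
    intro b d hd
    have hd0 := hOx d
    rw [if_neg hd] at hd0
    have hP : ∀ a, ∑ c, O c d * (-orthProj (dir p) a c) = -O a d := by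
      intro a
      have : ∀ c, O c d * (-orthProj (dir p) a c)
          = dir p a * (O c d * dir p c) - O c d * (1 : M3) a c := fun c => by
        rw [orthProj, Matrix.sub_apply, vecMulVec_apply]; ring
      simp only [this, Finset.sum_sub_distrib, ← Finset.mul_sum, hd0]
      simp [Matrix.one_apply]
    rw [hM2, val_neg_left, val_sum_left]
    simp only [val_smul_left, hBE]
    simp only [val_rotVec_right, hE, hg.val_eVec_eVec hp, hP]
    rw [hC, Matrix.mul_assoc, Matrix.mul_apply, Finset.sum_div, ← Finset.sum_neg_distrib]
    exact Finset.sum_congr rfl fun a _ => by rw [transpose_apply]; ring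
  -- C is the root metric in the adapted basis, with block determinant 1/ρ. With a factor 1/rad from
  -- each derivative of `dir` the third field contributes 2/(rad² ρ).
  have hdet : C 0 0 * C 1 1 - C 0 1 * C 1 0 = (rho g p)⁻¹ := by
    have hc : ∀ i, C i 2 = 0 := by
      intro i
      have : C *ᵥ Pi.single 2 1 = 0 := by
        rw [hC, ← mulVec_mulVec, hO3, ← mulVec_mulVec, hg.rootMetric_radial hp, mulVec_zero]
      simpa using congrFun this i
    have hc' : ∀ i, C 2 i = 0 := by
      intro i
      have : Pi.single 2 1 ᵥ* C = 0 := by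
        rw [hC, ← vecMul_vecMul, ← vecMul_vecMul, vecMul_transpose, hO3,
          hg.rootMetric_radial' hp, zero_vecMul]
      simpa using congrFun this i
    have hBC : rootMetric g p = O * C * Oᵀ := by
      rw [hC]
      calc rootMetric g p = (O * Oᵀ) * rootMetric g p * (O * Oᵀ) := by rw [hO2]; simp
        _ = _ := by simp only [Matrix.mul_assoc]
    rw [← hg.det_rootMetric hp, vecMulVec_eq_conj hO3, hBC, conj_add, det_conj hO1]
    simp [det_fin_three, hc, hc']
  have hsq : val (g p) (cov g kVec p *ᵥ lVec g p) (rotVec O E 0) ^ 2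
      + val (g p) (cov g kVec p *ᵥ lVec g p) (rotVec O E 1) ^ 2
      = -(1 / 4) * (twist g p ⬝ᵥ sp (g p) *ᵥ twist g p) := by
    rw [← hg.sum_sq_val_cov_kVec_lVec_eVec hp]
    have := sum_rotate hO2 fun a c => val (g p) (cov g kVec p *ᵥ lVec g p) (E a)
      * val (g p) (cov g kVec p *ᵥ lVec g p) (E c)
    have e : ∀ b, ∑ a, ∑ c, O a b * O c b * (val (g p) (cov g kVec p *ᵥ lVec g p) (E a)
      * val (g p) (cov g kVec p *ᵥ lVec g p) (E c))
        = val (g p) (cov g kVec p *ᵥ lVec g p) (rotVec O E b) ^ 2 := by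
      intro b
      rw [val_rotVec_right, sq, Finset.sum_mul_sum]
      exact Finset.sum_congr rfl fun a _ => Finset.sum_congr rfl fun c _ => by ring
    simp only [e, ← sq] at this
    rw [← this, Fin.sum_univ_three, hE2]
    simp [val]
  have hsum := quadratic_rotate hO2 M
  have hfin : ∑ a, (divg g (eVec g a) p ^ 2 - (cov g (eVec g a) p * cov g (eVec g a) p).trace)
      = ∑ a, ((M a).trace ^ 2 - (M a * M a).trace) := rfl
  rw [hfin, ← hsum, Fin.sum_univ_three, htan, hnor, hpair 0 0 (by decide), hpair 1 1 (by decide),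
    hpair 0 1 (by decide), hpair 1 0 (by decide), hsq]
  have hrho := (hg.rho_pos hp).ne'
  have hdet' : rho g p * (C 0 0 * C 1 1 - C 0 1 * C 1 0) = 1 := by
    rw [hdet, mul_inv_cancel₀ hrho]
  field_simp
  linear_combination 16 * hdet'

end BondiChart

/-- The flat divergence over the spatial coordinates. -/
def div3 (X : V4 → Fin 3 → ℝ) (p : V4) : ℝ := ∑ i, pd i.succ (fun q => X q i) p

/-- The divergence of the radial null field. -/
def expansion (g : V4 → M4) (p : V4) : ℝ := divg g kVec p

/-- The vector field whose divergence appears in the contracted Ricci identity for the frame. -/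
def flux (g : V4 → M4) (p : V4) : V4 :=
  ∑ a, (cov g (eVec g a) p *ᵥ eVec g a p - divg g (eVec g a) p • eVec g a p)

/-- At p the connection terms depend only on the value of X, so freezing X removes exactly the
derivative of its components. -/
theorem cov_sub_cov_const (g : V4 → M4) {X : V4 → V4} {p : V4}
    (hX : ∀ i, DifferentiableAt ℝ (fun q => X q i) p) (v : V4) :
    cov g X p *ᵥ v - cov g (fun _ => X p) p *ᵥ v = fderiv ℝ X p v := by
  funext i
  simp only [Pi.sub_apply, fderiv_apply_comp hX, mulVec, dotProduct, cov, Matrix.of_apply,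
    pd_const, ← Finset.sum_sub_distrib]
  exact Finset.sum_congr rfl fun j _ => by ring

/-- Jacobi's formula, by explicit expansion of the determinant. -/
theorem pd_det_three {A : V4 → M3} {p : V4}
    (hA : ∀ i j, DifferentiableAt ℝ (fun q => A q i j) p) (hu : IsUnit (A p).det) (m : Fin 4) :
    pd m (fun q => (A q).det) p
      = (A p).det * ((A p)⁻¹ * Matrix.of fun i j => pd m (fun q => A q i j) p).trace := by
  have h1 : (A p).det * ((A p)⁻¹ * Matrix.of fun i j => pd m (fun q => A q i j) p).trace
      = ((A p).adjugate * Matrix.of fun i j => pd m (fun q => A q i j) p).trace := by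
    rw [Matrix.inv_def, smul_mul_assoc, trace_smul, smul_eq_mul, ← mul_assoc,
      Ring.mul_inverse_cancel _ hu, one_mul]
  rw [h1]
  have d2 : ∀ i j k l, DifferentiableAt ℝ (fun q => A q i j * A q k l) p := fun i j k l =>
    (hA i j).fun_mul (hA k l)
  have d3 : ∀ i j k l m n, DifferentiableAt ℝ (fun q => A q i j * A q k l * A q m n) p :=
    fun i j k l m n => (d2 i j k l).fun_mul (hA m n)
  have e3 : ∀ i j k l a b, pd m (fun q => A q i j * A q k l * A q a b) p =
      A p i j * A p k l * pd m (fun q => A q a b) p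
      + (A p i j * pd m (fun q => A q k l) p + pd m (fun q => A q i j) p * A p k l) * A p a b := by
    intro i j k l a b
    rw [pd_mul (d2 _ _ _ _) (hA _ _), pd_mul (hA _ _) (hA _ _)]
  simp only [det_fin_three]
  rw [pd_sub (((((d3 _ _ _ _ _ _).fun_sub (d3 _ _ _ _ _ _)).fun_sub (d3 _ _ _ _ _ _)).fun_add
      (d3 _ _ _ _ _ _)).fun_add (d3 _ _ _ _ _ _)) (d3 _ _ _ _ _ _),
    pd_add ((((d3 _ _ _ _ _ _).fun_sub (d3 _ _ _ _ _ _)).fun_sub (d3 _ _ _ _ _ _)).fun_add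
      (d3 _ _ _ _ _ _)) (d3 _ _ _ _ _ _),
    pd_add (((d3 _ _ _ _ _ _).fun_sub (d3 _ _ _ _ _ _)).fun_sub (d3 _ _ _ _ _ _))
      (d3 _ _ _ _ _ _),
    pd_sub ((d3 _ _ _ _ _ _).fun_sub (d3 _ _ _ _ _ _)) (d3 _ _ _ _ _ _),
    pd_sub (d3 _ _ _ _ _ _) (d3 _ _ _ _ _ _)]
  simp only [e3, adjugate_fin_three, trace, Fin.sum_univ_three, Matrix.mul_apply, diag, of_apply,
    cons_val', cons_val_zero, cons_val_one, cons_val_two, cons_val_fin_one, vecHead, vecTail, Function.comp]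
  simp
  ring

/-- The Euclidean divergence of the unit radial field is 2 / rad. -/
theorem div3_smul_dir {f : V4 → ℝ} {p : V4} (hp : Fin.tail p ≠ 0) (hf : DifferentiableAt ℝ f p) :
    div3 (fun q i => f q * dir q i) p = fderiv ℝ f p (kVec p) + 2 * f p / rad p := by
  have hr := (rad_pos hp).ne'
  have h1 : ∀ i : Fin 3, pd i.succ (fun q => dir q i) p = (1 - dir p i ^ 2) / rad p := by
    intro i
    rw [pd, fderiv_dir hp]
    have : (dir p ⬝ᵥ Fin.tail (Pi.single i.succ 1 : V4)) = dir p i := by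
      have : Fin.tail (Pi.single i.succ 1 : V4) = Pi.single i 1 := by
        funext j
        simp [Fin.tail, Pi.single_apply]
      rw [this]; simp
    rw [this]; simp; ring
  have h2 : dir p 0 ^ 2 + dir p 1 ^ 2 + dir p 2 ^ 2 = 1 := by
    have := dir_dot_dir hp
    simp only [dotProduct, Fin.sum_univ_three] at this
    linarith
  have h3 : fderiv ℝ f p (kVec p) = ∑ i, dir p i * pd i.succ f p := by
    rw [fderiv_eq_sum_pd, Fin.sum_univ_succ]
    simp [kVec]
  simp only [div3, pd_mul hf (differentiableAt_dir hp _), h1, h3, Fin.sum_univ_three]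
  field_simp
  linear_combination (-f p) * h2

theorem div3_add {X Y : V4 → Fin 3 → ℝ} {p : V4}
    (hX : ∀ i, DifferentiableAt ℝ (fun q => X q i) p)
    (hY : ∀ i, DifferentiableAt ℝ (fun q => Y q i) p) :
    div3 (fun q i => X q i + Y q i) p = div3 X p + div3 Y p := by
  simp only [div3, pd_add (hX _) (hY _), Finset.sum_add_distrib]

theorem div3_congr {X Y : V4 → Fin 3 → ℝ} {U : Set V4} (hU : IsOpen U)
    (h : ∀ q ∈ U, X q = Y q) {p : V4} (hp : p ∈ U) : div3 X p = div3 Y p := by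
  refine Finset.sum_congr rfl fun i _ => pd_congr ?_ _
  filter_upwards [hU.mem_nhds hp] with q hq
  rw [h q hq]

/-! ### The volume density and the components of the flux -/

namespace BondiChart

variable {g : V4 → M4} {U : Set V4} (hg : BondiChart g U)
include hg

theorem smooth_expansion : ContDiffOn ℝ ∞ (expansion g) U :=
  hg.smoothMetric.divg_smooth (smoothVF_kVec hg.tail_ne)

theorem smooth_flux : SmoothVF (flux g) U := by
  intro i
  have : (fun q => flux g q i) = fun q => ∑ a, ((cov g (eVec g a) q *ᵥ eVec g a q) i
      - divg g (eVec g a) q * eVec g a q i) := by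
    funext q
    simp only [flux, Finset.sum_apply, Pi.sub_apply, Pi.smul_apply, smul_eq_mul]
  rw [this]
  exact ContDiffOn.sum fun a _ => (hg.smoothMetric.smoothVF_cov_mulVec (hg.smoothVF_eVec a)
    (hg.smoothVF_eVec a) i).sub ((hg.smoothMetric.divg_smooth (hg.smoothVF_eVec a)).mul
      (hg.smoothVF_eVec a i))

variable {p : V4} (hp : p ∈ U)
include hp

theorem sum_val_ricci_eVec : ∑ a, val (ricci g p) (eVec g a p) (eVec g a p) =
    divg g (flux g) p + 1 / 2 * (twist g p ⬝ᵥ sp (g p) *ᵥ twist g p)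
      + 2 / (rad p ^ 2 * rho g p) := by
  have hs : ∀ a, SmoothVF (fun q => cov g (eVec g a) q *ᵥ eVec g a q
      - divg g (eVec g a) q • eVec g a q) U := fun a i =>
    (hg.smoothMetric.smoothVF_cov_mulVec (hg.smoothVF_eVec a) (hg.smoothVF_eVec a) i).sub
      ((hg.smoothMetric.divg_smooth (hg.smoothVF_eVec a)).mul (hg.smoothVF_eVec a i))
  simp only [fun a => hg.smoothMetric.ricci_self' (hg.smoothVF_eVec a) hp, Finset.sum_add_distrib]
  rw [hg.sum_quadratic hp, add_assoc]
  congr 1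
  exact (hg.smoothMetric.divg_sum hs hp).symm

omit hg hp in
theorem val_flux (w : V4) : val (g p) (flux g p) w =
    ∑ a, (val (g p) (cov g (eVec g a) p *ᵥ eVec g a p) w
      - divg g (eVec g a) p * val (g p) (eVec g a p) w) := by
  simp only [flux, val_sum_left, val_sub_left, val_smul_left]

/-- The time component is the pairing with k. Moving derivatives from E_a to k leaves minus the
tangential trace of ∇k, and the null directions add nothing to the full trace. -/
theorem flux_zero : flux g p 0 = expansion g p := by
  rw [← hg.val_kVec hp (flux g p), val_flux, expansion, divg, (hg.resolution hp).trace_eq,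
    hg.val_cov_kVec_self hp, hg.val_cov_kVec_kVec hp]
  simp only [hg.val_cov_eVec_kVec hp, hg.val_eVec_kVec hp, mul_zero, sub_zero,
    Finset.sum_neg_distrib, zero_add, zero_sub]

theorem val_cov_kVec_lVec_lVec : val (g p) (cov g kVec p *ᵥ lVec g p) (lVec g p)
    = fderiv ℝ (lapse g) p (kVec p) / 2 := by
  have h1 : val (g p) (cov g kVec p *ᵥ lVec g p - cov g (lVec g) p *ᵥ kVec p) (lVec g p)
      = fderiv ℝ (lapse g) p (kVec p) / 2 := by
    rw [hg.smoothMetric.torsion_free hp (hg.diff_kVec hp) (hg.diff_lVec hp), hg.commutator hp,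
      hg.val_lVec hp, Fin.tail_cons, dotProduct_add, dotProduct_neg, hg.dir_dot_twist hp,
      dotProduct_smul, hg.dir_unit hp]
    simp
  rw [val_sub_left, hg.val_cov_lVec_lVec hp] at h1
  linarith

/-- The pairing with l leaves the tangential part of div l; the null part of div l is minus half the
radial derivative of the lapse and has to be compensated. -/
theorem flux_radial : dir p ⬝ᵥ Fin.tail (flux g p) = divg g (lVec g) p
    + fderiv ℝ (lapse g) p (kVec p) / 2 - lapse g p / 2 * expansion g p := by
  have h1 := hg.val_lVec hp (flux g p)
  rw [hg.flux_zero hp] at h1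
  have h2 : val (g p) (flux g p) (lVec g p)
      = divg g (lVec g) p + fderiv ℝ (lapse g) p (kVec p) / 2 := by
    rw [val_flux, divg, (hg.resolution hp).trace_eq, hg.val_cov_lVec_lVec hp,
      hg.val_cov_lVec_kVec hp, hg.val_cov_kVec_lVec_lVec hp]
    simp only [hg.val_cov_eVec_lVec hp, hg.val_eVec_lVec hp, mul_zero, sub_zero,
      Finset.sum_neg_distrib, zero_add]
    ring
  linarith

theorem diff_metric (i j : Fin 4) : DifferentiableAt ℝ (fun q => g q i j) p :=
  differentiableAt_of_smooth hg.isOpen (hg.smooth i j) hp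

theorem fderiv_val_const (v w z : V4) : fderiv ℝ (fun q => val (g q) v w) p z
    = val (Matrix.of fun i j => fderiv ℝ (fun q => g q i j) p z) v w := by
  have dg := hg.diff_metric hp
  have d1 : ∀ i j, DifferentiableAt ℝ (fun q => v i * (g q i j * w j)) p := fun i j =>
    ((dg i j).mul_const _).const_mul _
  have e : (fun q => val (g q) v w) = fun q => ∑ i, ∑ j, v i * (g q i j * w j) := by
    funext q
    simp only [val, dotProduct, mulVec, Finset.mul_sum]
  rw [e, fderiv_fun_sum fun i _ => DifferentiableAt.fun_sum fun j _ => d1 i j]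
  simp only [fderiv_fun_sum fun j _ => d1 _ j, _root_.sum_apply]
  simp only [val, dotProduct, mulVec, Finset.mul_sum, Matrix.of_apply]
  refine Finset.sum_congr rfl fun i _ => Finset.sum_congr rfl fun j _ => ?_
  rw [fderiv_const_mul ((dg i j).mul_const _), fderiv_mul_const (dg i j)]
  simp only [_root_.smul_apply, smul_eq_mul]
  ring

/-- Near p, g(k, w) is constant for constant w. Replacing k by its value at p changes this to first
order only by g(dk, l), and dk is tangent to the spheres. -/
theorem fderiv_val_kVec_lVec (v : V4) :
    fderiv ℝ (fun q => val (g q) (kVec p) (lVec g p)) p v = 0 := by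
  have h1 := hg.smoothMetric.fderiv_val hp (X := kVec) (Y := fun _ => lVec g p)
    (hg.diff_kVec hp) (fun i => differentiableAt_const _) v
  have h2 := hg.smoothMetric.fderiv_val hp (X := fun _ => kVec p) (Y := fun _ => lVec g p)
    (fun i => differentiableAt_const _) (fun i => differentiableAt_const _) v
  have h0 := fderiv_eq_of_const (f := fun q => val (g q) (kVec q) (lVec g p)) (c := lVec g p 0)
    hg.isOpen (fun q hq => by rw [val_comm (hg.symm q hq), hg.val_kVec hq]) hp v
  have h3 : val (g p) (cov g kVec p *ᵥ v - cov g (fun _ => kVec p) p *ᵥ v) (lVec g p) = 0 := by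
    rw [cov_sub_cov_const g (hg.diff_kVec hp), fderiv_kVec hg.tail_ne hg.isOpen hp, hg.val_lVec hp,
      Fin.tail_cons, dotProduct_smul, dotProduct_sub, dotProduct_smul, hg.dir_unit hp]
    simp
  rw [val_sub_left] at h3
  rw [h2]
  rw [h0] at h1
  linarith

/-- The divergence of a coordinate vector field. -/
theorem divg_const (v : V4) : divg g (fun _ => v) p =
    -(1 / 2) * ∑ a, fderiv ℝ (fun q => val (g q) (eVec g a p) (eVec g a p)) p v := by
  have hc : ∀ w z : V4, fderiv ℝ (fun q => val (g q) w z) p v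
      = val (g p) (cov g (fun _ => v) p *ᵥ w) z + val (g p) (cov g (fun _ => v) p *ᵥ z) w := by
    intro w z
    rw [hg.smoothMetric.fderiv_val hp (X := fun _ => w) (Y := fun _ => z)
      (fun i => differentiableAt_const _) (fun i => differentiableAt_const _),
      val_comm (hg.symm p hp) w, hg.cov_const_symm hp w, hg.cov_const_symm hp z]
  have h1 := hg.fderiv_val_kVec_lVec hp v
  rw [hc] at h1
  rw [divg, (hg.resolution hp).trace_eq, h1]
  simp only [hc, ← two_mul, ← Finset.mul_sum]
  ring

theorem sum_val_eVec (A : M4) : ∑ a, val A (eVec g a p) (eVec g a p)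
    = (invMetric g p * sp A).trace := by
  have h1 : ∀ a, val A (eVec g a p) (eVec g a p)
      = (rootMetric g p * sp A * rootMetric g p) a a := by
    intro a
    rw [eVec, val_cons]
    simp only [zero_mul, mul_zero, zero_add]
    rw [Matrix.mul_assoc, Matrix.mul_apply]
    refine Finset.sum_congr rfl fun j _ => ?_
    have h : rootMetric g p a j = rootMetric g p j a :=
      congrFun (congrFun (hg.rootMetric_symm hp) j) a
    rw [h]
    rfl
  simp only [h1]
  change (rootMetric g p * sp A * rootMetric g p).trace = _
  rw [trace_mul_comm, ← Matrix.mul_assoc, hg.rootMetric_mul_self hp]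

/-- The derivative of the spatial metric. -/
theorem trace_invMetric_mul (v : V4) :
    ∑ a, fderiv ℝ (fun q => val (g q) (eVec g a p) (eVec g a p)) p v
      = (invMetric g p * Matrix.of fun i j : Fin 3 =>
          fderiv ℝ (fun q => g q i.succ j.succ) p v).trace := by
  simp only [hg.fderiv_val_const hp, hg.sum_val_eVec hp]
  rfl

theorem diff_rho : DifferentiableAt ℝ (rho g) p :=
  differentiableAt_of_smooth hg.isOpen hg.smooth_rho hp

/-- This is Γ^i_im = ∂_m log ρ, with the 3 × 3 determinant of `posMetric` in place of the
determinant of g. The added normal part x xᵀ does not contribute, as the derivative of x is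
orthogonal to x. -/
theorem pd_rho (m : Fin 4) : pd m (rho g) p = rho g p * divg g (fun _ => Pi.single m 1) p := by
  have dh : ∀ i j, DifferentiableAt ℝ (fun q => posMetric g q i j) p := fun i j =>
    differentiableAt_of_smooth hg.isOpen (hg.smooth_posMetric i j) hp
  have ddet : DifferentiableAt ℝ (fun q => (posMetric g q).det) p :=
    differentiableAt_of_smooth hg.isOpen (contDiffOn_det hg.smooth_posMetric) hp
  have hrho := hg.rho_pos hp
  have h1 : pd m (fun q => (posMetric g q).det) p = 2 * rho g p * pd m (rho g) p := by
    have : (fun q => (posMetric g q).det) =ᶠ[𝓝 p] fun q => rho g q * rho g q := by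
      filter_upwards [hg.isOpen.mem_nhds hp] with q hq
      rw [← hg.rho_sq hq, sq]
    rw [pd_congr this, pd_mul (hg.diff_rho hp) (hg.diff_rho hp)]
    ring
  rw [pd_det_three dh (hg.isUnit_det_posMetric hp), ← hg.rho_sq hp] at h1
  set dn : Fin 3 → ℝ := fun i => pd m (fun q => dir q i) p with hdn
  set dG : M3 := Matrix.of fun i j : Fin 3 => pd m (fun q => g q i.succ j.succ) p with hdG
  have dd := differentiableAt_dir (hg.tail_ne p hp)
  have hdh : (Matrix.of fun i j => pd m (fun q => posMetric g q i j) p)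
      = vecMulVec (dir p) dn + vecMulVec dn (dir p) - dG := by
    ext i j
    have : (fun q => posMetric g q i j) = fun q => dir q i * dir q j - g q i.succ j.succ := rfl
    rw [Matrix.of_apply, this, pd_sub ((dd i).fun_mul (dd j)) (hg.diff_metric hp _ _),
      pd_mul (dd i) (dd j)]
    rfl
  have hndn : dir p ⬝ᵥ dn = 0 := by
    have h := fderiv_eq_of_const (f := fun q => ∑ i, dir q i * dir q i) (c := 1) hg.isOpen
      (fun q hq => hg.dir_unit hq) hp (Pi.single m 1)
    change pd m (fun q => ∑ i, dir q i * dir q i) p = 0 at h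
    rw [pd_sum fun i _ => (dd i).fun_mul (dd i)] at h
    simp only [pd_mul (dd _) (dd _)] at h
    have e : ∑ i, (dir p i * pd m (fun q => dir q i) p + pd m (fun q => dir q i) p * dir p i)
        = 2 * (dir p ⬝ᵥ dn) := by
      simp only [dotProduct, hdn, Finset.mul_sum]
      exact Finset.sum_congr rfl fun i _ => by ring
    rw [e] at h
    linarith
  have hdGn : dG *ᵥ dir p = -(sp (g p) *ᵥ dn) := by
    funext i
    have h := fderiv_eq_of_const (f := fun q => ∑ j : Fin 3, g q i.succ j.succ * dir q j) (c := 0)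
      hg.isOpen (fun q hq => congrFun (hg.radial q hq) i) hp (Pi.single m 1)
    change pd m (fun q => ∑ j : Fin 3, g q i.succ j.succ * dir q j) p = 0 at h
    rw [pd_sum fun j _ => (hg.diff_metric hp _ _).fun_mul (dd j)] at h
    simp only [pd_mul (hg.diff_metric hp _ _) (dd _), Finset.sum_add_distrib] at h
    rw [Pi.neg_apply, eq_neg_iff_add_eq_zero, add_comm]
    exact h
  have hinv : (posMetric g p)⁻¹ = invMetric g p + vecMulVec (dir p) (dir p) := by
    rw [invMetric, sub_add_cancel]
  have htr : ((posMetric g p)⁻¹ * (vecMulVec (dir p) dn + vecMulVec dn (dir p) - dG)).trace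
      = -(invMetric g p * dG).trace := by
    have e1 : (invMetric g p *ᵥ dn) ⬝ᵥ dir p = 0 := by
      rw [dotProduct_comm, dotProduct_mulVec, hg.invMetric_radial' hp, zero_dotProduct]
    have e2 : (vecMulVec (dir p) (dir p) * dG).trace = 0 := by
      rw [trace_mul_comm, mul_vecMulVec, hdGn, trace_vecMulVec, neg_dotProduct, dotProduct_comm,
        dotProduct_mulVec, hg.radial' hp, zero_dotProduct, neg_zero]
    rw [hinv]
    simp only [add_mul, mul_add, mul_sub, trace_add, trace_sub, mul_vecMulVec, trace_vecMulVec,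
      hg.invMetric_radial hp, e1, e2, vecMulVec_mulVec, hndn, hg.dir_unit hp]
    simp [hndn]
  rw [hdh, htr] at h1
  have h2 := hg.divg_const hp (Pi.single m 1)
  rw [hg.trace_invMetric_mul hp] at h2
  change _ = -(1 / 2) * (invMetric g p * dG).trace at h2
  rw [h2]
  have : rho g p * (2 * (-(1 / 2) * (invMetric g p * dG).trace) * rho g p
      - 2 * pd m (rho g) p) = 0 := by linarith
  rcases mul_eq_zero.1 this with h | h
  · exact absurd h hrho.ne'
  · linarith

/-- The covariant divergence in terms of the volume density. -/
theorem rho_mul_divg {X : V4 → V4} (hX : ∀ i, DifferentiableAt ℝ (fun q => X q i) p) :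
    rho g p * divg g X p = ∑ i, pd i (fun q => rho g q * X q i) p := by
  have h1 : ∀ l, pd l (rho g) p = rho g p * ∑ i, christoffel g i l i p := by
    intro l
    rw [hg.pd_rho hp l]
    congr 1
    simp only [divg, trace, diag, cov, Matrix.of_apply, pd_const, zero_add]
    refine Finset.sum_congr rfl fun i _ => ?_
    simp [Pi.single_apply]
  simp only [pd_mul (hg.diff_rho hp) (hX _), h1, divg, trace, diag, cov, Matrix.of_apply,
    Finset.sum_add_distrib, mul_add, Finset.mul_sum, Finset.sum_mul]
  congr 1
  rw [Finset.sum_comm]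
  exact Finset.sum_congr rfl fun l _ => Finset.sum_congr rfl fun i _ => by ring

theorem rho_mul_divg' {X : V4 → V4} (hX : ∀ i, DifferentiableAt ℝ (fun q => X q i) p) :
    rho g p * divg g X p = pd 0 (fun q => rho g q * X q 0) p
      + div3 (fun q i => rho g q * X q i.succ) p := by
  rw [hg.rho_mul_divg hp hX, Fin.sum_univ_succ]; rfl

theorem rho_mul_expansion :
    rho g p * expansion g p = fderiv ℝ (rho g) p (kVec p) + 2 * rho g p / rad p := by
  rw [expansion, hg.rho_mul_divg' hp (hg.diff_kVec hp), ← div3_smul_dir (hg.tail_ne p hp)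
    (hg.diff_rho hp)]
  simp [kVec, pd_const]

/-- The derivative of the lapse in `flux_radial` cancels against the one from the divergence form of
div l. What remains are first derivatives of ρ and a divergence over the spheres. -/
theorem rho_mul_flux_radial : rho g p * (dir p ⬝ᵥ Fin.tail (flux g p)) = pd 0 (rho g) p
    - lapse g p * (rho g p * expansion g p) + div3 (fun q i => rho g q * shift g q i) p := by
  have hl := hg.rho_mul_divg' hp (hg.diff_lVec hp)
  have e0 : (fun q => rho g q * lVec g q 0) = rho g := by funext q; simp [lVec]
  have e1 : (fun (q : V4) (i : Fin 3) => rho g q * lVec g q i.succ) = fun q i =>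
      rho g q * shift g q i + (-(1 / 2) * (rho g q * lapse g q)) * dir q i := by
    funext q i
    simp only [lVec, Fin.cons_succ, Pi.sub_apply, Pi.smul_apply, smul_eq_mul]
    ring
  have dr := hg.diff_rho hp
  have dl := hg.diff_lapse hp
  have drl : DifferentiableAt ℝ (fun q => -(1 / 2) * (rho g q * lapse g q)) p :=
    (dr.fun_mul dl).const_mul _
  rw [e0, e1, div3_add (X := fun q i => rho g q * shift g q i)
    (Y := fun q i => (-(1 / 2) * (rho g q * lapse g q)) * dir q i)
    (fun i => dr.fun_mul (hg.diff_shift hp i))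
    (fun i => drl.fun_mul (differentiableAt_dir (hg.tail_ne p hp) i)),
    div3_smul_dir (hg.tail_ne p hp) drl, fderiv_const_mul (dr.fun_mul dl),
    fderiv_fun_mul dr dl] at hl
  simp only [_root_.add_apply, _root_.smul_apply, smul_eq_mul] at hl
  have hθ := hg.rho_mul_expansion hp
  rw [hg.flux_radial hp]
  have : rho g p * (divg g (lVec g) p + fderiv ℝ (lapse g) p (kVec p) / 2
      - lapse g p / 2 * expansion g p) = rho g p * divg g (lVec g) p
      + rho g p * fderiv ℝ (lapse g) p (kVec p) / 2 - lapse g p / 2 * (rho g p * expansion g p) := by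
    ring
  rw [this, hl, hθ]
  ring

end BondiChart

/-- The derivative of the spatial metric along the radial null field. -/
def radialDeriv (g : V4 → M4) (p : V4) : M3 :=
  Matrix.of fun i j : Fin 3 => fderiv ℝ (fun q => g q i.succ j.succ) p (kVec p)

/-- The component of the flux along the radial direction, with the volume density. -/
def radialFlux (g : V4 → M4) (p : V4) : ℝ := pd 0 (rho g) p
    - lapse g p * (rho g p * expansion g p) + div3 (fun q i => rho g q * shift g q i) p

/-- The part of the flux tangent to the spheres, with the volume density. -/
def tangentFlux (g : V4 → M4) (p : V4) (i : Fin 3) : ℝ :=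
  rho g p * (flux g p i.succ - (dir p ⬝ᵥ Fin.tail (flux g p)) * dir p i)

/-- The function whose radial derivative balances the geometric and the matter terms. -/
def potential (g : V4 → M4) (p : V4) : ℝ :=
  4 * rad p - rad p ^ 2 * expansion g p + rad p ^ 2 * pd 0 (rho g) p + rad p ^ 2 * radialFlux g p

theorem trace_orthProj {x : Fin 3 → ℝ} (hx : x ⬝ᵥ x = 1) : (orthProj x).trace = 2 := by
  have : (vecMulVec x x).trace = 1 := by rw [trace_vecMulVec, hx]
  simp [orthProj, this]; norm_num

/-! ### The focusing equation and the pointwise balance law -/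

namespace BondiChart

variable {g : V4 → M4} {U : Set V4} (hg : BondiChart g U)
include hg

theorem smooth_rho_shift (i : Fin 3) : ContDiffOn ℝ ∞ (fun q => rho g q * shift g q i) U :=
  hg.smooth_rho.mul (hg.smooth_shift i)

theorem smooth_div3 {X : V4 → Fin 3 → ℝ} (hX : ∀ i, ContDiffOn ℝ ∞ (fun q => X q i) U) :
    ContDiffOn ℝ ∞ (div3 X) U :=
  ContDiffOn.sum fun i _ => (hX i).pd hg.isOpen _

theorem smooth_radialFlux : ContDiffOn ℝ ∞ (radialFlux g) U :=
  ((hg.smooth_rho.pd hg.isOpen 0).sub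
    (hg.smooth_lapse.mul (hg.smooth_rho.mul hg.smooth_expansion))).add
    (hg.smooth_div3 hg.smooth_rho_shift)

theorem smooth_flux_radial : ContDiffOn ℝ ∞ (fun p => dir p ⬝ᵥ Fin.tail (flux g p)) U := by
  change ContDiffOn ℝ ∞ (fun p => ∑ i : Fin 3, dir p i * flux g p i.succ) U
  exact ContDiffOn.sum fun i _ => (contDiffOn_dir hg.tail_ne i).mul (hg.smooth_flux i.succ)

theorem smooth_tangentFlux (i : Fin 3) : ContDiffOn ℝ ∞ (fun q => tangentFlux g q i) U :=
  hg.smooth_rho.mul ((hg.smooth_flux i.succ).sub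
    (hg.smooth_flux_radial.mul (contDiffOn_dir hg.tail_ne i)))

theorem smooth_potential : ContDiffOn ℝ ∞ (potential g) U := by
  have hr := contDiffOn_rad hg.tail_ne
  exact (((contDiffOn_const.mul hr).sub ((hr.pow 2).mul hg.smooth_expansion)).add
    ((hr.pow 2).mul (hg.smooth_rho.pd hg.isOpen 0))).add ((hr.pow 2).mul hg.smooth_radialFlux)

variable {p : V4} (hp : p ∈ U)
include hp

theorem dir_dot_tangentFlux : dir p ⬝ᵥ tangentFlux g p = 0 := by
  have h : tangentFlux g p = rho g p • (Fin.tail (flux g p)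
      - (dir p ⬝ᵥ Fin.tail (flux g p)) • dir p) := rfl
  rw [h, dotProduct_smul, dotProduct_sub, dotProduct_smul, hg.dir_unit hp]
  simp

theorem val_eVec_eVec_of (A : M4) (a b : Fin 3) : val A (eVec g a p) (eVec g b p)
    = (rootMetric g p * sp A * rootMetric g p) a b := by
  rw [eVec, eVec, val_cons]
  simp only [zero_mul, mul_zero, zero_add]
  rw [Matrix.mul_assoc, Matrix.mul_apply]
  refine Finset.sum_congr rfl fun j _ => ?_
  have h : rootMetric g p a j = rootMetric g p j a :=
    congrFun (congrFun (hg.rootMetric_symm hp) j) a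
  rw [h]
  rfl

/-- Half the Lie derivative of g along k. The projection term comes from the derivative 1 / rad of k
in tangential directions. -/
theorem val_cov_kVec_eVec_eVec (a b : Fin 3) :
    val (g p) (cov g kVec p *ᵥ eVec g a p) (eVec g b p)
      = ((1 / 2 : ℝ) • (rootMetric g p * radialDeriv g p * rootMetric g p)
        - (rad p)⁻¹ • orthProj (dir p)) a b := by
  have h := hg.two_mul_val_cov_kVec hp (eVec g a p) (eVec g b p)
  have hsymm : orthProj (dir p) b a = orthProj (dir p) a b := by
    simp only [orthProj, Matrix.sub_apply, vecMulVec_apply, Matrix.one_apply, eq_comm (a := a)]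
    ring
  rw [hg.fderiv_val_const hp, hg.val_eVec_eVec_of hp, hg.fderiv_kVec_eVec hp,
    hg.fderiv_kVec_eVec hp, val_smul_left, val_smul_left, hg.val_eVec_eVec hp,
    hg.val_eVec_eVec hp, hsymm] at h
  change _ = (rootMetric g p * radialDeriv g p * rootMetric g p) a b + _ + _ at h
  simp only [Matrix.sub_apply, Matrix.smul_apply, smul_eq_mul]
  linarith

/-- As k is geodesic near p, the divergence of ∇_k k drops out of the contracted Ricci identity. -/
theorem val_ricci_kVec : val (ricci g p) (kVec p) (kVec p)
    = -fderiv ℝ (expansion g) p (kVec p) - (cov g kVec p * cov g kVec p).trace := by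
  rw [hg.smoothMetric.ricci_self (smoothVF_kVec hg.tail_ne) hp]
  have : divg g (fun q => cov g kVec q *ᵥ kVec q) p = 0 := by
    change ∑ i, cov g (fun q => cov g kVec q *ᵥ kVec q) p i i = 0
    refine Finset.sum_eq_zero fun i _ => ?_
    have h0 : (fun q => (cov g kVec q *ᵥ kVec q) i) =ᶠ[𝓝 p] fun _ => 0 := by
      filter_upwards [hg.isOpen.mem_nhds hp] with q hq
      rw [hg.cov_kVec_self hq]; rfl
    have h1 : pd i (fun q => (cov g kVec q *ᵥ kVec q) i) p = 0 := by
      rw [pd_congr h0, pd_const]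
    have h2 : ∀ l, (cov g kVec p *ᵥ kVec p) l = 0 := fun l => by rw [hg.cov_kVec_self hp]; rfl
    change pd i (fun q => (cov g kVec q *ᵥ kVec q) i) p
      + ∑ l, christoffel g i l i p * (cov g kVec p *ᵥ kVec p) l = 0
    simp only [h1, h2, mul_zero, Finset.sum_const_zero, add_zero]
  rw [this, zero_sub]
  rfl

/-- In the frame ∇k is A = S/2 − P/rad, where S is the radial derivative of the metric conjugated by
its root. Expand tr A² and eliminate tr S through expansion = −tr A. -/
theorem trace_shear : 1 / 4 * (invMetric g p * radialDeriv g p * invMetric g p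
      * radialDeriv g p).trace
    = (cov g kVec p * cov g kVec p).trace - 2 * expansion g p / rad p + 2 / rad p ^ 2 := by
  set B := rootMetric g p with hB
  set S := B * radialDeriv g p * B with hS
  set P := orthProj (dir p) with hP
  set A : M3 := (1 / 2 : ℝ) • S - (rad p)⁻¹ • P with hA
  have hr := (rad_pos (hg.tail_ne p hp)).ne'
  have e1 : (cov g kVec p * cov g kVec p).trace = (A * A).trace := by
    rw [(hg.resolution hp).trace_eq]
    simp only [← mulVec_mulVec, (hg.resolution hp).val_mulVec_mulVec, hg.cov_kVec_self hp,
      hg.val_cov_kVec_kVec hp, mulVec_zero, val_zero_left, hg.val_cov_kVec_eVec_eVec hp]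
    simp only [← hS, ← hP, ← hA, ← hB]
    simp only [trace, diag, Matrix.mul_apply]
    simp
  have e2 : expansion g p = -A.trace := by
    rw [expansion, divg, (hg.resolution hp).trace_eq, hg.val_cov_kVec_self hp,
      hg.val_cov_kVec_kVec hp]
    simp only [hg.val_cov_kVec_eVec_eVec hp]
    simp only [← hS, ← hP, ← hA, ← hB]
    simp only [trace, diag]
    simp
  have e3 : (S * S).trace = (invMetric g p * radialDeriv g p * invMetric g p
      * radialDeriv g p).trace := by
    rw [← hg.rootMetric_mul_self hp, ← hB]
    calc (S * S).trace = (B * (radialDeriv g p * B * B * radialDeriv g p * B)).trace := by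
          rw [hS]; simp only [Matrix.mul_assoc]
      _ = ((radialDeriv g p) * (B * B * radialDeriv g p * (B * B))).trace := by
          rw [trace_mul_comm]; simp only [Matrix.mul_assoc]
      _ = _ := by rw [trace_mul_comm]
  have hSP : S * P = S := by
    rw [hS, Matrix.mul_assoc, mul_orthProj (hg.rootMetric_radial hp)]
  have hPS : P * S = S := by
    rw [hS, ← Matrix.mul_assoc, ← Matrix.mul_assoc, orthProj_mul (hg.rootMetric_radial' hp)]
  have hPP : P * P = P := orthProj_mul_self (hg.dir_unit hp)
  have hPt : P.trace = 2 := trace_orthProj (hg.dir_unit hp)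
  rw [e1, e2, ← e3, hA]
  simp only [sub_mul, mul_sub, smul_mul_smul_comm, hSP, hPS, hPP, trace_sub, trace_smul, hPt,
    smul_eq_mul]
  field_simp
  ring

theorem diff_expansion : DifferentiableAt ℝ (expansion g) p :=
  differentiableAt_of_smooth hg.isOpen hg.smooth_expansion hp

/-- The focusing equation. -/
theorem focusing : rad p ^ 2 * (1 / 4 * (invMetric g p * radialDeriv g p * invMetric g p
      * radialDeriv g p).trace + val (ricci g p) (kVec p) (kVec p))
    = 2 - 2 * rad p * expansion g p - rad p ^ 2 * fderiv ℝ (expansion g) p (kVec p) := by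
  have hr := (rad_pos (hg.tail_ne p hp)).ne'
  rw [hg.trace_shear hp, hg.val_ricci_kVec hp]
  field_simp
  ring

/-- Neither rad nor dir depends on u, so ∂_u commutes with the operator k + 2/rad that produces ρθ
from ρ. -/
theorem pd_zero_rho_mul_expansion : pd 0 (fun q => rho g q * expansion g q) p
    = fderiv ℝ (pd 0 (rho g)) p (kVec p) + 2 * pd 0 (rho g) p / rad p := by
  have hU := hg.isOpen
  have e : (fun q => rho g q * expansion g q) =ᶠ[𝓝 p]
      fun q => ∑ i : Fin 3, dir q i * pd i.succ (rho g) q + 2 * (rho g q * (rad q)⁻¹) := by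
    filter_upwards [hU.mem_nhds hp] with q hq
    rw [hg.rho_mul_expansion hq, fderiv_eq_sum_pd, Fin.sum_univ_succ]
    simp [kVec]; ring
  have dd := differentiableAt_dir (hg.tail_ne p hp)
  have dp : ∀ i, DifferentiableAt ℝ (pd i (rho g)) p := fun i =>
    differentiableAt_of_smooth hU (hg.smooth_rho.pd hU i) hp
  have hr := (rad_pos (hg.tail_ne p hp)).ne'
  have dri : DifferentiableAt ℝ (fun q => (rad q)⁻¹) p :=
    (differentiableAt_rad (hg.tail_ne p hp)).fun_inv hr
  have ht : Fin.tail (Pi.single 0 1 : V4) = 0 := by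
    funext j; simp [Fin.tail]
  have z1 : ∀ i : Fin 3, pd 0 (fun q => dir q i) p = 0 := fun i => by
    rw [pd, fderiv_dir (hg.tail_ne p hp), ht]; simp
  have z2 : pd 0 (fun q => (rad q)⁻¹) p = 0 := by
    have hd := (hasDerivAt_inv hr).comp_hasFDerivAt p
      (differentiableAt_rad (hg.tail_ne p hp)).hasFDerivAt
    change fderiv ℝ (Inv.inv ∘ rad) p _ = 0
    rw [hd.fderiv]
    simp [fderiv_rad (hg.tail_ne p hp), ht]
  have hk : fderiv ℝ (pd 0 (rho g)) p (kVec p) = ∑ i, dir p i * pd i.succ (pd 0 (rho g)) p := by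
    rw [fderiv_eq_sum_pd, Fin.sum_univ_succ]
    simp [kVec]
  rw [hk, pd_congr e, pd_add (DifferentiableAt.fun_sum fun i _ => (dd i).fun_mul (dp _))
    (((hg.diff_rho hp).fun_mul dri).const_mul _), pd_sum fun i _ => (dd i).fun_mul (dp _),
    pd_const_mul _ ((hg.diff_rho hp).fun_mul dri), pd_mul (hg.diff_rho hp) dri, z2]
  have hs : ∀ i : Fin 3, pd 0 (fun q => dir q i * pd i.succ (rho g) q) p
      = dir p i * pd i.succ (pd 0 (rho g)) p := fun i => by
    rw [pd_mul (dd i) (dp _), z1]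
    simp only [zero_mul, add_zero,
      pd_comm (hg.smooth_rho.contDiffAt (hU.mem_nhds hp)) 0 i.succ]
  rw [Finset.sum_congr rfl fun i _ => hs i]
  ring

theorem diff_flux (i : Fin 4) : DifferentiableAt ℝ (fun q => flux g q i) p :=
  differentiableAt_of_smooth hg.isOpen (hg.smooth_flux i) hp

theorem diff_radialFlux : DifferentiableAt ℝ (radialFlux g) p :=
  differentiableAt_of_smooth hg.isOpen hg.smooth_radialFlux hp

theorem diff_pd_rho : DifferentiableAt ℝ (pd 0 (rho g)) p :=
  differentiableAt_of_smooth hg.isOpen (hg.smooth_rho.pd hg.isOpen 0) hp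

theorem rho_mul_divg_flux : rho g p * divg g (flux g) p
    = fderiv ℝ (pd 0 (rho g)) p (kVec p) + 2 * pd 0 (rho g) p / rad p
      + (fderiv ℝ (radialFlux g) p (kVec p) + 2 * radialFlux g p / rad p)
      + div3 (tangentFlux g) p := by
  have hU := hg.isOpen
  have e0 : (fun q => rho g q * flux g q 0) =ᶠ[𝓝 p] fun q => rho g q * expansion g q := by
    filter_upwards [hU.mem_nhds hp] with q hq
    rw [hg.flux_zero hq]
  have e1 : div3 (fun q i => rho g q * flux g q i.succ) p
      = div3 (fun q i => radialFlux g q * dir q i + tangentFlux g q i) p := by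
    refine div3_congr hU (fun q hq => ?_) hp
    funext i
    have := hg.rho_mul_flux_radial hq
    rw [← radialFlux] at this
    rw [← this, tangentFlux]
    ring
  have dt : ∀ i, DifferentiableAt ℝ (fun q => tangentFlux g q i) p := fun i =>
    differentiableAt_of_smooth hU (hg.smooth_tangentFlux i) hp
  rw [hg.rho_mul_divg' hp (hg.diff_flux hp), pd_congr e0, hg.pd_zero_rho_mul_expansion hp, e1,
    div3_add (X := fun q i => radialFlux g q * dir q i)
      (fun i => (hg.diff_radialFlux hp).fun_mul (differentiableAt_dir (hg.tail_ne p hp) i)) dt,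
    div3_smul_dir (hg.tail_ne p hp) (hg.diff_radialFlux hp)]
  ring

/-- The pointwise balance law: the geometric and the matter terms add up to a radial derivative
and a divergence over the spheres. -/
theorem balance : rad p ^ 2 * (1 / 4 * (invMetric g p * radialDeriv g p * invMetric g p
      * radialDeriv g p).trace) - 1 / 2 * (rad p ^ 2 * rho g p)
        * (twist g p ⬝ᵥ sp (g p) *ᵥ twist g p)
      + (rad p ^ 2 * val (ricci g p) (kVec p) (kVec p)
        + rad p ^ 2 * rho g p * ∑ a, val (ricci g p) (eVec g a p) (eVec g a p))
    = fderiv ℝ (potential g) p (kVec p) + rad p ^ 2 * div3 (tangentFlux g) p := by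
  have hr := (rad_pos (hg.tail_ne p hp)).ne'
  have hrho := (hg.rho_pos hp).ne'
  have dr := differentiableAt_rad (hg.tail_ne p hp)
  have dr2 : DifferentiableAt ℝ (fun q => rad q ^ 2) p := dr.fun_pow 2
  have hDr : fderiv ℝ rad p (kVec p) = 1 := by
    rw [fderiv_rad (hg.tail_ne p hp), tail_kVec, hg.dir_unit hp]
  have hDr2 : fderiv ℝ (fun q => rad q ^ 2) p (kVec p) = 2 * rad p := by
    rw [fderiv_fun_pow 2 dr]
    simp [hDr]
  have dE := dr2.fun_mul (hg.diff_expansion hp)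
  have dP := dr2.fun_mul (hg.diff_pd_rho hp)
  have dF := dr2.fun_mul (hg.diff_radialFlux hp)
  have hpot : fderiv ℝ (potential g) p (kVec p) = 4
      - (2 * rad p * expansion g p + rad p ^ 2 * fderiv ℝ (expansion g) p (kVec p))
      + (2 * rad p * pd 0 (rho g) p + rad p ^ 2 * fderiv ℝ (pd 0 (rho g)) p (kVec p))
      + (2 * rad p * radialFlux g p + rad p ^ 2 * fderiv ℝ (radialFlux g) p (kVec p)) := by
    change fderiv ℝ (fun q => 4 * rad q - rad q ^ 2 * expansion g q
      + rad q ^ 2 * pd 0 (rho g) q + rad q ^ 2 * radialFlux g q) p (kVec p) = _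
    rw [fderiv_fun_add (((dr.const_mul 4).fun_sub dE).fun_add dP) dF,
      fderiv_fun_add ((dr.const_mul 4).fun_sub dE) dP, fderiv_fun_sub (dr.const_mul 4) dE,
      fderiv_const_mul dr, fderiv_fun_mul dr2 (hg.diff_expansion hp),
      fderiv_fun_mul dr2 (hg.diff_pd_rho hp), fderiv_fun_mul dr2 (hg.diff_radialFlux hp)]
    simp only [_root_.add_apply, _root_.sub_apply, _root_.smul_apply, smul_eq_mul, hDr, hDr2]
    ring
  have hfoc := hg.focusing hp
  have hdiv := hg.rho_mul_divg_flux hp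
  -- The factor rad² ρ turns 2/(rad² ρ) into the constant 2. Together with the 2 in the focusing
  -- equation it is the derivative of the term 4 rad of the potential.
  have hric : rad p ^ 2 * rho g p * ∑ a, val (ricci g p) (eVec g a p) (eVec g a p)
      = rad p ^ 2 * (rho g p * divg g (flux g) p)
        + 1 / 2 * (rad p ^ 2 * rho g p) * (twist g p ⬝ᵥ sp (g p) *ᵥ twist g p) + 2 := by
    rw [hg.sum_val_ricci_eVec hp]
    field_simp
  rw [hric, hdiv, hpot]
  have e : rad p ^ 2 * (fderiv ℝ (pd 0 (rho g)) p (kVec p) + 2 * pd 0 (rho g) p / rad p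
      + (fderiv ℝ (radialFlux g) p (kVec p) + 2 * radialFlux g p / rad p)
      + div3 (tangentFlux g) p) = rad p ^ 2 * fderiv ℝ (pd 0 (rho g)) p (kVec p)
      + 2 * rad p * pd 0 (rho g) p + rad p ^ 2 * fderiv ℝ (radialFlux g) p (kVec p)
      + 2 * rad p * radialFlux g p + rad p ^ 2 * div3 (tangentFlux g) p := by
    field_simp
    ring
  rw [e]
  linarith

end BondiChart

/-! ## Bondi coordinates in the chart -/

theorem pos_dot_pos (x : S2) : pos x ⬝ᵥ pos x = 1 := by
  have h : ‖(x.1 : EuclideanSpace ℝ (Fin 3))‖ = 1 := by simp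
  have h2 := EuclideanSpace.norm_sq_eq x.1
  rw [h] at h2
  simp only [Real.norm_eq_abs, sq_abs] at h2
  simp only [dotProduct, pos, ← pow_two]
  linarith

theorem tail_pt (u r : ℝ) (x : S2) : Fin.tail (pt u r x) = r • pos x := rfl

theorem rad_pt (u : ℝ) {r : ℝ} (hr : 0 < r) (x : S2) : rad (pt u r x) = r := by
  rw [rad, tail_pt, smul_dotProduct, dotProduct_smul, pos_dot_pos, smul_eq_mul, smul_eq_mul, mul_one,
    Real.sqrt_mul_self hr.le]

theorem dir_pt (u : ℝ) {r : ℝ} (hr : 0 < r) (x : S2) : dir (pt u r x) = pos x := by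
  funext i
  rw [dir, rad_pt u hr]
  change r * pos x i / r = _
  field_simp

theorem kVec_pt (u : ℝ) {r : ℝ} (hr : 0 < r) (x : S2) : kVec (pt u r x) = dR x := by
  rw [kVec, dir_pt u hr, dR]

theorem pos_ne_zero (x : S2) : pos x ≠ 0 := fun h => by
  have := pos_dot_pos x
  rw [h] at this
  simp at this

theorem pt_mem {I : Set ℝ} {u r : ℝ} (hu : u ∈ I) (hr : 0 < r) (x : S2) : pt u r x ∈ region I :=
  ⟨hu, by rw [tail_pt]; exact smul_ne_zero hr.ne' (pos_ne_zero x)⟩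

theorem exists_pt {I : Set ℝ} {p : V4} (hp : p ∈ region I) :
    ∃ u ∈ I, ∃ r > 0, ∃ x, p = pt u r x := by
  have hr := rad_pos hp.2
  have hx : ‖WithLp.toLp 2 (dir p)‖ = 1 := by
    rw [EuclideanSpace.norm_eq, Real.sqrt_eq_one]
    have := dir_dot_dir hp.2
    simp only [dotProduct, ← pow_two] at this
    simpa using this
  refine ⟨p 0, hp.1, rad p, hr, ⟨WithLp.toLp 2 (dir p), by simpa using hx⟩, ?_⟩
  funext i
  refine Fin.cases rfl (fun i => ?_) i
  change _ = rad p * (p i.succ / rad p)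
  field_simp

theorem hasDerivAt_pt_radial (u r : ℝ) (x : S2) : HasDerivAt (fun s => pt u s x) (dR x) r := by
  rw [hasDerivAt_pi]
  intro i
  refine Fin.cases ?_ (fun i => ?_) i
  · exact hasDerivAt_const _ _
  · change HasDerivAt (fun s => s * pos x i) (pos x i) r
    simpa using (hasDerivAt_id r).mul_const (pos x i)

theorem hasDerivAt_pt_time (u r : ℝ) (x : S2) :
    HasDerivAt (fun v => pt v r x) (Pi.single 0 1) u := by
  rw [hasDerivAt_pi]
  intro i
  refine Fin.cases ?_ (fun i => ?_) i
  · change HasDerivAt (fun v : ℝ => v) ((Pi.single 0 1 : V4) 0) u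
    simpa using hasDerivAt_id' u
  · change HasDerivAt (fun _ : ℝ => r * pos x i) ((Pi.single 0 1 : V4) i.succ) u
    simpa using hasDerivAt_const u (r * pos x i)

theorem hasDerivAt_comp_radial {f : V4 → ℝ} {u r : ℝ} (hr : 0 < r) {x : S2}
    (hf : DifferentiableAt ℝ f (pt u r x)) :
    HasDerivAt (fun s => f (pt u s x)) (fderiv ℝ f (pt u r x) (kVec (pt u r x))) r := by
  rw [kVec_pt u hr]
  exact hf.hasFDerivAt.comp_hasDerivAt r (hasDerivAt_pt_radial u r x)

theorem hasDerivAt_comp_time {f : V4 → ℝ} {u r : ℝ} {x : S2}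
    (hf : DifferentiableAt ℝ f (pt u r x)) :
    HasDerivAt (fun v => f (pt v r x)) (pd 0 f (pt u r x)) u :=
  hf.hasFDerivAt.comp_hasDerivAt u (hasDerivAt_pt_time u r x)

theorem matDeriv_mul {F H : ℝ → M3} {t : ℝ} (hF : ∀ i j, DifferentiableAt ℝ (fun s => F s i j) t)
    (hH : ∀ i j, DifferentiableAt ℝ (fun s => H s i j) t) :
    matDeriv (fun s => F s * H s) t = matDeriv F t * H t + F t * matDeriv H t := by
  ext i j
  simp only [matDeriv, Matrix.of_apply, Matrix.add_apply, Matrix.mul_apply]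
  rw [deriv_fun_sum fun l _ => (hF i l).fun_mul (hH l j), ← Finset.sum_add_distrib]
  exact Finset.sum_congr rfl fun l _ => deriv_fun_mul (hF i l) (hH l j)

theorem matDeriv_congr {F H : ℝ → M3} {t : ℝ} (h : F =ᶠ[𝓝 t] H) : matDeriv F t = matDeriv H t := by
  ext i j
  simp only [matDeriv, Matrix.of_apply]
  refine EventuallyEq.deriv_eq ?_
  filter_upwards [h] with s hs
  rw [hs]

theorem matDeriv_const (A : M3) (t : ℝ) : matDeriv (fun _ => A) t = 0 := by
  ext i j
  simp [matDeriv]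

theorem isSymm_matDeriv {F : ℝ → M3} {t : ℝ} (h : ∀ᶠ s in 𝓝 t, (F s)ᵀ = F s) :
    (matDeriv F t)ᵀ = matDeriv F t := by
  ext i j
  simp only [matDeriv, Matrix.of_apply, transpose_apply]
  refine EventuallyEq.deriv_eq ?_
  filter_upwards [h] with s hs
  exact congrFun (congrFun hs i) j

/-! ### Bondi components expressed by the fields on the chart -/

namespace IsAffineBondi

variable {g : V4 → M4} {I : Set ℝ} (hg : IsAffineBondi g I) (hI : IsOpen I)
include hg hI

theorem chart : BondiChart g (region I) where
  isOpen := isOpen_region hI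
  smooth := hg.smooth
  symm := hg.symm
  tail_ne := fun p hp => hp.2
  radial := by
    intro p hp
    obtain ⟨u, hu, r, hr, x, rfl⟩ := exists_pt hp
    rw [dir_pt u hr]
    set z := sp (g (pt u r x)) *ᵥ pos x with hz
    have hs : ∀ e, pos x ⬝ᵥ sp (g (pt u r x)) *ᵥ e = z ⬝ᵥ e := by
      intro e
      rw [dotProduct_mulVec, ← mulVec_transpose, sp, transpose_submatrix, (hg.symm _ hp).eq]
      rfl
    have h1 : z ⬝ᵥ pos x = 0 := by
      have := hg.g_rr u hu r hr x
      rw [dR, val_cons] at this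
      rw [← hs]
      simpa using this
    have h2 := hg.g_rA u hu r hr x z h1
    rw [dR, spatial, val_cons, hs] at h2
    exact dotProduct_self_eq_zero.1 (by simpa using h2)
  mixed_radial := by
    intro p hp
    obtain ⟨u, hu, r, hr, x, rfl⟩ := exists_pt hp
    have := hg.g_ur u hu r hr x
    rw [dU, dR, val_cons] at this
    rw [dir_pt u hr]
    change (fun i : Fin 3 => g (pt u r x) 0 i.succ) ⬝ᵥ pos x = 1
    simpa using this
  negDef := by
    intro p hp e he h0
    obtain ⟨u, hu, r, hr, x, rfl⟩ := exists_pt hp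
    rw [dir_pt u hr] at he
    have := hg.negDef u hu r hr x e he h0
    rw [spatial, val_cons] at this
    simpa using this

variable {u r : ℝ} (hu : u ∈ I) (hr : 0 < r) (x : S2)
include hu hr

theorem radial_pt : sp (g (pt u r x)) *ᵥ pos x = 0 := by
  rw [← dir_pt u hr]
  exact (hg.chart hI).radial _ (pt_mem hu hr x)

theorem radial_pt' : pos x ᵥ* sp (g (pt u r x)) = 0 := by
  rw [← dir_pt u hr]
  exact (hg.chart hI).radial' (pt_mem hu hr x)

theorem gAB_eq : gAB g u r x = r ^ 2 • sp (g (pt u r x)) := by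
  rw [gAB, angular]
  change r ^ 2 • (orthProj (pos x) * sp (g (pt u r x)) * orthProj (pos x)) = _
  rw [orthProj_mul (hg.radial_pt' hI hu hr x), mul_orthProj (hg.radial_pt hI hu hr x)]

/-- In the chart ∂_A is r times a spatial vector, so the rescaling by r⁻² is built into the chart
components. -/
theorem gHat_eq : gHat g u r x = sp (g (pt u r x)) := by
  rw [gHat, hg.gAB_eq hI hu hr, smul_smul, inv_mul_cancel₀ (by positivity), one_smul]

theorem tangentInv_smul_sp {c : ℝ} (hc : c ≠ 0) :
    tangentInv x (c • sp (g (pt u r x))) = -(c⁻¹ • invMetric g (pt u r x)) := by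
  have hp := pt_mem hu hr x
  have h1 := (hg.chart hI).sp_mul_invMetric hp
  have h2 := (hg.chart hI).invMetric_radial' hp
  rw [dir_pt u hr] at h1 h2
  rw [tangentInv, inv_eq_right_inv (B := normalProj x - c⁻¹ • invMetric g (pt u r x))]
  · abel
  · rw [add_mul, mul_sub, mul_sub, smul_mul_smul_comm, h1, mul_inv_cancel₀ hc, normalProj,
      mul_vecMulVec, smul_mulVec, hg.radial_pt hI hu hr, mul_vecMulVec, vecMulVec_mulVec,
      pos_dot_pos, mul_smul_comm, vecMulVec_mul, h2, orthProj]
    simp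

theorem gHatInv_eq : gHatInv g u r x = -invMetric g (pt u r x) := by
  have := hg.tangentInv_smul_sp hI hu hr x one_ne_zero
  rw [gHatInv, hg.gHat_eq hI hu hr]
  simpa using this

theorem gABinv_eq : gABinv g u r x = -((r ^ 2)⁻¹ • invMetric g (pt u r x)) := by
  rw [gABinv, hg.gAB_eq hI hu hr, hg.tangentInv_smul_sp hI hu hr x (by positivity)]

theorem sigma_eq : sigma g u r x = r ^ 2 * rho g (pt u r x) := by
  have hx := pos_dot_pos x
  have h1 := hg.radial_pt hI hu hr x
  have h2 := hg.radial_pt' hI hu hr x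
  have h3 : tangentDet x (gAB g u r x) = (r ^ 2) ^ 2 * (posMetric g (pt u r x)).det := by
    rw [tangentDet, hg.gAB_eq hI hu hr, normalProj, det_smul_add_normal hx h1 h2, posMetric,
      dir_pt u hr]
    have := det_smul_add_normal hx h1 h2 (-1)
    rw [show vecMulVec (pos x) (pos x) - sp (g (pt u r x)) = (-1 : ℝ) • sp (g (pt u r x))
      + vecMulVec (pos x) (pos x) by rw [neg_smul, one_smul]; abel, this]
    ring
  rw [sigma, h3, Real.sqrt_mul (by positivity), Real.sqrt_sq (by positivity), rho]

theorem sigma_pos : 0 < sigma g u r x := by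
  rw [hg.sigma_eq hI hu hr]
  have := (hg.chart hI).rho_pos (pt_mem hu hr x)
  positivity

theorem omegaUp_eq : omegaUp g u r x = -(r⁻¹ • shift g (pt u r x)) := by
  have h : invMetric g (pt u r x) * orthProj (pos x) = invMetric g (pt u r x) := by
    have := (hg.chart hI).invMetric_radial (pt_mem hu hr x)
    rw [dir_pt u hr] at this
    exact mul_orthProj this
  rw [omegaUp, hg.gABinv_eq hI hu hr, omegaLow]
  change -((r ^ 2)⁻¹ • invMetric g (pt u r x)) *ᵥ r • (orthProj (pos x) *ᵥ mixed g (pt u r x)) = _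
  rw [mulVec_smul, mulVec_mulVec, Matrix.neg_mul, smul_mul_assoc, h, neg_mulVec, smul_mulVec,
    smul_neg, smul_smul, shift]
  congr 2
  field_simp

theorem lapse_eq : lapse g (pt u r x) = g00 g u r x - omegaLow g u r x ⬝ᵥ omegaUp g u r x := by
  have h0 : g00 g u r x = g (pt u r x) 0 0 := by
    rw [g00, dU, val_cons]
    simp
  have h : pos x ⬝ᵥ shift g (pt u r x) = 0 := by
    have := (hg.chart hI).shift_radial (pt_mem hu hr x)
    rwa [dir_pt u hr] at this
  have hP : (orthProj (pos x) *ᵥ mixed g (pt u r x)) ⬝ᵥ shift g (pt u r x)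
      = mixed g (pt u r x) ⬝ᵥ shift g (pt u r x) := by
    rw [orthProj, sub_mulVec, one_mulVec, vecMulVec_mulVec, sub_dotProduct]
    simp [h]
  rw [h0, hg.omegaUp_eq hI hu hr, omegaLow]
  change _ = _ - (r • (orthProj (pos x) *ᵥ mixed g (pt u r x))) ⬝ᵥ _
  rw [smul_dotProduct, dotProduct_neg, dotProduct_smul, hP, lapse, shift]
  simp only [smul_eq_mul]
  field_simp
  ring

theorem hasDerivAt_sigma_radial : HasDerivAt (fun s => sigma g u s x)
    (sigma g u r x * expansion g (pt u r x)) r := by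
  have hp := pt_mem hu hr x
  have h := ((hasDerivAt_id r).pow 2).mul
    (hasDerivAt_comp_radial hr ((hg.chart hI).diff_rho hp))
  have hθ := (hg.chart hI).rho_mul_expansion hp
  rw [rad_pt u hr] at hθ
  refine (h.congr_of_eventuallyEq ?_).congr_deriv ?_
  · filter_upwards [lt_mem_nhds hr] with s hs
    exact hg.sigma_eq hI hu hs x
  · rw [hg.sigma_eq hI hu hr, mul_assoc (r ^ 2), hθ]
    simp
    field_simp
    ring

theorem hasDerivAt_sigma_time : HasDerivAt (fun v => sigma g v r x)
    (r ^ 2 * pd 0 (rho g) (pt u r x)) u := by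
  have hp := pt_mem hu hr x
  have h := (hasDerivAt_comp_time ((hg.chart hI).diff_rho hp)).const_mul (r ^ 2)
  refine h.congr_of_eventuallyEq ?_
  filter_upwards [hI.mem_nhds hu] with v hv
  exact hg.sigma_eq hI hv hr x

theorem matDeriv_gHat : matDeriv (fun s => gHat g u s x) r = radialDeriv g (pt u r x) := by
  have hp := pt_mem hu hr x
  rw [matDeriv_congr (H := fun s => sp (g (pt u s x)))]
  · ext i j
    exact (hasDerivAt_comp_radial hr (f := fun q => g q i.succ j.succ)
      (differentiableAt_of_smooth (hg.chart hI).isOpen (hg.smooth _ _) hp)).deriv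
  · filter_upwards [lt_mem_nhds hr] with s hs
    exact hg.gHat_eq hI hu hs x

/-- Differentiate N G = −P, where P is constant along the ray, and multiply by N from the right. -/
theorem matDeriv_invMetric : matDeriv (fun s => invMetric g (pt u s x)) r
    = invMetric g (pt u r x) * radialDeriv g (pt u r x) * invMetric g (pt u r x) := by
  have hp := pt_mem hu hr x
  have hc := hg.chart hI
  set N := fun s => invMetric g (pt u s x) with hN
  set G := fun s => sp (g (pt u s x)) with hG
  have dN : ∀ i j, DifferentiableAt ℝ (fun s => N s i j) r := fun i j =>
    (hasDerivAt_comp_radial hr (differentiableAt_of_smooth hc.isOpen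
      (hc.smooth_invMetric i j) hp)).differentiableAt
  have dG : ∀ i j, DifferentiableAt ℝ (fun s => G s i j) r := fun i j =>
    (hasDerivAt_comp_radial hr (f := fun q => g q i.succ j.succ) (differentiableAt_of_smooth hc.isOpen
      (hg.smooth _ _) hp)).differentiableAt
  have hG' : matDeriv G r = radialDeriv g (pt u r x) := by
    rw [← hg.matDeriv_gHat hI hu hr]
    refine matDeriv_congr ?_
    filter_upwards [lt_mem_nhds hr] with s hs
    exact (hg.gHat_eq hI hu hs x).symm
  have e1 : matDeriv N r * G r + N r * matDeriv G r = 0 := by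
    rw [← matDeriv_mul dN dG, matDeriv_congr (H := fun _ => -orthProj (pos x)), matDeriv_const]
    filter_upwards [lt_mem_nhds hr] with s hs
    rw [← dir_pt u hs]
    exact hc.invMetric_mul_sp (pt_mem hu hs x)
  have e2 : matDeriv N r * orthProj (pos x) = matDeriv N r := by
    have h := matDeriv_mul dN (H := fun _ => orthProj (pos x)) (fun i j => by fun_prop)
    rw [matDeriv_const, mul_zero, add_zero] at h
    rw [← h]
    refine matDeriv_congr ?_
    filter_upwards [lt_mem_nhds hr] with s hs
    have := hc.invMetric_radial (pt_mem hu hs x)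
    rw [dir_pt u hs] at this
    exact mul_orthProj this
  have e3 : G r * N r = -orthProj (pos x) := by
    rw [← dir_pt u hr]
    exact hc.sp_mul_invMetric hp
  have e4 := congrArg (· * N r) e1
  simp only [add_mul, Matrix.mul_assoc, e3, mul_neg, e2, zero_mul, hG'] at e4
  rw [Matrix.mul_assoc]
  exact (neg_add_eq_zero.1 e4)

theorem deriv_omegaUp (i : Fin 3) :
    deriv (fun s => omegaUp g u s x i) r = -(r⁻¹ * twist g (pt u r x) i) := by
  have hp := pt_mem hu hr x
  have hs := hasDerivAt_comp_radial hr ((hg.chart hI).diff_shift hp i)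
  have h := ((hasDerivAt_inv hr.ne').mul hs).neg
  have e : (fun s => omegaUp g u s x i)
      =ᶠ[𝓝 r] -((fun s => s⁻¹) * fun s => shift g (pt u s x) i) := by
    filter_upwards [lt_mem_nhds hr] with s hs
    rw [hg.omegaUp_eq hI hu hs]
    simp
  refine ((h.congr_of_eventuallyEq e).deriv).trans ?_
  rw [twist, rad_pt u hr]
  field_simp
  ring

theorem geomDensity_eq : geomDensity g u r x
    = r ^ 2 * (1 / 4 * (invMetric g (pt u r x) * radialDeriv g (pt u r x) * invMetric g (pt u r x)
      * radialDeriv g (pt u r x)).trace) - 1 / 2 * (r ^ 2 * rho g (pt u r x))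
        * (twist g (pt u r x) ⬝ᵥ sp (g (pt u r x)) *ᵥ twist g (pt u r x)) := by
  have hp := pt_mem hu hr x
  set N := invMetric g (pt u r x) with hN
  set G' := radialDeriv g (pt u r x) with hG'
  have hinv : matDeriv (fun s => gHatInv g u s x) r = -(N * G' * N) := by
    rw [hN, hG', ← hg.matDeriv_invMetric hI hu hr x, matDeriv_congr
      (H := fun s => -invMetric g (pt u s x))]
    · ext i j
      simp [matDeriv]
    · filter_upwards [lt_mem_nhds hr] with s hs
      exact hg.gHatInv_eq hI hu hs x
  have hsymm : G'ᵀ = G' := by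
    rw [hG', ← hg.matDeriv_gHat hI hu hr x]
    refine isSymm_matDeriv ?_
    filter_upwards [lt_mem_nhds hr] with s hs
    rw [hg.gHat_eq hI hu hs]
    exact (hg.chart hI).sp_symm (pt_mem hu hs x)
  have h1 : ∑ i, ∑ j, G' i j * (N * G' * N) i j = (N * G' * N * G').trace := by
    rw [trace_mul_comm, trace, Finset.sum_comm]
    refine Finset.sum_congr rfl fun j _ => ?_
    rw [diag_apply, Matrix.mul_apply]
    refine Finset.sum_congr rfl fun i _ => ?_
    rw [← congrFun (congrFun hsymm i) j, transpose_apply]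
  have h2 : ∑ i, ∑ j, gAB g u r x i j * deriv (fun s => omegaUp g u s x i) r
        * deriv (fun s => omegaUp g u s x j) r
      = twist g (pt u r x) ⬝ᵥ sp (g (pt u r x)) *ᵥ twist g (pt u r x) := by
    simp only [hg.deriv_omegaUp hI hu hr, hg.gAB_eq hI hu hr, dotProduct, mulVec, Finset.mul_sum]
    refine Finset.sum_congr rfl fun i _ => Finset.sum_congr rfl fun j _ => ?_
    simp only [Matrix.smul_apply, smul_eq_mul]
    field_simp
  rw [geomDensity, hg.matDeriv_gHat hI hu hr, hinv, h2, hg.sigma_eq hI hu hr, ← h1]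
  simp only [Matrix.neg_apply, mul_neg, Finset.sum_neg_distrib, ← hG']
  ring

theorem angTrace_eq (A : M4) : angTrace g u r x A
    = -∑ a, val A (eVec g a (pt u r x)) (eVec g a (pt u r x)) := by
  have hp := pt_mem hu hr x
  have h := (hg.chart hI).invMetric_radial hp
  have h' := (hg.chart hI).invMetric_radial' hp
  rw [dir_pt u hr] at h h'
  rw [(hg.chart hI).sum_val_eVec hp, angTrace, hg.gABinv_eq hI hu hr, angular]
  change (-((r ^ 2)⁻¹ • invMetric g (pt u r x)) * (r ^ 2 • (orthProj (pos x) * sp A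
    * orthProj (pos x)))).trace = _
  rw [Matrix.neg_mul, smul_mul_smul_comm, inv_mul_cancel₀ (by positivity), one_smul,
    ← Matrix.mul_assoc, ← Matrix.mul_assoc, mul_orthProj h, trace_neg, trace_mul_comm,
    ← Matrix.mul_assoc, orthProj_mul h']

theorem matterDensity_eq {T : V4 → M4} (hE : EinsteinEqs g T u) : matterDensity g T u r x
    = r ^ 2 * val (ricci g (pt u r x)) (kVec (pt u r x)) (kVec (pt u r x))
      + r ^ 2 * rho g (pt u r x) * ∑ a, val (ricci g (pt u r x)) (eVec g a (pt u r x))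
        (eVec g a (pt u r x)) := by
  have h1 := hE.eq11 r hr x
  have h2 := hE.eqAB r hr x
  rw [hg.angTrace_eq hI hu hr x (ricci g (pt u r x))] at h2
  rw [matterDensity, ← h1, comp11, kVec_pt u hr, hg.sigma_eq hI hu hr]
  linear_combination (r ^ 2 * rho g (pt u r x)) * h2

theorem density_add {T : V4 → M4} (hE : EinsteinEqs g T u) :
    geomDensity g u r x + matterDensity g T u r x
      = fderiv ℝ (potential g) (pt u r x) (kVec (pt u r x))
        + r ^ 2 * div3 (tangentFlux g) (pt u r x) := by
  have h := (hg.chart hI).balance (pt_mem hu hr x)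
  rw [rad_pt u hr] at h
  rw [hg.geomDensity_eq hI hu hr, hg.matterDensity_eq hI hu hr x hE, h]

end IsAffineBondi

/-- The part of the potential that is not a divergence over the spheres. -/
def conePotential (g : V4 → M4) (u r : ℝ) (x : S2) : ℝ :=
  4 * r - r ^ 2 * deriv (fun s => sigma g u s x) r / sigma g u r x
    + 2 * deriv (fun v => sigma g v r x) u
    - (g00 g u r x - omegaLow g u r x ⬝ᵥ omegaUp g u r x) * deriv (fun s => sigma g u s x) r

/-- From r²ρ = σ/σ_s one gets r²ρθ = σ_{,r} and r²∂_uρ = σ_{,u}, relative to σ_s. The time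
derivative enters both directly and through `radialFlux`, hence its factor 2. -/
theorem IsAffineBondi.potential_eq {g : V4 → M4} {I : Set ℝ} (hg : IsAffineBondi g I)
    (hI : IsOpen I) {u r : ℝ} (hu : u ∈ I) (hr : 0 < r) (x : S2) :
    potential g (pt u r x) = conePotential g u r x
      + r ^ 2 * div3 (fun q i => rho g q * shift g q i) (pt u r x) := by
  rw [conePotential, (hg.hasDerivAt_sigma_radial hI hu hr x).deriv,
    (hg.hasDerivAt_sigma_time hI hu hr x).deriv, ← hg.lapse_eq hI hu hr, potential, radialFlux,
    rad_pt u hr]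
  have := (hg.sigma_pos hI hu hr x).ne'
  rw [mul_div_assoc, mul_div_cancel_left₀ _ this, hg.sigma_eq hI hu hr]
  ring

/-! ## The divergence theorem on the spheres -/

theorem integral_polar {f : EuclideanSpace ℝ (Fin 3) → ℝ} {A : S2 → ℝ} {B : ℝ → ℝ}
    (h : ∀ x : S2, ∀ s > 0, f (s • x.1) = A x * B s) :
    ∫ y, f y = (∫ x, A x ∂sphereArea) * ∫ s in Set.Ioi (0 : ℝ), s ^ 2 * B s := by
  have hdim : Module.finrank ℝ (EuclideanSpace ℝ (Fin 3)) - 1 = 2 := by simp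
  set μ : Measure (EuclideanSpace ℝ (Fin 3)) := volume with hμ
  calc ∫ y, f y ∂μ = ∫ y : ({(0)}ᶜ : Set (EuclideanSpace ℝ (Fin 3))), f y.1 ∂(μ.comap (↑)) := by
        rw [integral_subtype_comap (measurableSet_singleton _).compl fun y ↦ f y,
          restrict_compl_singleton]
    _ = ∫ z, A z.1 * B z.2 ∂μ.toSphere.prod (.volumeIoiPow 2) := by
        have := μ.measurePreserving_homeomorphUnitSphereProd.integral_comp
          (Homeomorph.measurableEmbedding _)
          (fun z : S2 × Set.Ioi (0 : ℝ) => A z.1 * B z.2)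
        rw [hdim] at this
        rw [← this]
        refine integral_congr_ae (Eventually.of_forall fun y => ?_)
        have hz := congrArg Subtype.val
          ((homeomorphUnitSphereProd (EuclideanSpace ℝ (Fin 3))).symm_apply_apply y)
        rw [homeomorphUnitSphereProd_symm_apply_coe] at hz
        change f y.1 = _
        rw [← hz, h _ _ ((homeomorphUnitSphereProd (EuclideanSpace ℝ (Fin 3)) y).2.2)]
    _ = (∫ x, A x ∂μ.toSphere) * ∫ s : Set.Ioi (0 : ℝ), B s ∂.volumeIoiPow 2 :=
        integral_prod_mul A (fun s : Set.Ioi (0 : ℝ) => B s)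
    _ = _ := by
        rw [sphereArea]
        congr 1
        simp only [Measure.volumeIoiPow, ENNReal.ofReal]
        rw [integral_withDensity_eq_integral_smul
            ((measurable_subtype_coe.pow_const _).real_toNNReal),
          integral_subtype_comap measurableSet_Ioi fun a ↦ Real.toNNReal (a ^ 2) • B a,
          setIntegral_congr_fun measurableSet_Ioi fun x hx ↦ ?_]
        rw [NNReal.smul_def, Real.coe_toNNReal _ (pow_nonneg hx.out.le _), smul_eq_mul]

/-- Integration by parts against the constant 1. -/
theorem integral_fderiv_eq_zero {E : Type*} [NormedAddCommGroup E] [NormedSpace ℝ E]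
    [FiniteDimensional ℝ E] [MeasurableSpace E] [BorelSpace E] {μ : Measure E}
    [μ.IsAddHaarMeasure] {f : E → ℝ} (hf : ContDiff ℝ 1 f) (hc : HasCompactSupport f) (v : E) :
    Integrable (fun y => fderiv ℝ f y v) μ ∧ ∫ y, fderiv ℝ f y v ∂μ = 0 := by
  have hcont : Continuous fun y => fderiv ℝ f y v :=
    (hf.continuous_fderiv one_ne_zero).clm_apply continuous_const
  have hint : Integrable (fun y => fderiv ℝ f y v) μ :=
    hcont.integrable_of_hasCompactSupport (hc.fderiv_apply ℝ v)
  refine ⟨hint, ?_⟩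
  have := integral_mul_fderiv_eq_neg_fderiv_mul_of_integrable (μ := μ) (𝕜 := ℝ)
    (f := fun _ : E => (1 : ℝ)) (g := f) (v := v) (by simp) (by simpa using hint)
    (by simpa using hf.continuous.integrable_of_hasCompactSupport hc) (by simp)
    (fun x _ => hf.differentiable one_ne_zero x)
  simpa using this

/-- The point on the sphere of radius `r` in the direction of a point. -/
def radialProj (r : ℝ) (p : V4) : V4 := Fin.cons (p 0) (r • dir p)

theorem radialProj_pt {u r s : ℝ} (hs : 0 < s) (x : S2) :
    radialProj r (pt u s x) = pt u r x := by
  rw [radialProj, dir_pt u hs]; rfl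

theorem contDiffOn_radialProj {U : Set V4} (hU : ∀ p ∈ U, Fin.tail p ≠ 0) (r : ℝ) :
    ContDiffOn ℝ ∞ (radialProj r) U := by
  rw [contDiffOn_pi]
  intro i
  refine Fin.cases ?_ (fun i => ?_) i
  · exact contDiffOn_coord _ _
  · exact contDiffOn_const.mul (contDiffOn_dir hU i)

theorem fderiv_radialProj {I : Set ℝ} (hI : IsOpen I) (r : ℝ) {p : V4} (hp : p ∈ region I)
    (i : Fin 3) : fderiv ℝ (radialProj r) p (Pi.single i.succ 1)
      = (r / rad p) • ((Pi.single i.succ 1 : V4) - dir p i • kVec p) := by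
  have hU : ∀ q ∈ region I, Fin.tail q ≠ 0 := fun q hq => hq.2
  have hs := contDiffOn_pi.1 (contDiffOn_radialProj hU r)
  have ht : dir p ⬝ᵥ Fin.tail (Pi.single i.succ 1 : V4) = dir p i := by
    simp [dotProduct, Fin.tail, Pi.single_apply]
  funext j
  rw [fderiv_apply_comp fun j => differentiableAt_of_smooth (isOpen_region hI) (hs j) hp,
    ← fderiv_eq_sum_pd]
  refine Fin.cases ?_ (fun j => ?_) j
  · change fderiv ℝ (fun q : V4 => q 0) p (Pi.single i.succ 1) = _
    rw [fderiv_apply differentiableAt_id]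
    simp [kVec, (Fin.succ_ne_zero i).symm]
  · change fderiv ℝ (fun q : V4 => r * dir q j) p (Pi.single i.succ 1) = _
    rw [fderiv_const_mul (differentiableAt_dir hp.2 j), _root_.smul_apply, fderiv_dir hp.2, ht]
    simp only [kVec, Pi.smul_apply, Pi.sub_apply, Fin.cons_succ, smul_eq_mul]
    ring

/-- A field on the sphere of radius r is extended along rays with a radial cutoff. Tangential
derivatives scale by r / s, while radial derivatives of X and of the cutoff do not contribute
because X is tangential. -/
theorem div3_radialProj {I : Set ℝ} (hI : IsOpen I) {X : V4 → Fin 3 → ℝ}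
    (hX : ∀ i, ContDiffOn ℝ ∞ (fun q => X q i) (region I))
    (hrad : ∀ p ∈ region I, dir p ⬝ᵥ X p = 0) {χ : ℝ → ℝ} (hχ : ContDiff ℝ ∞ χ) {u r s : ℝ}
    (hu : u ∈ I) (hr : 0 < r) (hs : 0 < s) (x : S2) :
    div3 (fun q i => χ (rad q) * X (radialProj r q) i) (pt u s x)
      = div3 X (pt u r x) * (χ s * (r / s)) := by
  have hU := isOpen_region hI
  set p := pt u s x with hpdef
  set q := pt u r x with hqdef
  have hp : p ∈ region I := pt_mem hu hs x
  have hq : q ∈ region I := pt_mem hu hr x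
  have hpq : radialProj r p = q := radialProj_pt hs x
  have dq : DifferentiableAt ℝ (radialProj r) p :=
    ((contDiffOn_radialProj (fun _ h => h.2) r).contDiffAt (hU.mem_nhds hp)).differentiableAt
      (by simp)
  have dX : ∀ i, DifferentiableAt ℝ (fun z => X z i) q := fun i =>
    differentiableAt_of_smooth hU (hX i) hq
  have dXq : ∀ i, HasFDerivAt (fun z => X (radialProj r z) i)
      ((fderiv ℝ (fun z => X z i) q).comp (fderiv ℝ (radialProj r) p)) p := fun i => by
    have := (dX i).hasFDerivAt
    rw [← hpq] at this ⊢
    exact this.comp p dq.hasFDerivAt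
  have hχd : DifferentiableAt ℝ χ (rad p) := hχ.differentiable (by simp) _
  have dχ := hχd.hasDerivAt.comp_hasFDerivAt p (differentiableAt_rad hp.2).hasFDerivAt
  have hk : kVec p = kVec q := by rw [hpdef, hqdef, kVec_pt u hs, kVec_pt u hr]
  have hd : dir p = dir q := by rw [hpdef, hqdef, dir_pt u hs, dir_pt u hr]
  have e1 : ∀ i : Fin 3, pd i.succ (fun z => χ (rad z) * X (radialProj r z) i) p
      = χ s * (r / s) * (pd i.succ (fun z => X z i) q
        - dir q i * fderiv ℝ (fun z => X z i) q (kVec q))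
        + deriv χ s * (dir q i * X q i) := by
    intro i
    rw [pd_mul (f := fun z => χ (rad z)) dχ.differentiableAt (dXq i).differentiableAt]
    have h1 : pd i.succ (fun z => χ (rad z)) p = deriv χ s * dir q i := by
      change fderiv ℝ (χ ∘ rad) p _ = _
      rw [dχ.fderiv, _root_.smul_apply, fderiv_rad hp.2, rad_pt u hs, ← hd]
      simp [dotProduct, Fin.tail, Pi.single_apply]
    have h2 : pd i.succ (fun z => X (radialProj r z) i) p
        = (r / s) * (pd i.succ (fun z => X z i) q
          - dir q i * fderiv ℝ (fun z => X z i) q (kVec q)) := by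
      rw [pd, (dXq i).fderiv, ContinuousLinearMap.comp_apply, fderiv_radialProj hI r hp,
        map_smul, map_sub, map_smul, rad_pt u hs, hk, hd]
      rfl
    rw [h1, h2, hpq, rad_pt u hs]
    ring
  have e2 : ∑ i, dir q i * fderiv ℝ (fun z => X z i) q (kVec q) = 0 := by
    have h := fderiv_eq_of_const hU (f := fun z => ∑ i, dir z i * X z i) hrad hq (kVec q)
    rw [fderiv_fun_sum fun i _ => (differentiableAt_dir hq.2 i).fun_mul (dX i)] at h
    rw [← h, _root_.sum_apply]
    refine Finset.sum_congr rfl fun i _ => ?_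
    rw [fderiv_fun_mul (differentiableAt_dir hq.2 i) (dX i), _root_.add_apply, _root_.smul_apply,
      _root_.smul_apply, fderiv_dir_kVec hq.2]
    simp
  have e3 : ∑ i, dir q i * X q i = 0 := hrad q hq
  rw [div3, Finset.sum_congr rfl fun i _ => e1 i, Finset.sum_add_distrib, ← Finset.mul_sum,
    ← Finset.mul_sum, Finset.sum_sub_distrib, e2, e3, div3]
  ring

/-- The divergence theorem for vector fields tangent to the spheres. -/
theorem integral_div3_eq_zero {I : Set ℝ} (hI : IsOpen I) {X : V4 → Fin 3 → ℝ}
    (hX : ∀ i, ContDiffOn ℝ ∞ (fun q => X q i) (region I))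
    (hrad : ∀ p ∈ region I, dir p ⬝ᵥ X p = 0) {u r : ℝ} (hu : u ∈ I) (hr : 0 < r) :
    ∫ x, div3 X (pt u r x) ∂sphereArea = 0 := by
  -- The cutoff lives on 1 < s < 3: this makes the extended field smooth at the origin and compactly
  -- supported, so its Euclidean divergence has integral zero. In polar coordinates that integral is
  -- the wanted sphere integral times a positive radial one.
  let χ : ContDiffBump (2 : ℝ) := ⟨1 / 2, 1, by norm_num, by norm_num⟩
  have hχ : ContDiff ℝ ∞ χ := χ.contDiff
  have hχ0 : ∀ s, (s ≤ 1 ∨ 3 ≤ s) → χ s = 0 := fun s hs => χ.zero_of_le_dist (by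
    change (1 : ℝ) ≤ _
    rw [Real.dist_eq, le_abs]
    rcases hs with hs | hs
    · right; linarith
    · left; linarith)
  let Φ : V4 → Fin 3 → ℝ := fun q i => χ (rad q) * X (radialProj r q) i
  let ι : EuclideanSpace ℝ (Fin 3) → V4 := fun y => Fin.cons u fun i => y i
  let F : Fin 3 → EuclideanSpace ℝ (Fin 3) → ℝ := fun i y => Φ (ι y) i
  have hι : ContDiff ℝ ∞ ι := by
    rw [contDiff_pi]
    intro i
    refine Fin.cases ?_ (fun i => ?_) i
    · exact contDiff_const
    · change ContDiff ℝ ∞ fun y : EuclideanSpace ℝ (Fin 3) => y i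
      fun_prop
  have hrad' : ∀ y, rad (ι y) = ‖y‖ := fun y => by
    rw [EuclideanSpace.norm_eq, rad]
    congr 1
    refine Finset.sum_congr rfl fun i _ => ?_
    rw [Real.norm_eq_abs, sq_abs, pow_two]
    rfl
  have hιmem : ∀ y ≠ 0, ι y ∈ region I := fun y hy => ⟨hu, fun h => hy (by
    have h2 := hrad' y
    rw [rad, h] at h2
    simp only [dotProduct_zero, Real.sqrt_zero] at h2
    exact norm_eq_zero.1 h2.symm)⟩
  have hΦ : ∀ i, ContDiffOn ℝ ∞ (fun q => Φ q i) (region I) := fun i => by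
    refine (hχ.comp_contDiffOn (contDiffOn_rad fun _ h => h.2)).mul
      ((hX i).comp (contDiffOn_radialProj (fun _ h => h.2) r) ?_)
    intro p hp
    obtain ⟨v, hv, s, hs, x, rfl⟩ := exists_pt hp
    rw [radialProj_pt hs]
    exact pt_mem hv hr x
  have hF : ∀ i, ContDiff ℝ ∞ (F i) := fun i => by
    rw [contDiff_iff_contDiffAt]
    intro y
    by_cases hy : y = 0
    · refine ContDiffAt.congr_of_eventuallyEq (contDiffAt_const (c := (0 : ℝ))) ?_
      filter_upwards [Metric.ball_mem_nhds y one_pos] with z hz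
      change χ (rad (ι z)) * _ = 0
      rw [hrad', hχ0, zero_mul]
      left
      rw [hy, mem_ball_zero_iff] at hz
      exact hz.le
    · exact ((hΦ i).contDiffAt ((isOpen_region hI).mem_nhds (hιmem y hy))).comp y hι.contDiffAt
  have hFc : ∀ i, HasCompactSupport (F i) := fun i =>
    HasCompactSupport.intro (isCompact_closedBall (0 : EuclideanSpace ℝ (Fin 3)) 3) fun y hy => by
      change χ (rad (ι y)) * _ = 0
      rw [hrad', hχ0, zero_mul]
      right
      rw [mem_closedBall_zero_iff, not_le] at hy
      exact hy.le
  have key : ∀ x : S2, ∀ s > 0, ∑ i, fderiv ℝ (F i) (s • x.1) (EuclideanSpace.single i 1)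
      = div3 X (pt u r x) * (χ s * (r / s)) := by
    intro x s hs
    rw [← div3_radialProj hI hX hrad hχ hu hr hs x, div3]
    refine Finset.sum_congr rfl fun i _ => ?_
    have hpt : ι (s • x.1) = pt u s x := rfl
    have hd : DifferentiableAt ℝ (fun q => Φ q i) (pt u s x) :=
      differentiableAt_of_smooth (isOpen_region hI) (hΦ i) (pt_mem hu hs x)
    rw [pd, ← hd.lineDeriv_eq_fderiv,
      ← ((hF i).differentiable (by simp) (s • x.1)).lineDeriv_eq_fderiv, lineDeriv, lineDeriv]
    congr 1
    funext t
    change Φ (ι _) i = Φ _ i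
    congr 1
    funext j
    refine Fin.cases ?_ (fun j => ?_) j
    · simp [ι, pt, (Fin.succ_ne_zero i).symm]
    · simp [ι, pt, pos, Pi.single_apply]
  have hzero : ∫ y, ∑ i, fderiv ℝ (F i) y (EuclideanSpace.single i 1) = 0 := by
    have h := fun i => integral_fderiv_eq_zero (μ := volume) ((hF i).of_le (by simp)) (hFc i)
      (EuclideanSpace.single i 1)
    rw [integral_finsetSum _ fun i _ => (h i).1]
    exact Finset.sum_eq_zero fun i _ => (h i).2
  rw [integral_polar key] at hzero
  refine (mul_eq_zero.1 hzero).resolve_right (ne_of_gt ?_)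
  -- Writing the weight s²·(r/s) as r|s| gives a continuous non-negative integrand on the whole
  -- line.
  have e : ∫ s in Set.Ioi (0 : ℝ), s ^ 2 * (χ s * (r / s)) = ∫ s, r * |s| * χ s := by
    rw [← integral_indicator measurableSet_Ioi]
    refine integral_congr_ae (Eventually.of_forall fun s => ?_)
    by_cases hs : 0 < s
    · simp only [Set.indicator, Set.mem_Ioi, hs, if_true, abs_of_pos hs]
      field_simp
    · simp only [Set.indicator, Set.mem_Ioi, hs, if_false]
      rw [hχ0 s (Or.inl (by linarith)), mul_zero]
  rw [e]
  refine Continuous.integral_pos_of_hasCompactSupport_nonneg_nonzero (x := 2) ?_ ?_ ?_ ?_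
  · exact (continuous_const.mul continuous_abs).mul hχ.continuous
  · exact χ.hasCompactSupport.mul_left
  · intro s
    have := χ.nonneg (x := s)
    positivity
  · have : χ 2 = 1 := χ.one_of_mem_closedBall (Metric.mem_closedBall_self χ.rIn_pos.le)
    rw [this]
    positivity

/-! ## Integration over the cone -/

instance : IsFiniteMeasure sphereArea :=
  inferInstanceAs (IsFiniteMeasure (Measure.toSphere volume))

theorem continuous_pos : Continuous pos :=
  continuous_pi fun i => by
    change Continuous fun x : S2 => x.1 i
    fun_prop

theorem continuous_pt (u : ℝ) : Continuous fun z : ℝ × S2 => pt u z.1 z.2 := by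
  refine continuous_pi fun i => ?_
  refine Fin.cases ?_ (fun i => ?_) i
  · exact continuous_const
  · exact continuous_fst.mul ((continuous_apply i).comp (continuous_pos.comp continuous_snd))

section

variable {I : Set ℝ} {f : V4 → ℝ} (hf : ContinuousOn f (region I)) {u : ℝ} (hu : u ∈ I)
include hf hu

theorem continuousOn_comp_pt :
    ContinuousOn (fun z : ℝ × S2 => f (pt u z.1 z.2)) (Set.Ioi 0 ×ˢ Set.univ) :=
  hf.comp (continuous_pt u).continuousOn fun z hz => pt_mem hu hz.1 z.2

theorem continuous_comp_pt {r : ℝ} (hr : 0 < r) : Continuous fun x => f (pt u r x) := by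
  rw [← continuousOn_univ]
  exact (continuousOn_comp_pt hf hu).comp (by fun_prop : Continuous fun x : S2 => (r, x)).continuousOn
    fun x _ => ⟨hr, trivial⟩

theorem integrable_comp_pt {r : ℝ} (hr : 0 < r) :
    Integrable (fun x => f (pt u r x)) sphereArea :=
  (continuous_comp_pt hf hu hr).integrable_of_hasCompactSupport (HasCompactSupport.of_compactSpace _)

theorem continuousOn_integral_comp_pt :
    ContinuousOn (fun r => ∫ x, f (pt u r x) ∂sphereArea) (Set.Ioi 0) :=
  continuousOn_integral_of_compact_support isCompact_univ (continuousOn_comp_pt hf hu)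
    fun _ _ _ h => absurd trivial h

end

theorem hasDerivAt_integral_comp_pt {I : Set ℝ} (hI : IsOpen I) {f : V4 → ℝ}
    (hf : ContDiffOn ℝ ∞ f (region I)) {u r : ℝ} (hu : u ∈ I) (hr : 0 < r) :
    HasDerivAt (fun s => ∫ x, f (pt u s x) ∂sphereArea)
      (∫ x, fderiv ℝ f (pt u r x) (kVec (pt u r x)) ∂sphereArea) r := by
  have hU := isOpen_region hI
  have hD : ContinuousOn (fun p => fderiv ℝ f p (kVec p)) (region I) :=
    ((hf.fderiv_of_isOpen hU (by simp : (∞ : WithTop ℕ∞) + 1 ≤ ∞)).continuousOn).clm_apply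
      (contDiffOn_pi.2 (smoothVF_kVec (U := region I) fun _ h => h.2)).continuousOn
  have hK : IsCompact (Set.Icc (r / 2) (2 * r) ×ˢ (Set.univ : Set S2)) :=
    isCompact_Icc.prod isCompact_univ
  obtain ⟨C, hC⟩ := hK.exists_bound_of_continuousOn ((continuousOn_comp_pt hD hu).mono
    (Set.prod_mono (fun s hs => lt_of_lt_of_le (by positivity : 0 < r / 2) hs.1) subset_rfl))
  refine (hasDerivAt_integral_of_dominated_loc_of_deriv_le (bound := fun _ => C)
    (Icc_mem_nhds (by linarith : r / 2 < r) (by linarith : r < 2 * r)) ?_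
    (integrable_comp_pt hf.continuousOn hu hr)
    (integrable_comp_pt hD hu hr).aestronglyMeasurable
    (Eventually.of_forall fun x s hs => hC (s, x) ⟨hs, trivial⟩) (integrable_const C)
    (Eventually.of_forall fun x s hs => ?_)).2
  · filter_upwards [lt_mem_nhds hr] with s hs
    exact (integrable_comp_pt hf.continuousOn hu hs).aestronglyMeasurable
  · have hs' : 0 < s := lt_of_lt_of_le (by positivity : 0 < r / 2) hs.1
    exact hasDerivAt_comp_radial hs' (differentiableAt_of_smooth hU hf (pt_mem hu hs' x))

/-- T carries no regularity assumption. On the cone the field equations express the matter density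
by the Ricci tensor, and its continuity and integrability come from there. -/
theorem BondiChart.continuousOn_matter {g : V4 → M4} {U : Set V4} (hg : BondiChart g U) :
    ContinuousOn (fun p => rad p ^ 2 * val (ricci g p) (kVec p) (kVec p)
      + rad p ^ 2 * rho g p * ∑ a, val (ricci g p) (eVec g a p) (eVec g a p)) U := by
  have hric : ∀ i j, ContDiffOn ℝ ∞ (fun p => ricci g p i j) U := fun i j => by
    have hc := hg.smoothMetric.christoffel_smooth
    unfold ricci
    simp only [Matrix.of_apply]
    exact ContDiffOn.sum fun k _ => (((hc _ _ _).pd hg.isOpen _).sub ((hc _ _ _).pd hg.isOpen _)).add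
      (ContDiffOn.sum fun l _ => ((hc _ _ _).mul (hc _ _ _)).sub ((hc _ _ _).mul (hc _ _ _)))
  have hval : ∀ X : V4 → V4, SmoothVF X U → ContDiffOn ℝ ∞ (fun p => val (ricci g p) (X p) (X p)) U :=
    fun X hX => by
      simp only [val, dotProduct, mulVec]
      exact ContDiffOn.sum fun i _ => (hX i).mul
        (ContDiffOn.sum fun j _ => (hric i j).mul (hX j))
  have hr2 := (contDiffOn_rad hg.tail_ne).pow 2
  exact ((hr2.mul (hval _ (smoothVF_kVec hg.tail_ne))).add ((hr2.mul hg.smooth_rho).mul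
    (ContDiffOn.sum fun a _ => hval _ (hg.smoothVF_eVec a)))).continuousOn

theorem BondiChart.smooth_deriv_potential {g : V4 → M4} {U : Set V4} (hg : BondiChart g U) :
    ContDiffOn ℝ ∞ (fun p => fderiv ℝ (potential g) p (kVec p)) U := by
  simp only [fderiv_eq_sum_pd]
  exact ContDiffOn.sum fun i _ => (smoothVF_kVec hg.tail_ne i).mul
    (hg.smooth_potential.pd hg.isOpen i)

/-! ### Fluxes through the spheres and the integrated balance law -/

namespace IsAffineBondi

variable {g T : V4 → M4} {I : Set ℝ} (hg : IsAffineBondi g I) (hI : IsOpen I) {u : ℝ} (hu : u ∈ I)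
include hg hI hu

theorem conePotential_eq {r : ℝ} (hr : 0 < r) : (fun x => conePotential g u r x) = fun x =>
    potential g (pt u r x) - r ^ 2 * div3 (fun q i => rho g q * shift g q i) (pt u r x) := by
  funext x
  rw [hg.potential_eq hI hu hr]
  ring

theorem conePotential_integrable {r : ℝ} (hr : 0 < r) :
    Integrable (fun x => conePotential g u r x) sphereArea := by
  have hc := hg.chart hI
  rw [hg.conePotential_eq hI hu hr]
  exact (integrable_comp_pt hc.smooth_potential.continuousOn hu hr).sub
    ((integrable_comp_pt (hc.smooth_div3 hc.smooth_rho_shift).continuousOn hu hr).const_mul _)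

/-- The two functions differ by a multiple of the divergence of ρ times the shift, a field tangent
to the spheres. -/
theorem integral_potential {r : ℝ} (hr : 0 < r) : ∫ x, potential g (pt u r x) ∂sphereArea
    = ∫ x, conePotential g u r x ∂sphereArea := by
  have hc := hg.chart hI
  have hd := hc.smooth_div3 hc.smooth_rho_shift
  have h0 := integral_div3_eq_zero hI hc.smooth_rho_shift (fun p hp => by
    have h := hc.shift_radial hp
    change dir p ⬝ᵥ (rho g p • shift g p) = 0
    rw [dotProduct_smul, h, smul_zero]) hu hr
  rw [hg.conePotential_eq hI hu hr, integral_sub (integrable_comp_pt hc.smooth_potential.continuousOn hu hr)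
    ((integrable_comp_pt hd.continuousOn hu hr).const_mul _), integral_const_mul, h0]
  ring

variable (hE : EinsteinEqs g T u)
include hE

theorem matterDensity_integrable {r : ℝ} (hr : 0 < r) :
    Integrable (fun x => matterDensity g T u r x) sphereArea := by
  refine (integrable_comp_pt (hg.chart hI).continuousOn_matter hu hr).congr
    (Eventually.of_forall fun x => ?_)
  change _ = matterDensity g T u r x
  rw [hg.matterDensity_eq hI hu hr x hE]
  simp only [rad_pt u hr]

theorem continuousOn_matterFlux : ContinuousOn (matterFlux g T u) (Set.Ioi 0) := by
  refine (continuousOn_integral_comp_pt (hg.chart hI).continuousOn_matter hu).congr fun r hr => ?_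
  refine integral_congr_ae (Eventually.of_forall fun x => ?_)
  rw [hg.matterDensity_eq hI hu hr x hE]
  simp only [rad_pt u (Set.mem_Ioi.1 hr)]

theorem integral_density {r : ℝ} (hr : 0 < r) :
    ∫ x, geomDensity g u r x + matterDensity g T u r x ∂sphereArea
      = ∫ x, fderiv ℝ (potential g) (pt u r x) (kVec (pt u r x)) ∂sphereArea := by
  have hc := hg.chart hI
  have h0 := integral_div3_eq_zero hI hc.smooth_tangentFlux
    (fun p hp => hc.dir_dot_tangentFlux hp) hu hr
  have hd := hc.smooth_div3 hc.smooth_tangentFlux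
  rw [integral_congr_ae (Eventually.of_forall fun x => hg.density_add hI hu hr x hE),
    integral_add (integrable_comp_pt hc.smooth_deriv_potential.continuousOn hu hr)
      ((integrable_comp_pt hd.continuousOn hu hr).const_mul _), integral_const_mul, h0]
  ring

theorem geomFlux_add_matterFlux {r : ℝ} (hr : 0 < r) : geomFlux g u r + matterFlux g T u r
    = ∫ x, fderiv ℝ (potential g) (pt u r x) (kVec (pt u r x)) ∂sphereArea := by
  have hc := hg.chart hI
  have hd := hc.smooth_div3 hc.smooth_tangentFlux
  have hm := hg.matterDensity_integrable hI hu hE hr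
  have hgeo : Integrable (fun x => geomDensity g u r x) sphereArea := by
    refine (((integrable_comp_pt hc.smooth_deriv_potential.continuousOn hu hr).add
      ((integrable_comp_pt hd.continuousOn hu hr).const_mul (r ^ 2))).sub hm).congr
      (Eventually.of_forall fun x => ?_)
    have := hg.density_add hI hu hr x hE
    simp only [Pi.add_apply, Pi.sub_apply]
    linarith
  rw [← hg.integral_density hI hu hE hr, integral_add hgeo hm]
  rfl

theorem continuousOn_geomFlux : ContinuousOn (geomFlux g u) (Set.Ioi 0) := by
  refine ((continuousOn_integral_comp_pt (hg.chart hI).smooth_deriv_potential.continuousOn hu).sub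
    (hg.continuousOn_matterFlux hI hu hE)).congr fun r hr => ?_
  have := hg.geomFlux_add_matterFlux hI hu hE hr
  simp only [Pi.sub_apply]
  linarith

/-- The integrated balance law. -/
theorem integral_flux {a b : ℝ} (ha : 0 < a) (hb : 0 < b) :
    (∫ r in a..b, geomFlux g u r) + ∫ r in a..b, matterFlux g T u r
      = (∫ x, conePotential g u b x ∂sphereArea) - ∫ x, conePotential g u a x ∂sphereArea := by
  have hsub : Set.uIcc a b ⊆ Set.Ioi 0 := fun s hs => lt_of_lt_of_le (lt_min ha hb) hs.1
  have h1 : IntervalIntegrable (geomFlux g u) volume a b :=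
    ((hg.continuousOn_geomFlux hI hu hE).mono hsub).intervalIntegrable
  have h2 : IntervalIntegrable (matterFlux g T u) volume a b :=
    ((hg.continuousOn_matterFlux hI hu hE).mono hsub).intervalIntegrable
  rw [← intervalIntegral.integral_add h1 h2, ← hg.integral_potential hI hu ha,
    ← hg.integral_potential hI hu hb]
  refine intervalIntegral.integral_eq_sub_of_hasDerivAt
    (f := fun s => ∫ x, potential g (pt u s x) ∂sphereArea) (fun r hr => ?_) (h1.add h2)
  rw [hg.geomFlux_add_matterFlux hI hu hE (hsub hr)]
  exact hasDerivAt_integral_comp_pt hI (hg.chart hI).smooth_potential hu (hsub hr)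

end IsAffineBondi

/-! ## Expansions in inverse powers of the radius -/

/-- Uniformity on the sphere becomes a statement along the product filter with ⊤, so the Landau
calculus applies to uniform estimates. -/
theorem eventually_prod_top {l : Filter ℝ} {p : ℝ → S2 → Prop} :
    (∀ᶠ z : ℝ × S2 in l ×ˢ ⊤, p z.1 z.2) ↔ ∀ᶠ r in l, ∀ x, p r x := by
  constructor
  · intro h
    obtain ⟨pa, ha, pb, hb, hab⟩ := eventually_prod_iff.1 h
    rw [eventually_top] at hb
    filter_upwards [ha] with r hr x
    exact hab hr (hb x)
  · intro h
    exact (h.prod_inl ⊤).mono fun z hz => hz z.2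

/-- The filter of large radii, uniformly on the sphere. -/
abbrev farField : Filter (ℝ × S2) := atTop ×ˢ ⊤

theorem bigO_iff {k : ℕ} {F : ℝ → S2 → ℝ} :
    BigO k F ↔ (fun z : ℝ × S2 => F z.1 z.2) =O[farField] fun z => z.1⁻¹ ^ k := by
  rw [Asymptotics.isBigO_iff]
  constructor
  · rintro ⟨C, R, hR, h⟩
    refine ⟨C, (eventually_prod_top (p := fun r x => ‖F r x‖ ≤ C * ‖r⁻¹ ^ k‖)).2 ?_⟩
    filter_upwards [eventually_ge_atTop R] with r hr x
    have hr0 : 0 < r := hR.trans_le hr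
    rw [Real.norm_eq_abs, Real.norm_eq_abs, abs_of_pos (a := r⁻¹ ^ k) (by positivity), inv_pow,
      ← div_eq_mul_inv]
    exact h r hr x
  · rintro ⟨C, h⟩
    have h' := (eventually_prod_top (p := fun r x => ‖F r x‖ ≤ C * ‖r⁻¹ ^ k‖)).1 h
    obtain ⟨R, hR⟩ := eventually_atTop.1 h'
    refine ⟨C, max R 1, by positivity, fun r hr x => ?_⟩
    have hr0 : 0 < r := lt_of_lt_of_le (by positivity) hr
    have := hR r ((le_max_left _ _).trans hr) x
    rwa [Real.norm_eq_abs, Real.norm_eq_abs, abs_of_pos (a := r⁻¹ ^ k) (by positivity), inv_pow,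
      ← div_eq_mul_inv] at this

theorem isBigO_of_continuous {a : S2 → ℝ} (ha : Continuous a) :
    (fun z : ℝ × S2 => a z.2) =O[farField] fun _ => (1 : ℝ) := by
  obtain ⟨C, hC⟩ := isCompact_univ.exists_bound_of_continuousOn ha.continuousOn
  exact Asymptotics.IsBigO.of_bound C (Eventually.of_forall fun z => by
    simpa using hC z.2 trivial)

theorem tendsto_inv_farField : Tendsto (fun z : ℝ × S2 => z.1⁻¹) farField (𝓝 0) :=
  tendsto_inv_atTop_zero.comp tendsto_fst

theorem isBigO_inv_one : (fun z : ℝ × S2 => z.1⁻¹) =O[farField] fun _ => (1 : ℝ) :=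
  tendsto_inv_farField.isBigO_one ℝ

theorem eventually_pos_farField : ∀ᶠ z : ℝ × S2 in farField, 0 < z.1 :=
  tendsto_fst.eventually (eventually_gt_atTop 0)

/-- The expansion `F = a + b r⁻¹ + O(r⁻²)`, uniformly on the sphere. -/
structure Jet (F : ℝ → S2 → ℝ) (a b : S2 → ℝ) : Prop where
  cont_fst : Continuous a
  cont_snd : Continuous b
  isBigO : (fun z : ℝ × S2 => F z.1 z.2 - (a z.2 + b z.2 * z.1⁻¹)) =O[farField] fun z => z.1⁻¹ ^ 2

namespace Jet

variable {F H : ℝ → S2 → ℝ} {a b c d : S2 → ℝ}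

theorem isBigO_sub_fst (h : Jet F a b) :
    (fun z : ℝ × S2 => F z.1 z.2 - a z.2) =O[farField] fun z => z.1⁻¹ := by
  have h1 : (fun z : ℝ × S2 => b z.2 * z.1⁻¹) =O[farField] fun z => z.1⁻¹ := by
    simpa using (isBigO_of_continuous h.cont_snd).mul (Asymptotics.isBigO_refl (fun z : ℝ × S2 => z.1⁻¹) farField)
  have h2 : (fun z : ℝ × S2 => z.1⁻¹ ^ 2) =O[farField] fun z => z.1⁻¹ := by
    simpa [pow_two] using isBigO_inv_one.mul (Asymptotics.isBigO_refl (fun z : ℝ × S2 => z.1⁻¹) farField)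
  refine ((h.isBigO.trans h2).add h1).congr_left fun z => ?_
  ring

theorem isBigO_one (h : Jet F a b) :
    (fun z : ℝ × S2 => F z.1 z.2) =O[farField] fun _ => (1 : ℝ) := by
  refine ((h.isBigO_sub_fst.trans isBigO_inv_one).add
    (isBigO_of_continuous h.cont_fst)).congr_left fun z => ?_
  ring

theorem congr (h : Jet F a b) (e : ∀ᶠ r in atTop, ∀ x, F r x = H r x) : Jet H a b :=
  ⟨h.cont_fst, h.cont_snd, h.isBigO.congr' (by
    filter_upwards [(eventually_prod_top (p := fun r x => F r x = H r x)).2 e] with z hz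
    rw [hz]) EventuallyEq.rfl⟩

theorem of_eq (h : Jet F a b) (ha : ∀ x, a x = c x) (hb : ∀ x, b x = d x) : Jet F c d := by
  rwa [funext ha, funext hb] at h

theorem const (ha : Continuous a) : Jet (fun _ x => a x) a 0 :=
  ⟨ha, continuous_const, by simpa using Asymptotics.isBigO_zero _ _⟩

theorem add (h : Jet F a b) (h' : Jet H c d) :
    Jet (fun r x => F r x + H r x) (fun x => a x + c x) (fun x => b x + d x) :=
  ⟨h.cont_fst.add h'.cont_fst, h.cont_snd.add h'.cont_snd,
    (h.isBigO.add h'.isBigO).congr_left fun z => by ring⟩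

theorem mul (h : Jet F a b) (h' : Jet H c d) :
    Jet (fun r x => F r x * H r x) (fun x => a x * c x) (fun x => a x * d x + b x * c x) := by
  refine ⟨h.cont_fst.mul h'.cont_fst, (h.cont_fst.mul h'.cont_snd).add (h.cont_snd.mul h'.cont_fst), ?_⟩
  have e1 : (fun z : ℝ × S2 => (F z.1 z.2 - (a z.2 + b z.2 * z.1⁻¹)) * H z.1 z.2)
      =O[farField] fun z => z.1⁻¹ ^ 2 := by
    simpa using h.isBigO.mul h'.isBigO_one
  have e2 : (fun z : ℝ × S2 => a z.2 * (H z.1 z.2 - (c z.2 + d z.2 * z.1⁻¹)))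
      =O[farField] fun z => z.1⁻¹ ^ 2 := by
    simpa using (isBigO_of_continuous h.cont_fst).mul h'.isBigO
  have e3 : (fun z : ℝ × S2 => b z.2 * (z.1⁻¹ * (H z.1 z.2 - c z.2)))
      =O[farField] fun z => z.1⁻¹ ^ 2 := by
    simpa [pow_two] using (isBigO_of_continuous h.cont_snd).mul
      ((Asymptotics.isBigO_refl (fun z : ℝ × S2 => z.1⁻¹) farField).mul h'.isBigO_sub_fst)
  refine ((e1.add e2).add e3).congr_left fun z => ?_
  ring

theorem const_mul (h : Jet F a b) (k : ℝ) :
    Jet (fun r x => k * F r x) (fun x => k * a x) (fun x => k * b x) := by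
  simpa using (const (a := fun _ => k) continuous_const).mul h

theorem sub (h : Jet F a b) (h' : Jet H c d) :
    Jet (fun r x => F r x - H r x) (fun x => a x - c x) (fun x => b x - d x) := by
  simpa [sub_eq_add_neg] using h.add (h'.const_mul (-1))

theorem sum {ι : Type*} {s : Finset ι} {F : ι → ℝ → S2 → ℝ} {a b : ι → S2 → ℝ}
    (h : ∀ i, Jet (F i) (a i) (b i)) :
    Jet (fun r x => ∑ i ∈ s, F i r x) (fun x => ∑ i ∈ s, a i x) (fun x => ∑ i ∈ s, b i x) := by
  refine ⟨continuous_finsetSum _ fun i _ => (h i).cont_fst,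
    continuous_finsetSum _ fun i _ => (h i).cont_snd, ?_⟩
  refine (Asymptotics.IsBigO.sum (s := s) fun i _ => (h i).isBigO).congr_left fun z => ?_
  rw [Finset.sum_apply, Finset.sum_sub_distrib, Finset.sum_add_distrib, Finset.sum_mul]

theorem smul_inv_sq (h : Jet F a b) : Jet (fun r x => r⁻¹ ^ 2 * F r x) 0 0 :=
  ⟨continuous_const, continuous_const, by
    refine ((Asymptotics.isBigO_refl (fun z : ℝ × S2 => z.1⁻¹ ^ 2) farField).mul
      h.isBigO_one).congr (fun z => ?_) fun z => mul_one _
    simp⟩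

theorem tendsto_sub (h : Jet F a b) :
    Tendsto (fun z : ℝ × S2 => F z.1 z.2 - a z.2) farField (𝓝 0) :=
  h.isBigO_sub_fst.trans_tendsto tendsto_inv_farField

theorem eventually_lt (h : Jet F a b) {k δ : ℝ} (hδ : 0 < δ) (hk : ∀ x, k + δ ≤ a x) :
    ∀ᶠ r in atTop, ∀ x, k < F r x := by
  refine eventually_prod_top.1 ?_
  filter_upwards [h.tendsto_sub.eventually (lt_mem_nhds (neg_lt_zero.2 hδ))] with z hz
  linarith [hk z.2]

theorem isBigO_one_of_eventually {k : ℝ} (hk : 0 < k) (h : ∀ᶠ r in atTop, ∀ x, k < F r x) :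
    (fun z : ℝ × S2 => (F z.1 z.2)⁻¹) =O[farField] fun _ => (1 : ℝ) := by
  refine Asymptotics.IsBigO.of_bound k⁻¹ ?_
  filter_upwards [eventually_prod_top.2 h] with z hz
  rw [norm_inv, norm_one, mul_one, Real.norm_eq_abs, abs_of_pos (hk.trans hz)]
  exact inv_anti₀ hk hz.le

/-- F times the candidate is 1 + O(r⁻²); divide by F, which is eventually bounded away from zero. -/
theorem inv (h : Jet F a b) {k : ℝ} (hk0 : 0 < k) (ha : ∀ x, a x = k) :
    Jet (fun r x => (F r x)⁻¹) (fun _ => k⁻¹) (fun x => -b x / k ^ 2) := by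
  refine ⟨continuous_const, h.cont_snd.neg.div_const _, ?_⟩
  have hev := h.eventually_lt (k := k / 2) (half_pos hk0) fun x => by rw [ha]; linarith
  have e0 := isBigO_one_of_eventually (half_pos hk0) hev
  have hj : Jet (fun r x => k⁻¹ + (-b x / k ^ 2) * r⁻¹) (fun _ => k⁻¹) (fun x => -b x / k ^ 2) :=
    ⟨continuous_const, h.cont_snd.neg.div_const _, by simpa using Asymptotics.isBigO_zero _ _⟩
  have e1 := (h.mul hj).isBigO
  refine ((e0.mul e1).congr' ?_ (by simp)).neg_left.congr_left fun z => neg_neg _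
  filter_upwards [eventually_prod_top.2 hev] with z hz
  have hF : F z.1 z.2 ≠ 0 := by linarith
  simp only [ha]
  field_simp
  ring

/-- With j the candidate, √F − j = (F − j²)/(√F + j). The numerator is O(r⁻²) and the denominator is
bounded below. -/
theorem sqrt (h : Jet F a b) (ha : ∀ x, a x = 1) :
    Jet (fun r x => √(F r x)) (fun _ => 1) (fun x => b x / 2) := by
  refine ⟨continuous_const, h.cont_snd.div_const _, ?_⟩
  have hj : Jet (fun r x => 1 + (b x / 2) * r⁻¹) (fun _ => 1) (fun x => b x / 2) :=
    ⟨continuous_const, h.cont_snd.div_const _, by simpa using Asymptotics.isBigO_zero _ _⟩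
  have hF := h.eventually_lt (k := 0) one_pos fun x => by rw [ha]; norm_num
  have hD : ∀ᶠ r in atTop, ∀ x, 1 / 2 < √(F r x) + (1 + (b x / 2) * r⁻¹) := by
    refine eventually_prod_top.1 ?_
    filter_upwards [hj.tendsto_sub.eventually (lt_mem_nhds (by norm_num : (-1 / 2 : ℝ) < 0))] with z hz
    linarith [Real.sqrt_nonneg (F z.1 z.2)]
  have e0 := isBigO_one_of_eventually (by norm_num : (0 : ℝ) < 1 / 2) hD
  have e1 := (h.sub (hj.mul hj)).isBigO
  refine (e0.mul e1).congr' ?_ (by simp)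
  filter_upwards [eventually_prod_top.2 hF, eventually_prod_top.2 hD] with z hz1 hz2
  have h1 := Real.sq_sqrt hz1.le
  have h2 : √(F z.1 z.2) + (1 + (b z.2 / 2) * z.1⁻¹) ≠ 0 := by linarith
  simp only [ha]
  rw [inv_mul_eq_iff_eq_mul₀ h2]
  linear_combination -h1

end Jet

/-- Entrywise expansions of matrices. -/
def MatJet (F : ℝ → S2 → M3) (a b : S2 → M3) : Prop :=
  ∀ i j, Jet (fun r x => F r x i j) (fun x => a x i j) fun x => b x i j

namespace MatJet

variable {F H : ℝ → S2 → M3} {a b c d : S2 → M3}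

theorem mul (h : MatJet F a b) (h' : MatJet H c d) :
    MatJet (fun r x => F r x * H r x) (fun x => a x * c x) (fun x => a x * d x + b x * c x) := by
  intro i j
  simp only [Matrix.add_apply, Matrix.mul_apply, ← Finset.sum_add_distrib]
  exact Jet.sum fun l => (h i l).mul (h' l j)

theorem congr (h : MatJet F a b) (e : ∀ᶠ r in atTop, ∀ x, F r x = H r x) : MatJet H a b :=
  fun i j => (h i j).congr (e.mono fun r hr x => by rw [hr])

theorem of_eq (h : MatJet F a b) (ha : ∀ x, a x = c x) (hb : ∀ x, b x = d x) : MatJet F c d := by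
  rwa [funext ha, funext hb] at h

theorem trace (h : MatJet F a b) :
    Jet (fun r x => (F r x).trace) (fun x => (a x).trace) (fun x => (b x).trace) :=
  Jet.sum fun i => h i i

theorem const (ha : Continuous a) : MatJet (fun _ x => a x) a 0 := fun i j =>
  Jet.const (ha.matrix_elem i j)

end MatJet

/-! ## The asymptotic expansion of the cone -/

theorem continuous_tangentProj : Continuous tangentProj := by
  refine continuous_matrix fun i j => ?_
  have h := fun i => (continuous_apply i).comp continuous_pos
  exact continuous_const.sub ((h i).mul (h j))

theorem tangentProj_mul_self (x : S2) : tangentProj x * tangentProj x = tangentProj x :=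
  orthProj_mul_self (pos_dot_pos x)

theorem trace_tangentProj (x : S2) : (tangentProj x).trace = 2 := trace_orthProj (pos_dot_pos x)

theorem hasDerivAt_trace {F : ℝ → M3} {t : ℝ} (hF : ∀ i j, DifferentiableAt ℝ (fun s => F s i j) t) :
    HasDerivAt (fun s => (F s).trace) (matDeriv F t).trace t :=
  HasDerivAt.fun_sum fun i _ => (hF i i).hasDerivAt

theorem hasDerivAt_det {F : ℝ → M3} {t : ℝ} (hF : ∀ i j, DifferentiableAt ℝ (fun s => F s i j) t) :
    HasDerivAt (fun s => 1 / 2 * ((F s).trace ^ 2 - (F s * F s).trace))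
      ((F t).trace * (matDeriv F t).trace - (F t * matDeriv F t).trace) t := by
  have h1 := hasDerivAt_trace hF
  have hFF : ∀ i j, DifferentiableAt ℝ (fun s => (F s * F s) i j) t := fun i j => by
    simp only [Matrix.mul_apply]
    exact DifferentiableAt.fun_sum fun l _ => (hF i l).fun_mul (hF l j)
  have h2 := hasDerivAt_trace hFF
  refine (((h1.fun_pow 2).sub h2).const_mul (1 / 2)).congr_deriv ?_
  rw [matDeriv_mul hF hF, trace_add, trace_mul_comm (matDeriv F t)]
  simp
  ring

/-! ### The quantities on the cone as traces of g_AB and its derivatives -/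

namespace IsAffineBondi

variable {g : V4 → M4} {I : Set ℝ} (hg : IsAffineBondi g I) (hI : IsOpen I)
  {u r : ℝ} (hu : u ∈ I) (hr : 0 < r) (x : S2)
include hg hI hu hr

theorem tangentProj_mul_gAB : tangentProj x * gAB g u r x = gAB g u r x := by
  rw [hg.gAB_eq hI hu hr, mul_smul_comm]
  congr 1
  exact orthProj_mul (hg.radial_pt' hI hu hr x)

theorem sigma_sq : sigma g u r x ^ 2
    = 1 / 2 * ((gAB g u r x).trace ^ 2 - (gAB g u r x * gAB g u r x).trace) := by
  have h := hg.sigma_pos hI hu hr x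
  rw [sigma, Real.sqrt_pos] at h
  rw [sigma, Real.sq_sqrt h.le, tangentDet, normalProj, det_add_normal (pos_dot_pos x)]
  · rw [hg.gAB_eq hI hu hr, smul_mulVec, hg.radial_pt hI hu hr, smul_zero]
  · rw [hg.gAB_eq hI hu hr, vecMul_smul, hg.radial_pt' hI hu hr, smul_zero]

theorem differentiableAt_gAB_radial (i j : Fin 3) :
    DifferentiableAt ℝ (fun s => gAB g u s x i j) r := by
  have h := ((differentiableAt_id (𝕜 := ℝ) (x := r)).fun_pow 2).fun_mul
    (hasDerivAt_comp_radial hr (f := fun q => g q i.succ j.succ) (differentiableAt_of_smooth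
      (isOpen_region hI) (hg.smooth _ _) (pt_mem hu hr x))).differentiableAt
  refine h.congr_of_eventuallyEq ?_
  filter_upwards [lt_mem_nhds hr] with s hs
  rw [hg.gAB_eq hI hu hs]
  rfl

theorem differentiableAt_gAB_time (i j : Fin 3) :
    DifferentiableAt ℝ (fun v => gAB g v r x i j) u := by
  have h := (hasDerivAt_comp_time (f := fun q => g q i.succ j.succ) (differentiableAt_of_smooth
      (isOpen_region hI) (hg.smooth _ _) (pt_mem hu hr x))).differentiableAt.const_mul (r ^ 2)
  refine h.congr_of_eventuallyEq ?_
  filter_upwards [hI.mem_nhds hu] with v hv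
  rw [hg.gAB_eq hI hv hr]
  rfl

theorem tangentProj_mul_matDeriv_radial : tangentProj x * matDeriv (fun s => gAB g u s x) r
    = matDeriv (fun s => gAB g u s x) r := by
  have h := matDeriv_mul (F := fun _ => tangentProj x) (t := r) (fun i j => by fun_prop)
    (hg.differentiableAt_gAB_radial hI hu hr x)
  rw [matDeriv_const, zero_mul, zero_add] at h
  rw [← h]
  refine matDeriv_congr ?_
  filter_upwards [lt_mem_nhds hr] with s hs
  exact hg.tangentProj_mul_gAB hI hu hs x

theorem tangentProj_mul_matDeriv_time : tangentProj x * matDeriv (fun v => gAB g v r x) u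
    = matDeriv (fun v => gAB g v r x) u := by
  have h := matDeriv_mul (F := fun _ => tangentProj x) (t := u) (fun i j => by fun_prop)
    (hg.differentiableAt_gAB_time hI hu hr x)
  rw [matDeriv_const, zero_mul, zero_add] at h
  rw [← h]
  refine matDeriv_congr ?_
  filter_upwards [hI.mem_nhds hu] with v hv
  exact hg.tangentProj_mul_gAB hI hv hr x

/-- The derivative of the polynomial relation `sigma_sq`. Only traces of matrices with known
expansions occur, so no expansion of σ has to be differentiated. -/
theorem two_mul_sigma_radial : 2 * sigma g u r x * deriv (fun s => sigma g u s x) r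
    = (gAB g u r x).trace * (matDeriv (fun s => gAB g u s x) r).trace
      - (gAB g u r x * matDeriv (fun s => gAB g u s x) r).trace := by
  have h1 := (hg.hasDerivAt_sigma_radial hI hu hr x).differentiableAt.hasDerivAt.fun_pow 2
  have h2 := hasDerivAt_det (hg.differentiableAt_gAB_radial hI hu hr x)
  have e : (fun s => sigma g u s x ^ 2) =ᶠ[𝓝 r] fun s => 1 / 2 * ((gAB g u s x).trace ^ 2
      - (gAB g u s x * gAB g u s x).trace) := by
    filter_upwards [lt_mem_nhds hr] with s hs
    exact hg.sigma_sq hI hu hs x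
  rw [← h1.unique (h2.congr_of_eventuallyEq e)]
  simp

theorem two_mul_sigma_time : 2 * sigma g u r x * deriv (fun v => sigma g v r x) u
    = (gAB g u r x).trace * (matDeriv (fun v => gAB g v r x) u).trace
      - (gAB g u r x * matDeriv (fun v => gAB g v r x) u).trace := by
  have h1 := (hg.hasDerivAt_sigma_time hI hu hr x).differentiableAt.hasDerivAt.fun_pow 2
  have h2 := hasDerivAt_det (hg.differentiableAt_gAB_time hI hu hr x)
  have e : (fun v => sigma g v r x ^ 2) =ᶠ[𝓝 u] fun v => 1 / 2 * ((gAB g v r x).trace ^ 2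
      - (gAB g v r x * gAB g v r x).trace) := by
    filter_upwards [hI.mem_nhds hu] with v hv
    exact hg.sigma_sq hI hv hr x
  rw [← h1.unique (h2.congr_of_eventuallyEq e)]
  simp

/-- Multiply the Cayley–Hamilton identity for Ĝ by N and use N Ĝ = −P. The inverse becomes a linear
expression in Ĝ, so its expansion needs no inversion of matrices. -/
theorem sigma_div_sq_smul_invMetric : (sigma g u r x / r ^ 2) ^ 2 • invMetric g (pt u r x)
    = (r ^ 2)⁻¹ • gAB g u r x - ((r ^ 2)⁻¹ • gAB g u r x).trace • tangentProj x := by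
  have hp := pt_mem hu hr x
  have hx := pos_dot_pos x
  have e0 : (r ^ 2)⁻¹ • gAB g u r x = sp (g (pt u r x)) := hg.gHat_eq hI hu hr x
  have h1 := hg.radial_pt hI hu hr x
  have h2 := hg.radial_pt' hI hu hr x
  set G := sp (g (pt u r x)) with hG
  set N := invMetric g (pt u r x) with hN
  have hch := tangential_cayley_hamilton hx h1 h2
  have hdet : (G + vecMulVec (pos x) (pos x)).det = (sigma g u r x / r ^ 2) ^ 2 := by
    rw [det_add_normal hx h1 h2, ← e0, div_pow, hg.sigma_sq hI hu hr]
    simp only [trace_smul, smul_mul_smul_comm, smul_eq_mul]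
    field_simp
  have hNG := (hg.chart hI).invMetric_mul_sp hp
  have hNx := (hg.chart hI).invMetric_radial hp
  rw [dir_pt u hr] at hNG hNx
  have h3 := congrArg (N * ·) hch
  simp only [mul_sub, mul_smul_comm] at h3
  rw [← Matrix.mul_assoc, hNG, Matrix.neg_mul, orthProj_mul h2, mul_orthProj hNx, hdet] at h3
  rw [e0]
  change _ = G - G.trace • orthProj (pos x)
  rw [smul_neg] at h3
  rw [eq_sub_iff_add_eq] at h3
  rw [← sub_eq_zero]
  have : -G + (sigma g u r x / r ^ 2) ^ 2 • N - (-(G.trace • orthProj (pos x))) = 0 :=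
    sub_eq_zero.2 h3
  rw [← this]
  abel

/-- As r' is the root of σ, the quotient of its derivatives is σ_{,u}/σ_{,r}. Since ∂_r is null with
g(∂_u, ∂_r) = 1, only the cross term changes g_00. -/
theorem g00Lum_eq : g00Lum g u r x = g00 g u r x
    - 2 * (deriv (fun v => sigma g v r x) u / deriv (fun s => sigma g u s x) r) := by
  have hs := hg.sigma_pos hI hu hr x
  have h1 := ((hg.hasDerivAt_sigma_radial hI hu hr x).differentiableAt.hasDerivAt.sqrt hs.ne').deriv
  have h2 := ((hg.hasDerivAt_sigma_time hI hu hr x).differentiableAt.hasDerivAt.sqrt hs.ne').deriv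
  have hpos : 2 * √(sigma g u r x) ≠ 0 := by
    have := Real.sqrt_pos.2 hs
    positivity
  have hq : deriv (fun v => lumDist g v r x) u / deriv (fun s => lumDist g u s x) r
      = deriv (fun v => sigma g v r x) u / deriv (fun s => sigma g u s x) r := by
    simp only [lumDist]
    rw [h1, h2, div_div_div_cancel_right₀ hpos]
  have hsym : (g (pt u r x)).IsSymm := hg.symm _ (pt_mem hu hr x)
  have h3 := hg.g_ur u hu r hr x
  have h4 := hg.g_rr u hu r hr x
  rw [g00Lum, dULum, hq, val_sub_left, val_smul_left, val_comm hsym dU, val_comm hsym (dR x),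
    val_sub_left, val_sub_left, val_smul_left, val_smul_left, h4, val_comm hsym (dR x), h3, g00]
  ring

theorem hasDerivAt_lumDist : HasDerivAt (fun s => lumDist g u s x)
    (deriv (fun s => sigma g u s x) r / (2 * lumDist g u r x)) r :=
  (hg.hasDerivAt_sigma_radial hI hu hr x).differentiableAt.hasDerivAt.sqrt
    (hg.sigma_pos hI hu hr x).ne'

end IsAffineBondi

/-- The trace `P^AB n_AB` with respect to the standard metric of the sphere. -/
def tr (n : S2 → M3) (x : S2) : ℝ := (tangentProj x * n x).trace

/-- The time derivative of a coefficient of the expansion. -/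
def dot (n : ℝ → S2 → M3) (u : ℝ) (x : S2) : M3 := matDeriv (fun v => n v x) u

/-- The mass aspect in terms of the coefficients of the expansions. -/
def massAspect (n m : ℝ → S2 → M3) (M : S2 → ℝ) (u : ℝ) (x : S2) : ℝ :=
  M x + 1 / 16 * (tr (n u) x * tr (dot n u) x) - 1 / 4 * (tr (dot m u) x
    + (tangentProj x * n u x * (tangentProj x * dot n u x)).trace)

theorem continuous_tr {n : S2 → M3} (hn : Continuous n) : Continuous (tr n) :=
  (continuous_tangentProj.matrix_mul hn).matrix_trace

theorem trace_tangentProj_mul (n : S2 → M3) (x : S2) :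
    (tangentProj x * (tangentProj x * n x)).trace = tr n x := by
  rw [← Matrix.mul_assoc, tangentProj_mul_self, tr]

theorem trace_mul_tangentProj (n : S2 → M3) (x : S2) :
    (tangentProj x * n x * tangentProj x).trace = tr n x := by
  rw [trace_mul_comm, trace_tangentProj_mul]

/-! ### Expansions of the metric functions at large radius -/

namespace IsAsymptotic

variable {g : V4 → M4} {I : Set ℝ} {u : ℝ} {ψ κ : S2 → Fin 3 → ℝ} {n m : ℝ → S2 → M3} {M : S2 → ℝ}
  (ha : IsAsymptotic g u ψ κ n m M)
include ha

theorem jet_omegaLow (i : Fin 3) : Jet (fun r x => omegaLow g u r x i) (fun x => ψ x i)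
    fun x => κ x i :=
  ⟨(continuous_apply i).comp ha.cont_ψ, (continuous_apply i).comp ha.cont_κ, by
    simpa only [div_eq_mul_inv] using bigO_iff.1 (ha.expand_omega i)⟩

theorem jet_g00 : Jet (g00 g u) (fun x => 1 - 1 / 2 * tr (dot n u) x) fun x => -2 * M x := by
  refine ⟨continuous_const.sub (continuous_const.mul (continuous_tr ha.cont_ndot)),
    continuous_const.mul ha.cont_M, (bigO_iff.1 ha.expand_g00).congr_left fun z => ?_⟩
  simp only [sTrace, tr, dot]
  ring

omit ha in
theorem isBigO_inv_mul {k l : ℕ} {F : ℝ → S2 → ℝ} (h : BigO k F) (hkl : k + l = 2 ∨ k + l = 3) :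
    (fun z : ℝ × S2 => z.1⁻¹ ^ l * F z.1 z.2) =O[farField] fun z => z.1⁻¹ ^ 2 := by
  have h1 := (Asymptotics.isBigO_refl (fun z : ℝ × S2 => z.1⁻¹ ^ l) farField).mul (bigO_iff.1 h)
  rcases hkl with hkl | hkl
  · refine h1.congr_right fun z => ?_
    rw [← pow_add, add_comm l, hkl]
  · refine h1.trans ?_
    have h2 := (Asymptotics.isBigO_refl (fun z : ℝ × S2 => z.1⁻¹ ^ 2) farField).mul isBigO_inv_one
    refine h2.congr (fun z => ?_) fun z => mul_one _
    rw [← pow_succ, ← pow_add, add_comm l, hkl]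

theorem jet_gAB : MatJet (fun r x => (r ^ 2)⁻¹ • gAB g u r x) (fun x => -tangentProj x) (n u) := by
  intro i j
  refine ⟨(continuous_tangentProj.neg).matrix_elem i j, ha.cont_n.matrix_elem i j, ?_⟩
  have h1 := isBigO_inv_mul (l := 2) (ha.expand_gAB i j) (Or.inr rfl)
  have h2 : (fun z : ℝ × S2 => z.1⁻¹ ^ 2 * m u z.2 i j) =O[farField] fun z => z.1⁻¹ ^ 2 := by
    refine ((Asymptotics.isBigO_refl (fun z : ℝ × S2 => z.1⁻¹ ^ 2) farField).mul
      (isBigO_of_continuous (ha.cont_m.matrix_elem i j))).congr_right fun z => mul_one _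
  refine (h1.add h2).congr' ?_ EventuallyEq.rfl
  filter_upwards [eventually_pos_farField] with z hz
  simp only [Matrix.smul_apply, Matrix.neg_apply, smul_eq_mul]
  field_simp
  ring

theorem jet_gAB_radial : MatJet (fun r x => r⁻¹ • matDeriv (fun s => gAB g u s x) r)
    (fun x => (-2 : ℝ) • tangentProj x) (n u) := by
  intro i j
  refine ⟨(continuous_tangentProj.const_smul (-2 : ℝ)).matrix_elem i j,
    ha.cont_n.matrix_elem i j, ?_⟩
  have h1 := isBigO_inv_mul (l := 1) (ha.expand_gAB_r i j) (Or.inr rfl)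
  refine h1.congr' ?_ EventuallyEq.rfl
  filter_upwards [eventually_pos_farField] with z hz
  simp only [Matrix.smul_apply, smul_eq_mul]
  field_simp

theorem jet_gAB_time : MatJet (fun r x => r⁻¹ • matDeriv (fun v => gAB g v r x) u)
    (dot n u) (dot m u) := by
  intro i j
  refine ⟨Continuous.matrix_elem ha.cont_ndot i j, Continuous.matrix_elem ha.cont_mdot i j, ?_⟩
  have h1 := isBigO_inv_mul (l := 1) (ha.expand_gAB_u i j) (Or.inl rfl)
  refine h1.congr' ?_ EventuallyEq.rfl
  filter_upwards [eventually_pos_farField] with z hz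
  simp only [Matrix.smul_apply, smul_eq_mul, dot]
  field_simp

variable (hg : IsAffineBondi g I) (hI : IsOpen I) (hu : u ∈ I)
include hg hI hu

/-- The coefficient n is not assumed to be tangential. As P fixes g_AB, it may be replaced by P n,
the form in which the traces are evaluated. -/
theorem jet_tangent : MatJet (fun r x => (r ^ 2)⁻¹ • gAB g u r x) (fun x => -tangentProj x)
    fun x => tangentProj x * n u x := by
  refine (((MatJet.const continuous_tangentProj).mul ha.jet_gAB).congr ?_).of_eq (fun x => ?_)
    fun x => ?_
  · filter_upwards [eventually_gt_atTop 0] with r hr x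
    rw [mul_smul_comm, hg.tangentProj_mul_gAB hI hu hr]
  · rw [mul_neg, tangentProj_mul_self]
  · simp

theorem jet_tangent_radial : MatJet (fun r x => r⁻¹ • matDeriv (fun s => gAB g u s x) r)
    (fun x => (-2 : ℝ) • tangentProj x) fun x => tangentProj x * n u x := by
  refine (((MatJet.const continuous_tangentProj).mul ha.jet_gAB_radial).congr ?_).of_eq
    (fun x => ?_) fun x => ?_
  · filter_upwards [eventually_gt_atTop 0] with r hr x
    rw [mul_smul_comm, hg.tangentProj_mul_matDeriv_radial hI hu hr]
  · rw [mul_smul_comm, tangentProj_mul_self]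
  · simp

theorem jet_tangent_time : MatJet (fun r x => r⁻¹ • matDeriv (fun v => gAB g v r x) u)
    (fun x => tangentProj x * dot n u x) fun x => tangentProj x * dot m u x := by
  refine (((MatJet.const continuous_tangentProj).mul ha.jet_gAB_time).congr ?_).of_eq
    (fun x => rfl) fun x => ?_
  · filter_upwards [eventually_gt_atTop 0] with r hr x
    rw [mul_smul_comm, hg.tangentProj_mul_matDeriv_time hI hu hr]
  · simp

theorem jet_sigma_sq : Jet (fun r x => (sigma g u r x / r ^ 2) ^ 2) (fun _ => 1)
    fun x => -tr (n u) x := by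
  have h := ha.jet_tangent hg hI hu
  refine ((((h.trace.mul h.trace).sub (h.mul h).trace).const_mul (1 / 2)).congr ?_).of_eq
    (fun x => ?_) fun x => ?_
  · filter_upwards [eventually_gt_atTop 0] with r hr x
    rw [div_pow, hg.sigma_sq hI hu hr]
    simp only [trace_smul, smul_mul_smul_comm, smul_eq_mul]
    field_simp
  · simp only [trace_neg, neg_mul_neg, tangentProj_mul_self, trace_tangentProj]
    norm_num
  · simp only [trace_neg, Matrix.neg_mul, Matrix.mul_neg, trace_add, trace_tangentProj_mul,
      trace_mul_tangentProj, trace_tangentProj]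
    rw [← tr]
    ring

theorem jet_sigma : Jet (fun r x => sigma g u r x / r ^ 2) (fun _ => 1)
    fun x => -tr (n u) x / 2 := by
  refine ((ha.jet_sigma_sq hg hI hu).sqrt fun _ => rfl).congr ?_
  filter_upwards [eventually_gt_atTop 0] with r hr x
  have := hg.sigma_pos hI hu hr x
  exact Real.sqrt_sq (by positivity)

theorem jet_sigma_sq_radial : Jet (fun r x => 2 * sigma g u r x
    * deriv (fun s => sigma g u s x) r / r ^ 3) (fun _ => 4) fun x => -3 * tr (n u) x := by
  have h := ha.jet_tangent hg hI hu
  have h' := ha.jet_tangent_radial hg hI hu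
  refine (((h.trace.mul h'.trace).sub (h.mul h').trace).congr ?_).of_eq (fun x => ?_) fun x => ?_
  · filter_upwards [eventually_gt_atTop 0] with r hr x
    rw [hg.two_mul_sigma_radial hI hu hr]
    simp only [trace_smul, smul_mul_smul_comm, smul_eq_mul]
    field_simp
  · simp only [trace_neg, trace_smul, smul_eq_mul, mul_smul_comm, Matrix.neg_mul,
      tangentProj_mul_self, trace_tangentProj]
    norm_num
  · simp only [trace_neg, trace_smul, smul_eq_mul, mul_smul_comm, Matrix.neg_mul, trace_add,
      trace_tangentProj_mul, trace_mul_tangentProj, trace_tangentProj]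
    rw [← tr]
    ring

theorem jet_sigma_sq_time : Jet (fun r x => 2 * sigma g u r x
    * deriv (fun v => sigma g v r x) u / r ^ 3) (fun x => -tr (dot n u) x)
    fun x => tr (n u) x * tr (dot n u) x - tr (dot m u) x
      - (tangentProj x * n u x * (tangentProj x * dot n u x)).trace := by
  have h := ha.jet_tangent hg hI hu
  have h' := ha.jet_tangent_time hg hI hu
  refine (((h.trace.mul h'.trace).sub (h.mul h').trace).congr ?_).of_eq (fun x => ?_) fun x => ?_
  · filter_upwards [eventually_gt_atTop 0] with r hr x
    rw [hg.two_mul_sigma_time hI hu hr]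
    simp only [trace_smul, smul_mul_smul_comm, smul_eq_mul]
    field_simp
  · simp only [trace_neg, Matrix.neg_mul, trace_tangentProj_mul, trace_tangentProj]
    rw [← tr]
    ring
  · simp only [trace_neg, Matrix.neg_mul, trace_add, trace_tangentProj_mul, trace_tangentProj]
    rw [← tr, ← tr, ← tr]
    ring

theorem jet_sigma_radial : Jet (fun r x => deriv (fun s => sigma g u s x) r / r) (fun _ => 2)
    fun x => -tr (n u) x / 2 := by
  refine ((((ha.jet_sigma_sq_radial hg hI hu).mul ((ha.jet_sigma hg hI hu).inv one_pos
    fun _ => rfl)).const_mul (1 / 2)).congr ?_).of_eq (fun x => ?_) fun x => ?_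
  · filter_upwards [eventually_gt_atTop 0] with r hr x
    have := (hg.sigma_pos hI hu hr x).ne'
    field_simp
  · norm_num
  · ring

/-- The term −½ tr ṅ in the limit of g_00 is compensated by −2σ_{,u}/σ_{,r}, which tends to +½ tr ṅ.
The next order is the definition of `massAspect`. -/
theorem jet_g00Lum : Jet (g00Lum g u) (fun _ => 1) fun x => -2 * massAspect n m M u x := by
  have h := (ha.jet_sigma_sq_time hg hI hu).mul ((ha.jet_sigma_sq_radial hg hI hu).inv
    (by norm_num : (0 : ℝ) < 4) fun _ => rfl)
  refine ((ha.jet_g00.sub (h.const_mul 2)).congr ?_).of_eq (fun x => ?_) fun x => ?_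
  · filter_upwards [eventually_gt_atTop 0] with r hr x
    have h1 := (hg.sigma_pos hI hu hr x).ne'
    rw [hg.g00Lum_eq hI hu hr, ← div_eq_mul_inv, div_div_div_cancel_right₀ (by positivity),
      mul_div_mul_left _ _ (mul_ne_zero two_ne_zero h1)]
  · ring
  · rw [massAspect]
    ring

/-- ω_A is bounded and g^AB is O(r⁻²), so both coefficients vanish. -/
theorem jet_omega_sq : Jet (fun r x => omegaLow g u r x ⬝ᵥ omegaUp g u r x) 0 0 := by
  have hG := ha.jet_tangent hg hI hu
  have hD := (ha.jet_sigma_sq hg hI hu).inv one_pos fun _ => rfl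
  have hN : MatJet (fun r x => (r ^ 2)⁻¹ • gAB g u r x
      - ((r ^ 2)⁻¹ • gAB g u r x).trace • tangentProj x) _ _ := fun i j =>
    (hG i j).sub (hG.trace.mul (MatJet.const continuous_tangentProj i j))
  have hw : Jet (fun r x => ∑ i, omegaLow g u r x i * ∑ j, ((r ^ 2)⁻¹ • gAB g u r x
      - ((r ^ 2)⁻¹ • gAB g u r x).trace • tangentProj x) i j * omegaLow g u r x j) _ _ :=
    Jet.sum fun i => (ha.jet_omegaLow i).mul
      (Jet.sum fun j => (hN i j).mul (ha.jet_omegaLow j))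
  refine ((hD.mul hw).const_mul (-1)).smul_inv_sq.congr ?_
  filter_upwards [eventually_gt_atTop 0] with r hr x
  have h1 := hg.sigma_pos hI hu hr x
  have h2 : (sigma g u r x / r ^ 2) ^ 2 ≠ 0 := by positivity
  change _ * (-1 * (_ * (omegaLow g u r x ⬝ᵥ ((r ^ 2)⁻¹ • gAB g u r x
      - ((r ^ 2)⁻¹ • gAB g u r x).trace • tangentProj x) *ᵥ omegaLow g u r x))) = _
  rw [← hg.sigma_div_sq_smul_invMetric hI hu hr, omegaUp, hg.gABinv_eq hI hu hr, smul_mulVec,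
    dotProduct_smul, neg_mulVec, dotProduct_neg, smul_mulVec, dotProduct_smul, smul_eq_mul,
    smul_eq_mul, inv_mul_cancel_left₀ h2, inv_pow]
  ring

theorem eventually_sigma_radial_pos :
    ∀ᶠ r in atTop, ∀ x, 0 < deriv (fun s => sigma g u s x) r := by
  filter_upwards [(ha.jet_sigma_radial hg hI hu).eventually_lt (k := 0) two_pos fun x => by simp,
    eventually_gt_atTop 0] with r hr hr0 x
  have := hr x
  rwa [lt_div_iff₀ hr0, zero_mul] at this

/-- Through g'_00 the time derivative of σ disappears and the potential is 4r − σ_{,r}(r²/σ + g'_00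
− ω_Aω^A). The leading terms 4 cancel, and so do the contributions of tr n at the next order; only
the mass aspect is left. -/
theorem jet_conePotential : Jet (fun r x => conePotential g u r x / r) 0
    fun x => 4 * massAspect n m M u x := by
  have h := (ha.jet_sigma_radial hg hI hu).mul ((((ha.jet_sigma hg hI hu).inv one_pos
    fun _ => rfl).add (ha.jet_g00Lum hg hI hu)).sub (ha.jet_omega_sq hg hI hu))
  refine (((Jet.const (a := fun _ => 4) continuous_const).sub h).congr ?_).of_eq (fun x => ?_)
    fun x => ?_
  · filter_upwards [eventually_gt_atTop 0, ha.eventually_sigma_radial_pos hg hI hu] with r hr hs x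
    have h1 := (hg.sigma_pos hI hu hr x).ne'
    have h2 := (hs x).ne'
    rw [hg.g00Lum_eq hI hu hr, conePotential]
    field_simp
    ring
  · norm_num
  · simp only [Pi.zero_apply]
    ring

theorem tendsto_conePotential : Tendsto (fun z : ℝ × S2 => conePotential g u z.1 z.2
    - 4 * massAspect n m M u z.2) farField (𝓝 0) := by
  have h := (Asymptotics.isBigO_refl (fun z : ℝ × S2 => z.1) farField).mul
    (ha.jet_conePotential hg hI hu).isBigO
  refine (h.congr' ?_ ?_).trans_tendsto tendsto_inv_farField
  · filter_upwards [eventually_pos_farField] with z hz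
    simp only [Pi.zero_apply]
    field_simp
    ring
  · filter_upwards [eventually_pos_farField] with z hz
    field_simp

end IsAsymptotic

/-! ## The energy and the limits of the potential -/

namespace IsAsymptotic

variable {g : V4 → M4} {I : Set ℝ} {u : ℝ} {ψ κ : S2 → Fin 3 → ℝ} {n m : ℝ → S2 → M3} {M : S2 → ℝ}
  (ha : IsAsymptotic g u ψ κ n m M) (hg : IsAffineBondi g I) (hI : IsOpen I) (hu : u ∈ I)
include ha hg hI hu

theorem continuous_massAspect : Continuous (massAspect n m M u) := by
  have h := (ha.jet_conePotential hg hI hu).cont_snd.const_mul (1 / 4)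
  refine h.congr fun x => ?_
  ring

theorem jet_lumDist : Jet (fun r x => lumDist g u r x / r) (fun _ => 1)
    fun x => -tr (n u) x / 2 / 2 := by
  refine ((ha.jet_sigma hg hI hu).sqrt fun _ => rfl).congr ?_
  filter_upwards [eventually_gt_atTop 0] with r hr x
  rw [Real.sqrt_div' _ (by positivity), Real.sqrt_sq hr.le, lumDist]

theorem isBigO_g00Lum : (fun z : ℝ × S2 => g00Lum g u z.1 z.2
    - (1 - 2 * massAspect n m M u z.2 / lumDist g u z.1 z.2)) =O[farField]
      fun z => (lumDist g u z.1 z.2 ^ 2)⁻¹ := by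
  have hl := ha.jet_lumDist hg hI hu
  have hi := hl.inv one_pos fun _ => rfl
  have h1 := (isBigO_of_continuous (ha.continuous_massAspect hg hI hu)).mul
    ((Asymptotics.isBigO_refl (fun z : ℝ × S2 => z.1⁻¹) farField).mul hi.isBigO_sub_fst)
  have h2 : (fun z : ℝ × S2 => z.1⁻¹ ^ 2) =O[farField] fun z => (lumDist g u z.1 z.2 ^ 2)⁻¹ := by
    have h := ((Asymptotics.isBigO_refl
      (fun z : ℝ × S2 => (lumDist g u z.1 z.2 ^ 2)⁻¹) farField).mul hl.isBigO_one).mul hl.isBigO_one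
    refine h.congr' ?_ (Eventually.of_forall fun z => by simp)
    filter_upwards [eventually_pos_farField] with z hz
    have := Real.sqrt_pos.2 (hg.sigma_pos hI hu hz z.2)
    rw [← lumDist] at this
    field_simp
  refine (((ha.jet_g00Lum hg hI hu).isBigO.add ((h1.const_mul_left 2).congr_right
    fun z => ?_)).trans h2).congr' ?_ EventuallyEq.rfl
  · ring
  · filter_upwards [eventually_pos_farField] with z hz
    have := Real.sqrt_pos.2 (hg.sigma_pos hI hu hz z.2)
    rw [← lumDist] at this
    field_simp
    ring

theorem isBondiMassAspect : IsBondiMassAspect g u (massAspect n m M u) := by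
  refine ⟨ha.continuous_massAspect hg hI hu, ?_⟩
  obtain ⟨C, hC⟩ := (ha.isBigO_g00Lum hg hI hu).bound
  have hC' := (eventually_prod_top (p := fun r x => ‖g00Lum g u r x
    - (1 - 2 * massAspect n m M u x / lumDist g u r x)‖ ≤ C * ‖(lumDist g u r x ^ 2)⁻¹‖)).1 hC
  obtain ⟨R, hR⟩ := eventually_atTop.1 (hC'.and (ha.eventually_sigma_radial_pos hg hI hu))
  refine ⟨C, max R 1, by positivity, fun r hr x => ?_⟩
  have hr0 : 0 < r := lt_of_lt_of_le (by positivity) hr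
  obtain ⟨h1, h2⟩ := hR r ((le_max_left _ _).trans hr)
  have hl : 0 < lumDist g u r x := Real.sqrt_pos.2 (hg.sigma_pos hI hu hr0 x)
  have h3 := h2 x
  refine ⟨hl, ?_, ?_⟩
  · rw [(hg.hasDerivAt_lumDist hI hu hr0 x).deriv]
    positivity
  · have h4 := h1 x
    rwa [Real.norm_eq_abs, norm_inv, norm_pow, Real.norm_eq_abs, abs_of_pos hl,
      ← div_eq_mul_inv] at h4

theorem tendsto_lumDist (x : S2) : Tendsto (fun r => lumDist g u r x) atTop atTop := by
  have h : Tendsto (fun r => lumDist g u r x / r) atTop (𝓝 1) := by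
    have h0 := (ha.jet_lumDist hg hI hu).tendsto_sub.comp
      ((tendsto_id (α := ℝ) (x := atTop)).prodMk (tendsto_top (f := fun _ : ℝ => x)))
    simpa using h0.add_const 1
  refine (h.pos_mul_atTop one_pos tendsto_id).congr' ?_
  filter_upwards [eventually_gt_atTop 0] with r hr
  simp only [id]
  field_simp

/-- Two mass aspects differ by O(1/r') and r' → ∞ along each ray. Uniqueness makes the energy well
defined. -/
theorem eq_massAspect {M' : S2 → ℝ} (h : IsBondiMassAspect g u M') :
    M' = massAspect n m M u := by
  obtain ⟨-, C₁, R₁, -, h1⟩ := h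
  obtain ⟨-, C₂, R₂, -, h2⟩ := ha.isBondiMassAspect hg hI hu
  funext x
  have hb : ∀ᶠ r in atTop, |M' x - massAspect n m M u x|
      ≤ (C₁ + C₂) / 2 * (lumDist g u r x)⁻¹ := by
    filter_upwards [eventually_ge_atTop R₁, eventually_ge_atTop R₂] with r hr1 hr2
    obtain ⟨hl, -, e1⟩ := h1 r hr1 x
    obtain ⟨-, -, e2⟩ := h2 r hr2 x
    set L := lumDist g u r x
    have e3 := (abs_sub _ _).trans (add_le_add e1 e2)
    have e4 : g00Lum g u r x - (1 - 2 * M' x / L) - (g00Lum g u r x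
        - (1 - 2 * massAspect n m M u x / L)) = (2 / L) * (M' x - massAspect n m M u x) := by ring
    rw [e4, abs_mul, abs_of_pos (by positivity)] at e3
    have e5 := mul_le_mul_of_nonneg_left e3 (by positivity : 0 ≤ L / 2)
    calc _ = L / 2 * (2 / L * |M' x - massAspect n m M u x|) := by field_simp
      _ ≤ _ := e5
      _ = _ := by field_simp
  have hlim : Tendsto (fun r => (C₁ + C₂) / 2 * (lumDist g u r x)⁻¹) atTop (𝓝 0) := by
    simpa using ((ha.tendsto_lumDist hg hI hu x).inv_tendsto_atTop).const_mul ((C₁ + C₂) / 2)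
  have := ge_of_tendsto hlim hb
  exact sub_eq_zero.1 (abs_eq_zero.1 (le_antisymm this (abs_nonneg _)))

end IsAsymptotic

theorem tendsto_integral_of_uniform {l : Filter ℝ} [l.IsCountablyGenerated] {F : ℝ → S2 → ℝ}
    {L : S2 → ℝ} (hF : ∀ᶠ r in l, Integrable (F r) sphereArea) (hL : Integrable L sphereArea)
    (h : Tendsto (fun z : ℝ × S2 => F z.1 z.2 - L z.2) (l ×ˢ ⊤) (𝓝 0)) :
    Tendsto (fun r => ∫ x, F r x ∂sphereArea) l (𝓝 (∫ x, L x ∂sphereArea)) := by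
  have h0 : Tendsto (fun r => ∫ x, F r x - L x ∂sphereArea) l (𝓝 (∫ _, (0 : ℝ) ∂sphereArea)) := by
    refine tendsto_integral_filter_of_dominated_convergence (fun _ => 1)
      (hF.mono fun r hr => (hr.sub hL).aestronglyMeasurable) ?_ (integrable_const 1)
      (Eventually.of_forall fun x => ?_)
    · refine (eventually_prod_top (p := fun r x => ‖F r x - L x‖ ≤ 1)).1 ?_ |>.mono
        fun r hr => Eventually.of_forall hr
      filter_upwards [h.eventually (Metric.closedBall_mem_nhds 0 one_pos)] with z hz
      simpa using hz
    · exact h.comp ((tendsto_id (α := ℝ) (x := l)).prodMk (tendsto_top (f := fun _ : ℝ => x)))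
  rw [integral_zero] at h0
  have h1 := h0.add_const (∫ x, L x ∂sphereArea)
  rw [zero_add] at h1
  refine h1.congr' ?_
  filter_upwards [hF] with r hr
  rw [integral_sub hr hL, sub_add_cancel]

theorem IsAsymptotic.tendsto_integral_conePotential {g : V4 → M4} {I : Set ℝ} {u : ℝ}
    {ψ κ : S2 → Fin 3 → ℝ} {n m : ℝ → S2 → M3} {M : S2 → ℝ} (ha : IsAsymptotic g u ψ κ n m M)
    (hg : IsAffineBondi g I) (hI : IsOpen I) (hu : u ∈ I) :
    Tendsto (fun r => ∫ x, conePotential g u r x ∂sphereArea) atTop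
      (𝓝 (4 * ∫ x, massAspect n m M u x ∂sphereArea)) := by
  rw [← integral_const_mul]
  refine tendsto_integral_of_uniform ?_ ?_ (ha.tendsto_conePotential hg hI hu)
  · filter_upwards [eventually_gt_atTop 0] with r hr
    exact hg.conePotential_integrable hI hu hr
  · exact (continuous_const.mul (ha.continuous_massAspect hg hI hu)).integrable_of_hasCompactSupport
      (HasCompactSupport.of_compactSpace _)

theorem tendsto_prod_of_uniform {l : Filter ℝ} {F : ℝ → S2 → ℝ}
    (h : TendstoUniformly F (fun _ => 0) l) :
    Tendsto (fun z : ℝ × S2 => F z.1 z.2) (l ×ˢ ⊤) (𝓝 0) := by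
  rw [Metric.tendsto_nhds]
  intro ε hε
  refine (eventually_prod_top (p := fun r x => dist (F r x) 0 < ε)).2 ?_
  filter_upwards [Metric.tendstoUniformly_iff.1 h ε hε] with r hr x
  rw [dist_comm]
  exact hr x

/-- The only singular looking term, r²σ_{,r}/σ, is σ_{,r} divided by r⁻²σ, which stays away from
zero; every other term tends to zero by the vertex conditions. -/
theorem IsVertexRegular.tendsto_integral_conePotential {g : V4 → M4} {I : Set ℝ} {u : ℝ}
    (hv : IsVertexRegular g u) (hg : IsAffineBondi g I) (hI : IsOpen I) (hu : u ∈ I) :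
    Tendsto (fun r => ∫ x, conePotential g u r x ∂sphereArea) (𝓝[>] 0) (𝓝 0) := by
  have hpos : ∀ᶠ r : ℝ in 𝓝[>] 0, 0 < r := self_mem_nhdsWithin
  set l : Filter (ℝ × S2) := 𝓝[>] (0 : ℝ) ×ˢ ⊤ with hl
  have h1 : Tendsto (fun z : ℝ × S2 => z.1) l (𝓝 0) :=
    tendsto_fst.mono_right nhdsWithin_le_nhds
  have h2 := tendsto_prod_of_uniform hv.sigma_u
  have h3 := tendsto_prod_of_uniform hv.sigma_r
  have h4 : (fun z : ℝ × S2 => (sigma g u z.1 z.2 / z.1 ^ 2)⁻¹) =O[l] fun _ => (1 : ℝ) := by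
    obtain ⟨L, hLc, hL0, hL⟩ := hv.sigma_lim
    obtain ⟨C, hC⟩ := isCompact_univ.exists_bound_of_continuousOn
      (f := fun x => (L x)⁻¹) (hLc.inv₀ hL0).continuousOn
    -- Compactness of the sphere bounds 1/L; |C| + 1 in place of C keeps the bound positive.
    have hC1 : ∀ x, (|C| + 1)⁻¹ ≤ |L x| := fun x => by
      have h := hC x trivial
      rw [norm_inv, Real.norm_eq_abs] at h
      rw [inv_le_comm₀ (by positivity) (abs_pos.2 (hL0 x))]
      linarith [le_abs_self C]
    refine Asymptotics.IsBigO.of_bound (2 * (|C| + 1)) ?_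
    refine (eventually_prod_top (p := fun r x => ‖(sigma g u r x / r ^ 2)⁻¹‖
      ≤ 2 * (|C| + 1) * ‖(1 : ℝ)‖)).2 ?_
    have hδ : 0 < (|C| + 1)⁻¹ / 2 := by positivity
    filter_upwards [Metric.tendstoUniformly_iff.1 hL _ hδ] with r hr x
    have h5 := hr x
    rw [Real.dist_eq] at h5
    have h6 : (|C| + 1)⁻¹ / 2 ≤ |sigma g u r x / r ^ 2| := by
      have := abs_sub_abs_le_abs_sub (L x) (sigma g u r x / r ^ 2)
      linarith [hC1 x]
    rw [norm_inv, Real.norm_eq_abs, norm_one, mul_one]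
    calc _ ≤ ((|C| + 1)⁻¹ / 2)⁻¹ := inv_anti₀ hδ h6
      _ = _ := by rw [inv_div, div_inv_eq_mul]
  have h5 : (fun z : ℝ × S2 => g00 g u z.1 z.2 - omegaLow g u z.1 z.2 ⬝ᵥ omegaUp g u z.1 z.2)
      =O[l] fun _ => (1 : ℝ) := by
    obtain ⟨C, hC⟩ := hv.bounded
    refine Asymptotics.IsBigO.of_bound C ?_
    filter_upwards [eventually_prod_top.2 hC] with z hz
    simpa using hz
  have h6 : Tendsto (fun z : ℝ × S2 => (sigma g u z.1 z.2 / z.1 ^ 2)⁻¹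
      * deriv (fun s => sigma g u s z.2) z.1) l (𝓝 0) := by
    have := h4.mul (Asymptotics.isBigO_refl
      (fun z : ℝ × S2 => deriv (fun s => sigma g u s z.2) z.1) l)
    exact (this.congr_right fun z => one_mul _).trans_tendsto h3
  have h7 : Tendsto (fun z : ℝ × S2 => (g00 g u z.1 z.2 - omegaLow g u z.1 z.2
      ⬝ᵥ omegaUp g u z.1 z.2) * deriv (fun s => sigma g u s z.2) z.1) l (𝓝 0) := by
    have := h5.mul (Asymptotics.isBigO_refl
      (fun z : ℝ × S2 => deriv (fun s => sigma g u s z.2) z.1) l)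
    exact (this.congr_right fun z => one_mul _).trans_tendsto h3
  have h8 := (((h1.const_mul 4).sub h6).add (h2.const_mul 2)).sub h7
  have h9 := tendsto_integral_of_uniform (l := 𝓝[>] (0 : ℝ)) (F := conePotential g u)
    (L := fun _ => 0) (hpos.mono fun r hr => hg.conePotential_integrable hI hu hr)
    (integrable_zero _ _ _) (by
      simp only [mul_zero, sub_zero, add_zero] at h8 ⊢
      refine h8.congr fun z => ?_
      rw [conePotential, inv_div]
      ring)
  simpa using h9

/-! ## Signs of the integrands -/

theorem trace_mul_self_nonneg {S : M3} (hS : Sᵀ = S) : 0 ≤ (S * S).trace := by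
  refine Finset.sum_nonneg fun i _ => ?_
  rw [diag_apply, Matrix.mul_apply]
  refine Finset.sum_nonneg fun j _ => ?_
  rw [← congrFun (congrFun hS i) j, transpose_apply]
  exact mul_self_nonneg _

namespace BondiChart

variable {g : V4 → M4} {U : Set V4} (hg : BondiChart g U) {p : V4} (hp : p ∈ U)
include hg hp

theorem sp_nonpos (z : Fin 3 → ℝ) : z ⬝ᵥ sp (g p) *ᵥ z ≤ 0 := by
  set x := dir p with hx
  set e := z - (x ⬝ᵥ z) • x with he
  have h1 : z ⬝ᵥ sp (g p) *ᵥ z = e ⬝ᵥ sp (g p) *ᵥ e := by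
    rw [he, mulVec_sub, mulVec_smul, hg.radial p hp, smul_zero, sub_zero, sub_dotProduct,
      smul_dotProduct, dotProduct_mulVec x, hg.radial' hp]
    simp
  rw [h1]
  by_cases h0 : e = 0
  · rw [h0]; simp
  · refine (hg.negDef p hp e ?_ h0).le
    rw [he, sub_dotProduct, smul_dotProduct, hg.dir_unit hp, dotProduct_comm z]
    simp [hx]

theorem radialDeriv_symm : (radialDeriv g p)ᵀ = radialDeriv g p := by
  ext i j
  simp only [radialDeriv, transpose_apply, Matrix.of_apply]
  congr 1
  refine Filter.EventuallyEq.fderiv_eq ?_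
  filter_upwards [hg.isOpen.mem_nhds hp] with q hq
  exact (hg.symm q hq).apply _ _

/-- With B the symmetric root of N the trace is that of the square of the symmetric matrix B G' B.
-/
theorem trace_shear_nonneg :
    0 ≤ (invMetric g p * radialDeriv g p * invMetric g p * radialDeriv g p).trace := by
  set B := rootMetric g p with hB
  set G := radialDeriv g p with hG
  have hS : (B * G * B)ᵀ = B * G * B := by
    rw [transpose_mul, transpose_mul, hg.rootMetric_symm hp, hg.radialDeriv_symm hp,
      Matrix.mul_assoc]
  have h := trace_mul_self_nonneg hS
  rw [← hg.rootMetric_mul_self hp, ← hB]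
  calc 0 ≤ (B * G * B * (B * G * B)).trace := h
    _ = (B * (G * B * B * G * B)).trace := by simp only [Matrix.mul_assoc]
    _ = (G * (B * B * G * (B * B))).trace := by rw [trace_mul_comm]; simp only [Matrix.mul_assoc]
    _ = _ := by rw [trace_mul_comm]

/-- In T − g^AB T_AB the tangential parts cancel and 2 T(k, l) remains, which is what the dominant
energy condition controls. -/
theorem trace_inv_mul {T : M4} (hT : T.IsSymm) : ((g p)⁻¹ * T).trace
    = 2 * val T (kVec p) (lVec g p) - ∑ a, val T (eVec g a p) (eVec g a p) := by
  have h : ∀ a b : V4, (vecMulVec a b * T).trace = val T b a := fun a b => by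
    rw [vecMulVec_mul, trace_vecMulVec, dotProduct_comm, ← dotProduct_mulVec, val]
  rw [hg.inv_eq hp, sub_mul, add_mul, trace_sub, trace_add, h, h, Finset.sum_mul, trace_sum,
    val_comm hT (lVec g p)]
  simp only [h]
  ring

/-- The part of w tangent to the spheres contributes minus a sum of squares. -/
theorem val_self_le (w : V4) :
    val (g p) w w ≤ 2 * (val (g p) w (kVec p) * val (g p) w (lVec g p)) := by
  have h := congrArg (fun v => val (g p) v w) ((hg.resolution hp).expand w)
  simp only [val_sub_left, val_add_left, val_smul_left, val_sum_left] at h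
  simp only [val_comm (hg.symm p hp) (kVec p) w, val_comm (hg.symm p hp) (lVec g p) w,
    val_comm (hg.symm p hp) (eVec g _ p) w] at h
  have h1 : 0 ≤ ∑ a, val (g p) w (eVec g a p) * val (g p) w (eVec g a p) :=
    Finset.sum_nonneg fun a _ => mul_self_nonneg _
  linarith

theorem val_inv_mulVec (T : M4) (v y : V4) :
    val (g p) y (((g p)⁻¹ * T) *ᵥ v) = val T y v := by
  rw [val, mulVec_mulVec, ← Matrix.mul_assoc, mul_nonsing_inv _ (hg.det_ne hp).isUnit, one_mul, val]

/-- The dominant energy condition in the null directions of the frame. -/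
theorem null_energy {T : M4} (hT : T.IsSymm)
    (h : ∀ v : V4, 0 < val (g p) v v → 0 ≤ val T v v ∧
      0 ≤ val (g p) (((g p)⁻¹ * T) *ᵥ v) (((g p)⁻¹ * T) *ᵥ v)) :
    0 ≤ val T (kVec p) (kVec p) ∧ 0 ≤ val T (kVec p) (lVec g p) := by
  set k := kVec p with hk
  set l := lVec g p with hl
  have hgs := hg.symm p hp
  have e : ∀ (A : M4), A.IsSymm → ∀ ε : ℝ, val A (k + ε • l) (k + ε • l)
      = val A k k + 2 * ε * val A k l + ε ^ 2 * val A l l := fun A hA ε => by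
    rw [val_add_left, val_smul_left, val_comm hA k, val_comm hA l (k + ε • l), val_add_left,
      val_add_left, val_smul_left, val_smul_left, val_comm hA l k]
    ring
  have el : ∀ ε : ℝ, val T l (k + ε • l) = val T k l + ε * val T l l := fun ε => by
    rw [val_comm hT, val_add_left, val_smul_left]
  have hpos : ∀ ε : ℝ, 0 < ε → 0 < val (g p) (k + ε • l) (k + ε • l) := fun ε hε => by
    rw [e _ hgs, hg.val_kVec_kVec hp, hg.val_lVec_lVec hp, val_comm hgs k, hg.val_lVec_kVec hp]
    linarith
  have h1 : ∀ᶠ ε : ℝ in 𝓝[>] 0, 0 ≤ val T k k + 2 * ε * val T k l + ε ^ 2 * val T l l := by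
    filter_upwards [self_mem_nhdsWithin] with ε hε
    rw [← e T hT]
    exact (h _ (hpos ε hε)).1
  -- For v = k + εl let w be the vector T^α_β v^β. Since w is not spacelike, g(k, w) g(l, w) ≥ 0;
  -- positivity of T(v, v) gives g(k, w) + ε g(l, w) ≥ 0. Hence g(l, w) = T(l, v) cannot be
  -- negative, and ε → 0 yields the sign of T(k, l).
  have h2 : ∀ᶠ ε : ℝ in 𝓝[>] 0, 0 ≤ val T k l + ε * val T l l := by
    filter_upwards [self_mem_nhdsWithin] with ε hε
    obtain ⟨hv, hw⟩ := h _ (hpos ε hε)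
    rw [← hg.val_inv_mulVec hp, val_add_left, val_smul_left] at hv
    set w := ((g p)⁻¹ * T) *ᵥ (k + ε • l) with hwdef
    have hq := hw.trans (hg.val_self_le hp w)
    rw [← hk, ← hl, val_comm hgs w k, val_comm hgs w l] at hq
    rw [← el, ← hg.val_inv_mulVec hp, ← hwdef]
    by_contra hneg
    push Not at hneg
    have hε' : 0 < ε := hε
    have hk0 : 0 < val (g p) k w := by nlinarith
    nlinarith
  have c1 : Tendsto (fun ε : ℝ => val T k k + 2 * ε * val T k l + ε ^ 2 * val T l l) (𝓝[>] 0)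
      (𝓝 (val T k k)) := by
    have : Continuous fun ε : ℝ => val T k k + 2 * ε * val T k l + ε ^ 2 * val T l l := by fun_prop
    simpa using this.continuousAt.tendsto.mono_left (nhdsWithin_le_nhds (a := (0 : ℝ)))
  have c2 : Tendsto (fun ε : ℝ => val T k l + ε * val T l l) (𝓝[>] 0) (𝓝 (val T k l)) := by
    have : Continuous fun ε : ℝ => val T k l + ε * val T l l := by fun_prop
    simpa using this.continuousAt.tendsto.mono_left (nhdsWithin_le_nhds (a := (0 : ℝ)))
  exact ⟨ge_of_tendsto c1 h1, ge_of_tendsto c2 h2⟩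

end BondiChart

namespace IsAffineBondi

variable {g T : V4 → M4} {I : Set ℝ} (hg : IsAffineBondi g I) (hI : IsOpen I) {u : ℝ} (hu : u ∈ I)
include hg hI hu

theorem geomDensity_nonneg {r : ℝ} (hr : 0 < r) (x : S2) : 0 ≤ geomDensity g u r x := by
  have hp := pt_mem hu hr x
  have hc := hg.chart hI
  rw [hg.geomDensity_eq hI hu hr]
  have h1 := hc.trace_shear_nonneg hp
  have h2 := hc.sp_nonpos hp (twist g (pt u r x))
  have h3 := hc.rho_pos hp
  have h4 : 0 ≤ -(1 / 2 * (r ^ 2 * rho g (pt u r x))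
      * (twist g (pt u r x) ⬝ᵥ sp (g (pt u r x)) *ᵥ twist g (pt u r x))) := by
    rw [← mul_neg]
    exact mul_nonneg (by positivity) (neg_nonneg.2 h2)
  have h5 : 0 ≤ r ^ 2 * (1 / 4 * (invMetric g (pt u r x) * radialDeriv g (pt u r x)
    * invMetric g (pt u r x) * radialDeriv g (pt u r x)).trace) := by positivity
  linarith

theorem matterDensity_nonneg (hT : ∀ r > 0, ∀ x, (T (pt u r x)).IsSymm)
    (hD : DominantEnergy g T u) {r : ℝ} (hr : 0 < r) (x : S2) : 0 ≤ matterDensity g T u r x := by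
  have hp := pt_mem hu hr x
  have hc := hg.chart hI
  obtain ⟨h1, h2⟩ := hc.null_energy hp (hT r hr x) (hD r hr x)
  have h3 := hg.sigma_pos hI hu hr x
  rw [matterDensity, comp11, ← kVec_pt u hr, hg.angTrace_eq hI hu hr, fullTrace,
    hc.trace_inv_mul hp (hT r hr x), sub_neg_eq_add, sub_add_cancel]
  positivity

end IsAffineBondi

/-! ## Improper integrals -/

theorem aecover_inv_succ : AECover (volume.restrict (Set.Ioi (0 : ℝ))) atTop
    fun n : ℕ => Set.Ioc ((n : ℝ) + 1)⁻¹ ((n : ℝ) + 1) := by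
  have ha : Tendsto (fun n : ℕ => ((n : ℝ) + 1)⁻¹) atTop (𝓝 0) := by
    simpa using tendsto_one_div_add_atTop_nhds_zero_nat (𝕜 := ℝ)
  have hb : Tendsto (fun n : ℕ => (n : ℝ) + 1) atTop atTop :=
    tendsto_atTop_add_const_right _ _ tendsto_natCast_atTop_atTop
  exact (aecover_Ioi_of_Ioi ha).inter (aecover_Iic hb)

theorem tendsto_inv_succ : Tendsto (fun n : ℕ => (((n : ℝ) + 1)⁻¹, (n : ℝ) + 1)) atTop
    (𝓝[>] 0 ×ˢ atTop) := by
  refine Tendsto.prodMk (tendsto_nhdsWithin_iff.2 ⟨?_, Eventually.of_forall fun n => ?_⟩)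
    (tendsto_atTop_add_const_right _ _ tendsto_natCast_atTop_atTop)
  · simpa using tendsto_one_div_add_atTop_nhds_zero_nat (𝕜 := ℝ)
  · change (0 : ℝ) < ((n : ℝ) + 1)⁻¹
    positivity

theorem setIntegral_inv_succ (f : ℝ → ℝ) (n : ℕ) :
    ∫ r in Set.Ioc ((n : ℝ) + 1)⁻¹ ((n : ℝ) + 1), f r ∂volume.restrict (Set.Ioi 0)
      = ∫ r in ((n : ℝ) + 1)⁻¹..((n : ℝ) + 1), f r := by
  have h1 : (1 : ℝ) ≤ (n : ℝ) + 1 := by linarith [n.cast_nonneg (α := ℝ)]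
  have h0 : (0 : ℝ) < ((n : ℝ) + 1)⁻¹ := by positivity
  have hsub : Set.Ioc ((n : ℝ) + 1)⁻¹ ((n : ℝ) + 1) ⊆ Set.Ioi 0 := fun s hs => h0.trans hs.1
  rw [intervalIntegral.integral_of_le ((inv_le_one_of_one_le₀ h1).trans h1),
    Measure.restrict_restrict measurableSet_Ioc, Set.inter_eq_left.2 hsub]

/-- For a non-negative function, convergence along one exhausting sequence of intervals already
gives integrability. -/
theorem integrableOn_of_tendsto {f : ℝ → ℝ} (hf : ContinuousOn f (Set.Ioi 0))
    (h0 : ∀ r > 0, 0 ≤ f r) {L : ℝ}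
    (h : Tendsto (fun n : ℕ => ∫ r in ((n : ℝ) + 1)⁻¹..((n : ℝ) + 1), f r) atTop (𝓝 L)) :
    IntegrableOn f (Set.Ioi 0) := by
  refine aecover_inv_succ.integrable_of_integral_tendsto_of_nonneg_ae L (fun n => ?_)
    ((ae_restrict_iff' measurableSet_Ioi).2 (Eventually.of_forall h0)) ?_
  · have h2 : (0 : ℝ) < ((n : ℝ) + 1)⁻¹ := by positivity
    have hsub : Set.Icc ((n : ℝ) + 1)⁻¹ ((n : ℝ) + 1) ⊆ Set.Ioi 0 := fun s hs => h2.trans_le hs.1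
    have h3 := ((hf.mono hsub).integrableOn_Icc (μ := volume)).mono_set Set.Ioc_subset_Icc_self
    rw [IntegrableOn, Measure.restrict_restrict measurableSet_Ioc,
      Set.inter_eq_left.2 (Set.Ioc_subset_Icc_self.trans hsub)]
    exact h3
  · exact h.congr fun n => (setIntegral_inv_succ f n).symm

theorem tendsto_of_integrableOn {f : ℝ → ℝ} (hf : IntegrableOn f (Set.Ioi 0)) :
    Tendsto (fun n : ℕ => ∫ r in ((n : ℝ) + 1)⁻¹..((n : ℝ) + 1), f r) atTop
      (𝓝 (∫ r in Set.Ioi 0, f r)) :=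
  (aecover_inv_succ.integral_tendsto_of_countably_generated hf).congr fun n =>
    setIntegral_inv_succ f n

end NullCone

end

/-! ### The energy formula and its consequences -/

open NullCone in
theorem proposition3p1 (g T : V4 → M4) (I : Set ℝ) (hI : IsOpen I) (u : ℝ) (hu : u ∈ I)
    (ψ κ : S2 → Fin 3 → ℝ) (n m : ℝ → S2 → M3) (M : S2 → ℝ)
    (hg : IsAffineBondi g I)
    (hasym : IsAsymptotic g u ψ κ n m M)
    (hvertex : IsVertexRegular g u)
    (hT : ∀ r > 0, ∀ x, (T (pt u r x)).IsSymm)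
    (hE : EinsteinEqs g T u) :
    (∃ E, IsTrautmanBondiEnergy g u E) ∧
    ∀ E, IsTrautmanBondiEnergy g u E →
      -- the geometric terms are non-negative
      (∀ r > 0, ∀ x, 0 ≤ geomDensity g u r x) ∧
      -- the formula, with the integral over `0 < r < ∞` as an improper integral
      Tendsto (fun p : ℝ × ℝ =>
          (∫ r in p.1..p.2, geomFlux g u r) + ∫ r in p.1..p.2, matterFlux g T u r)
        (𝓝[>] 0 ×ˢ atTop) (𝓝 (16 * Real.pi * E)) ∧
      -- the formula with two separate integrals, as soon as the matter terms are integrable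
      (IntegrableOn (matterFlux g T u) (Set.Ioi 0) →
        IntegrableOn (geomFlux g u) (Set.Ioi 0) ∧
        16 * Real.pi * E =
          (∫ r in Set.Ioi 0, geomFlux g u r) + ∫ r in Set.Ioi 0, matterFlux g T u r) ∧
      -- consequences of the dominant energy condition
      (DominantEnergy g T u →
        (∀ r > 0, ∀ x, 0 ≤ matterDensity g T u r x) ∧
        IntegrableOn (geomFlux g u) (Set.Ioi 0) ∧
        IntegrableOn (matterFlux g T u) (Set.Ioi 0) ∧
        16 * Real.pi * E =
          (∫ r in Set.Ioi 0, geomFlux g u r) + ∫ r in Set.Ioi 0, matterFlux g T u r ∧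
        0 ≤ E) := by
  have hlim := hasym.tendsto_integral_conePotential hg hI hu
  have hlim0 := hvertex.tendsto_integral_conePotential hg hI hu
  refine ⟨⟨_, massAspect n m M u, hasym.isBondiMassAspect hg hI hu, rfl⟩, ?_⟩
  rintro E ⟨M', hM', rfl⟩
  rw [hasym.eq_massAspect hg hI hu hM']
  set e := ∫ x, massAspect n m M u x ∂sphereArea with he
  -- The factor 4 matches the limit 4M' of the cone potential at infinity.
  have hE16 : 16 * Real.pi * (1 / (4 * Real.pi) * e) = 4 * e := by
    have := Real.pi_ne_zero
    field_simp
    norm_num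
  rw [hE16]
  have hgeo : ∀ r > 0, ∀ x, 0 ≤ geomDensity g u r x := fun r hr x =>
    hg.geomDensity_nonneg hI hu hr x
  have hgeo' : ∀ r > 0, 0 ≤ geomFlux g u r := fun r hr => integral_nonneg (hgeo r hr)
  have cg := hg.continuousOn_geomFlux hI hu hE
  have cm := hg.continuousOn_matterFlux hI hu hE
  have hmain : Tendsto (fun p : ℝ × ℝ =>
      (∫ r in p.1..p.2, geomFlux g u r) + ∫ r in p.1..p.2, matterFlux g T u r)
      (𝓝[>] 0 ×ˢ atTop) (𝓝 (4 * e)) := by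
    have h := (hlim.comp (tendsto_snd (f := 𝓝[>] (0 : ℝ)))).sub
      (hlim0.comp (tendsto_fst (g := (atTop : Filter ℝ))))
    rw [sub_zero] at h
    refine h.congr' ?_
    filter_upwards [tendsto_fst.eventually (self_mem_nhdsWithin : Set.Ioi (0 : ℝ) ∈ 𝓝[>] 0),
      tendsto_snd.eventually (eventually_gt_atTop (0 : ℝ))] with p h1 h2
    exact (hg.integral_flux hI hu hE h1 h2).symm
  have hseq := hmain.comp tendsto_inv_succ
  have hsep : IntegrableOn (matterFlux g T u) (Set.Ioi 0) →
      IntegrableOn (geomFlux g u) (Set.Ioi 0) ∧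
      4 * e = (∫ r in Set.Ioi 0, geomFlux g u r) + ∫ r in Set.Ioi 0, matterFlux g T u r := by
    intro hm
    have h1 := tendsto_of_integrableOn hm
    -- The truncated geometric integrals are the truncated sums minus the truncated matter
    -- integrals, so they converge; non-negativity then gives integrability.
    have h2 : IntegrableOn (geomFlux g u) (Set.Ioi 0) :=
      integrableOn_of_tendsto cg hgeo' ((hseq.sub h1).congr fun k => by simp)
    exact ⟨h2, tendsto_nhds_unique hseq ((tendsto_of_integrableOn h2).add h1)⟩
  refine ⟨hgeo, hmain, hsep, fun hD => ?_⟩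
  have hmat : ∀ r > 0, ∀ x, 0 ≤ matterDensity g T u r x := fun r hr x =>
    hg.matterDensity_nonneg hI hu hT hD hr x
  have hmat' : ∀ r > 0, 0 ≤ matterFlux g T u r := fun r hr => integral_nonneg (hmat r hr)
  -- With both integrands non-negative, convergence of the truncated sums makes the sum integrable,
  -- and the sum dominates the matter flux. No integrability of the matter terms has to be assumed.
  have hsum : IntegrableOn (fun r => geomFlux g u r + matterFlux g T u r) (Set.Ioi 0) := by
    refine integrableOn_of_tendsto (cg.add cm) (fun r hr => add_nonneg (hgeo' r hr) (hmat' r hr))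
      (hseq.congr fun k => ?_)
    have hk : (0 : ℝ) < ((k : ℝ) + 1)⁻¹ := by positivity
    have hsub : Set.uIcc ((k : ℝ) + 1)⁻¹ ((k : ℝ) + 1) ⊆ Set.Ioi 0 := fun s hs =>
      (lt_min hk (by positivity)).trans_le hs.1
    exact (intervalIntegral.integral_add (cg.mono hsub).intervalIntegrable
      (cm.mono hsub).intervalIntegrable).symm
  have hm : IntegrableOn (matterFlux g T u) (Set.Ioi 0) := by
    refine hsum.mono' (cm.aestronglyMeasurable measurableSet_Ioi)
      ((ae_restrict_iff' measurableSet_Ioi).2 (Eventually.of_forall fun r hr => ?_))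
    rw [Real.norm_eq_abs, abs_of_nonneg (hmat' r hr)]
    linarith [hgeo' r hr]
  obtain ⟨h1, h2⟩ := hsep hm
  refine ⟨hmat, h1, hm, h2, ?_⟩
  have h3 := setIntegral_nonneg (μ := volume) measurableSet_Ioi hgeo'
  have h4 := setIntegral_nonneg (μ := volume) measurableSet_Ioi hmat'
  have h5 : 0 ≤ e := by linarith
  have := Real.pi_pos
  positivity
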